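/- Let $T>0$, $d\ge 1$, $p>1$, $q=p/(p-1)$, and let $\mathcal X=C_0([0,T];\mathbb R^d)$ be the space of continuous paths starting at $0$, with the supremum norm, its Borel $\sigma$-algebra, the canonical process $X$, and $(\mathcal F_t)$ the right-continuous version of its natural filtration. Write $|\cdot|$ and $|\cdot|_*$ for the $l_p$- and $l_q$-norms on $\mathbb R^d$. **Transport cost.** For $\omega,\eta\in\mathcal X$ let $c(\omega,\eta)=\|\omega-\eta\|_{W^{1,p}_0}^p=\int_0^T|\dot\omega_t-\dot\eta_t|^p\,dt$ if $\omega-\eta\in W^{1,p}_0$, and $c(\omega,\eta)=+\infty$ otherwise. For Borel probability measures $\mu,\nu$ on $\mathcal X$ let $d_{\mathfrak c}(\mu,\nu)=\inf_\pi E_\pi[c(X,Y)]$, the infimum being over the causal couplings, i.e. the $\pi(dx,dy)=\mu(dx)\,\pi_y(x,dy)$ with marginals $\mu,\nu$ such that $x\mapsto\pi_y(x,U)$ is measurable for the $\mu$-completion of $\mathcal F_t$, for all $t\in[0,T]$ and $U\in\mathcal F_t$ (with $\inf\emptyset=+\infty$). **Penalty.** Let $L:[0,\infty)\to[0,\infty]$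 be lower semicontinuous (for instance continuous, or $L=+\infty\mathbf 1_{(1,\infty)}$) and non-decreasing with $L(0)=0$ and $\lim_{u\to\infty}L(u)/u^p=+\infty$. Put $L_\delta(w)=\delta L(w/\delta)$ for $\delta>0$, $L_0(0)=0$, $L_0(w)=+\infty$ for $w>0$, $L_\delta(\infty)=+\infty$, and $L^*(v)=\sup_{u\ge0}\{uv-L(u)\}$. **Functional.** Let $f:\mathcal X\to\mathbb R$ belong to $\mathbb D^1_b$: $f$ has an extension $\tilde f$ to the space $D([0,T];\mathbb R^d)$ of càdlàg paths and there is $\mathbb D\tilde f:[0,T]\times D([0,T];\mathbb R^d)\to\mathbb R^d$ with $$\langle\mathbb D_t\tilde f(\omega),e\rangle=\lim_{\varepsilon\to0}\frac{\tilde f(\omega+\varepsilon e\mathbf 1_{[t,T]})-\tilde f(\omega)}{\varepsilon}\qquad\text{for all }t,\omega,e,$$ such that $\tilde f$ and each $\mathbb D_t\tilde f$ are continuous for the uniform topology, $\mathbb D\tilde f$ is bounded on $[0,T]\times\{\|\omega\|_\infty\le K\}$ for every $K$, and for all $(t,\omega)$ there is a single limit of $\mathbb D_{t^n}\tilde f(\omega^n)$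 whenever $t^n\to t$, $t^n<t$, and $\omega^n\to\omega$ uniformly. Let $\mathbb D_tf$ be the restriction of $\mathbb D_t\tilde f$ to $\mathcal X$ (the pathwise Malliavin derivative). Assume that for some constant $C$, $|f(\omega)|\le C(1+\|\omega\|_\infty^p)$ and $|\mathbb D_tf(\omega)|\le C(1+\|\omega\|_\infty^{p-1})$ for all $\omega\in\mathcal X$, $t\in[0,T]$. **Theorem.** Let $\mu$ be a Borel probability measure on $\mathcal X$ with $E_\mu[\sup_{t\in[0,T]}|X_t|^p]<\infty$, and for $\delta\ge0$ let $$V(\delta)=\sup_{\nu}\bigl\{E_\nu[f(X)]-L_\delta\bigl(d_{\mathfrak c}(\mu,\nu)^{1/p}\bigr)\bigr\},$$ the supremum being over all Borel probability measures $\nu$ on $\mathcal X$, where a $\nu$ with infinite penalty contributes $-\infty$. Then $V(0)=E_\mu[f(X)]$, $V(\delta)$ is finite for all small $\delta$, and as $\delta\downarrow0$ $$V(\delta)=V(0)+\Upsilon\delta+o(\delta),\qquad \Upsilon=\lim_{\delta\downarrow0}\frac{V(\delta)-V(0)}{\delta}=L^*\bigl(\|{}^{\mathrm o}\mathbb Df\|_{L^q(\mu)}\bigr)=L^*\Bigl(\Bigl(\int_0^TE_\mu\bigl[\bigl|E_\mu[\mathbb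 D_tf(X)\mid\mathcal F_t]\bigr|_*^q\bigr]dt\Bigr)^{1/q}\Bigr)\in\mathbb R .$$ Here ${}^{\mathrm o}A$ denotes the optional projection of a process $A$ with respect to $\mu$ and the $\mu$-completion of $(\mathcal F_t)$, i.e. the optional process (measurable for the $\sigma$-algebra generated by the càdlàg adapted processes) such that ${}^{\mathrm o}A_\tau=E_\mu[A_\tau\mid\mathcal F_\tau]$ a.s. for every $[0,T]$-valued stopping time $\tau$, and $\|A\|_{L^q(\mu)}=\bigl(\int_0^TE_\mu[|A_t|_*^q]\,dt\bigr)^{1/q}$. -/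

import Mathlib

open MeasureTheory ProbabilityTheory Filter Topology Set
open scoped NNReal ENNReal

noncomputable section

namespace CausalDRO

/-! ### Path spaces -/

/-- The space `C₀([0,T]; ℝ^d)` of continuous paths starting at `0`, with the supremum norm. -/
def pathSubmodule (T : ℝ) (d : ℕ) : Submodule ℝ C(Icc (0 : ℝ) T, Fin d → ℝ) where
  carrier := {ω | ∀ t : Icc (0 : ℝ) T, (t : ℝ) = 0 → ω t = 0}
  add_mem' := by
    intro a b ha hb t ht
    simp [ha t ht, hb t ht]
  zero_mem' := by
    intro t _
    rfl
  smul_mem' := by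
    intro c a ha t ht
    simp [ha t ht]

def PathSpace (T : ℝ) (d : ℕ) : Type := pathSubmodule T d

instance instNormedAddCommGroupPathSpace (T : ℝ) (d : ℕ) : NormedAddCommGroup (PathSpace T d) :=
  inferInstanceAs (NormedAddCommGroup (pathSubmodule T d))

instance instNormedSpacePathSpace (T : ℝ) (d : ℕ) : NormedSpace ℝ (PathSpace T d) :=
  inferInstanceAs (NormedSpace ℝ (pathSubmodule T d))

/-- The path space carries the Borel σ-algebra of the supremum norm. -/
instance instMeasurableSpacePathSpace (T : ℝ) (d : ℕ) : MeasurableSpace (PathSpace T d) :=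
  borel (PathSpace T d)

instance instBorelSpacePathSpace (T : ℝ) (d : ℕ) : BorelSpace (PathSpace T d) := ⟨rfl⟩

/-- Right continuity and existence of left limits at every point. -/
def IsCadlag {T : ℝ} {E : Type*} [TopologicalSpace E] (ω : Icc (0 : ℝ) T → E) : Prop :=
  ∀ t, ContinuousWithinAt ω (Ici t) t ∧ ∃ l, Tendsto ω (𝓝[<] t) (𝓝 l)

/-- The space `D([0,T]; ℝ^d)` of càdlàg paths. -/
def cadlagSubmodule (T : ℝ) (d : ℕ) : Submodule ℝ (Icc (0 : ℝ) T → Fin d → ℝ) where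
  carrier := {ω | IsCadlag ω}
  add_mem' := by
    intro a b ha hb t
    obtain ⟨ha1, l, hl⟩ := ha t
    obtain ⟨hb1, m, hm⟩ := hb t
    exact ⟨ha1.add hb1, l + m, hl.add hm⟩
  zero_mem' := fun _ => ⟨continuousWithinAt_const, 0, tendsto_const_nhds⟩
  smul_mem' := by
    intro c a ha t
    obtain ⟨ha1, l, hl⟩ := ha t
    exact ⟨ha1.const_smul c, c • l, hl.const_smul c⟩

abbrev CadlagSpace (T : ℝ) (d : ℕ) : Type := cadlagSubmodule T d

/-- The inclusion of `C₀([0,T]; ℝ^d)` into `D([0,T]; ℝ^d)`. -/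
def PathSpace.toCadlag {T : ℝ} {d : ℕ} (ω : PathSpace T d) : CadlagSpace T d :=
  ⟨fun t => ω.1 t, fun t => ⟨ω.1.continuous.continuousWithinAt, ω.1 t,
    (ω.1.continuous.tendsto t).mono_left nhdsWithin_le_nhds⟩⟩

/-- The step path `e 1_{[t,T]}`. -/
def stepPath {T : ℝ} {d : ℕ} (t : Icc (0 : ℝ) T) (e : Fin d → ℝ) : CadlagSpace T d :=
  ⟨fun s => if t ≤ s then e else 0, by
    intro s
    constructor
    · rcases le_or_gt t s with h | h
      · refine (continuousWithinAt_const (b := e)).congr (fun r hr => ?_) ?_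
        · exact if_pos (h.trans hr)
        · exact if_pos h
      · refine ContinuousAt.continuousWithinAt ?_
        refine (continuousAt_const (y := (0 : Fin d → ℝ))).congr ?_
        filter_upwards [Iio_mem_nhds h] with r hr
        exact (if_neg (not_le.mpr hr)).symm
    · rcases lt_or_ge t s with h | h
      · refine ⟨e, tendsto_const_nhds.congr' ?_⟩
        filter_upwards [mem_nhdsWithin_of_mem_nhds (Ioi_mem_nhds h)] with r hr
        exact (if_pos (le_of_lt hr)).symm
      · refine ⟨0, tendsto_const_nhds.congr' ?_⟩
        filter_upwards [self_mem_nhdsWithin] with r hr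
        exact (if_neg (not_le.mpr (lt_of_lt_of_le hr h))).symm⟩

/-- Uniform convergence of a sequence of càdlàg paths. -/
def UniformlyTendsto {T : ℝ} {d : ℕ} (ωs : ℕ → CadlagSpace T d) (ω : CadlagSpace T d) : Prop :=
  TendstoUniformly (fun n s => (ωs n).1 s) (fun s => ω.1 s) atTop

/-! ### The pathwise Malliavin derivative -/

/-- Continuity of a functional on `D([0,T]; ℝ^d)` for the uniform topology (which is metrizable, so
sequences suffice). -/
def UniformlyContinuousFunctional {T : ℝ} {d : ℕ} {E : Type*} [TopologicalSpace E]
    (F : CadlagSpace T d → E) : Prop :=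
  ∀ (ωs : ℕ → CadlagSpace T d) (ω : CadlagSpace T d), UniformlyTendsto ωs ω →
    Tendsto (fun n => F (ωs n)) atTop (𝓝 (F ω))

/-- `DF` is the pathwise Malliavin derivative of the functional `F` on `D([0,T]; ℝ^d)`. -/
def IsPathwiseMalliavinDerivative {T : ℝ} {d : ℕ} (F : CadlagSpace T d → ℝ)
    (DF : Icc (0 : ℝ) T → CadlagSpace T d → Fin d → ℝ) : Prop :=
  ∀ (t : Icc (0 : ℝ) T) (ω : CadlagSpace T d) (e : Fin d → ℝ),
    Tendsto (fun ε : ℝ => (F (ω + ε • stepPath t e) - F ω) / ε) (𝓝[≠] 0)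
      (𝓝 (∑ i, DF t ω i * e i))

/-- `F(tⁿ, ωⁿ)` converges, to a limit depending on `(t, ω)` only, whenever `tⁿ` tends to `t` from
the left and `ωⁿ` tends uniformly to `ω`. -/
def HasLeftLimits {T : ℝ} {d : ℕ} {E : Type*} [TopologicalSpace E]
    (F : Icc (0 : ℝ) T → CadlagSpace T d → E) : Prop :=
  ∀ (t : Icc (0 : ℝ) T) (ω : CadlagSpace T d), ∃ l : E,
    ∀ (ts : ℕ → Icc (0 : ℝ) T) (ωs : ℕ → CadlagSpace T d),
      Tendsto ts atTop (𝓝[<] t) → UniformlyTendsto ωs ω →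
        Tendsto (fun n => F (ts n) (ωs n)) atTop (𝓝 l)

def BoundednessPreserving {T : ℝ} {d : ℕ} {E : Type*} [Norm E]
    (F : Icc (0 : ℝ) T → CadlagSpace T d → E) : Prop :=
  ∀ K : ℝ, ∃ M : ℝ, ∀ (t : Icc (0 : ℝ) T) (ω : CadlagSpace T d),
    (∀ s, ‖ω.1 s‖ ≤ K) → ‖F t ω‖ ≤ M

/-- `f` belongs to `𝔻¹_b` and `Df` is its pathwise Malliavin derivative: `f` has an extension to
the càdlàg path space which is differentiable there, is continuous, and whose derivative is
continuous at every time, has left limits and preserves boundedness; `Df` is the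
restriction of the derivative of that extension to continuous paths. -/
def MemD1b {T : ℝ} {d : ℕ} (f : PathSpace T d → ℝ)
    (Df : Icc (0 : ℝ) T → PathSpace T d → Fin d → ℝ) : Prop :=
  ∃ (F : CadlagSpace T d → ℝ) (DF : Icc (0 : ℝ) T → CadlagSpace T d → Fin d → ℝ),
    (∀ ω : PathSpace T d, F ω.toCadlag = f ω) ∧
    (∀ t (ω : PathSpace T d), DF t ω.toCadlag = Df t ω) ∧
    IsPathwiseMalliavinDerivative F DF ∧
    UniformlyContinuousFunctional F ∧
    (∀ t, UniformlyContinuousFunctional (DF t)) ∧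
    HasLeftLimits DF ∧
    BoundednessPreserving DF

/-! ### Filtrations -/

lemma stronglyMeasurable_eval {T : ℝ} {d : ℕ} (t : Icc (0 : ℝ) T) :
    StronglyMeasurable (fun ω : PathSpace T d => ω.1 t) := by
  have h : Continuous (fun ω : PathSpace T d => ω.1 t) :=
    (continuous_eval_const t).comp continuous_subtype_val
  exact h.measurable.stronglyMeasurable

/-- The right-continuous version `𝓕_t = ⋂_{s > t} σ(X_r : r ≤ s)` (and `𝓕_T = σ(X_r : r ≤ T)`) of
the natural filtration of the canonical process. -/
def canonicalFiltration (T : ℝ) (d : ℕ) :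
    Filtration (Icc (0 : ℝ) T) (instMeasurableSpacePathSpace T d) :=
  (Filtration.natural (fun t (ω : PathSpace T d) => ω.1 t) stronglyMeasurable_eval).rightCont

/-- The completion `^μ𝓕_t`: the Borel sets that agree with a member of `𝓕_t` up to a `μ`-null
set. -/
def completedFiltration {T : ℝ} {d : ℕ} (μ : Measure (PathSpace T d)) :
    Filtration (Icc (0 : ℝ) T) (instMeasurableSpacePathSpace T d) where
  seq t := @eventuallyMeasurableSpace _ (canonicalFiltration T d t) (ae μ) _ ⊓
    instMeasurableSpacePathSpace T d
  mono' := by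
    intro s t hst
    refine inf_le_inf_right _ ?_
    rintro U ⟨U', hU', hUU'⟩
    exact ⟨U', (canonicalFiltration T d).mono hst _ hU', hUU'⟩
  le' _ := inf_le_right

/-! ### Optional projections -/

/-- The optional σ-algebra of a filtration: it is generated by the càdlàg adapted processes. -/
@[reducible] def optionalSigmaAlgebra {T : ℝ} {Ω : Type*} {m : MeasurableSpace Ω}
    (𝓗 : Filtration (Icc (0 : ℝ) T) m) : MeasurableSpace (Icc (0 : ℝ) T × Ω) :=
  ⨆ (Z : Icc (0 : ℝ) T → Ω → ℝ)
    (_ : (∀ t, Measurable[𝓗 t] (Z t)) ∧ ∀ ω, IsCadlag (fun t => Z t ω)),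
    MeasurableSpace.comap (fun x : Icc (0 : ℝ) T × Ω => Z x.1 x.2) inferInstance

/-- `B` is an optional projection of the process `A` for the probability `μ` and filtration `𝓗`:
`B` is optional and `B_τ = E_μ[A_τ | 𝓗_τ]` almost surely for every `[0,T]`-valued stopping
time `τ`. -/
def IsOptionalProjection {T : ℝ} {d : ℕ} {Ω : Type*} {m : MeasurableSpace Ω} (μ : Measure Ω)
    (𝓗 : Filtration (Icc (0 : ℝ) T) m) (A B : Icc (0 : ℝ) T → Ω → Fin d → ℝ) : Prop :=
  Measurable[optionalSigmaAlgebra 𝓗] (fun x : Icc (0 : ℝ) T × Ω => B x.1 x.2) ∧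
  ∀ (τ : Ω → Icc (0 : ℝ) T)
    (hτ : IsStoppingTime 𝓗 (fun ω => ((τ ω : Icc (0 : ℝ) T) : WithTop (Icc (0 : ℝ) T)))),
    (fun ω => B (τ ω) ω) =ᵐ[μ] μ[fun ω => A (τ ω) ω | hτ.measurableSpace]

/-! ### Norms -/

/-- The `l_r`-norm on `ℝ^d`. -/
def lNorm {d : ℕ} (r : ℝ) (x : Fin d → ℝ) : ℝ := (∑ i, |x i| ^ r) ^ (1 / r)

/-- `‖A‖_{L^q(μ)} = (∫₀ᵀ E_μ[|A_t|_*^q] dt)^{1/q}`, where `|·|_*` is the `l_q`-norm. -/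
def processNorm {T : ℝ} {d : ℕ} {Ω : Type*} {m : MeasurableSpace Ω} (q : ℝ) (μ : Measure Ω)
    (A : Icc (0 : ℝ) T → Ω → Fin d → ℝ) : ℝ≥0∞ :=
  (∫⁻ t : Icc (0 : ℝ) T, ∫⁻ ω, ENNReal.ofReal (lNorm q (A t ω) ^ q) ∂μ
    ∂((volume : Measure ℝ).comap ((↑) : Icc (0 : ℝ) T → ℝ))) ^ (1 / q)

/-- `‖h‖^p_{W₀^{1,p}} = ∫₀ᵀ |ḣ_t|^p dt` if `h` belongs to `W₀^{1,p}`, and `+∞` otherwise. The weak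
derivative `g` is unique almost everywhere, and the infimum over no `g` is `+∞`. -/
def sobolevCost {T : ℝ} {d : ℕ} (p : ℝ) (h : PathSpace T d) : ℝ≥0∞ :=
  ⨅ (g : ℝ → Fin d → ℝ) (_ : IntegrableOn g (Icc 0 T) ∧
      ∀ t : Icc (0 : ℝ) T, h.1 t = ∫ s in (0 : ℝ)..t, g s),
    ∫⁻ s in Icc 0 T, ENNReal.ofReal (lNorm p (g s) ^ p)

/-! ### Causal optimal transport -/

/-- `π` is a causal coupling from `μ` to `ν`: it has marginals `μ` and `ν`, and it disintegrates as
`π(dx, dy) = μ(dx) κ(x, dy)` where `x ↦ κ(x, U)` is `^μ𝓕_t`-measurable for all `t` and `U ∈ 𝓖_t`.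
(Two disintegrations agree for `μ`-almost every `x`, so the choice of `κ` is immaterial.) -/
def IsCausalCoupling {T : ℝ} {d : ℕ} (μ ν : Measure (PathSpace T d))
    (π : Measure (PathSpace T d × PathSpace T d)) : Prop :=
  π.map Prod.fst = μ ∧ π.map Prod.snd = ν ∧
  ∃ κ : Kernel (PathSpace T d) (PathSpace T d), IsMarkovKernel κ ∧ π = μ ⊗ₘ κ ∧
    ∀ (t : Icc (0 : ℝ) T) (U : Set (PathSpace T d)),
      MeasurableSet[canonicalFiltration T d t] U →
        Measurable[completedFiltration μ t] (fun x => κ x U)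

/-- The causal transport cost `d_c(μ, ν)` for the cost `‖ω - η‖^p_{W₀^{1,p}}`. -/
def causalCost {T : ℝ} {d : ℕ} (p : ℝ) (μ ν : Measure (PathSpace T d)) : ℝ≥0∞ :=
  ⨅ (π : Measure (PathSpace T d × PathSpace T d)) (_ : IsCausalCoupling μ ν π),
    ∫⁻ z, sobolevCost p (z.1 - z.2) ∂π

/-! ### The robust optimization problem -/

/-- `L_δ(w) = δ L(w / δ)`, with `L_δ(∞) = ∞`. At `δ = 0` it is the limit of `L_δ(w)` as `δ ↓ 0` for
`L(0) = 0` and superlinear `L`, that is `0` if `w = 0` and `∞` otherwise. -/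
def penalty (L : ℝ≥0 → ℝ≥0∞) (δ : ℝ≥0) (w : ℝ≥0∞) : ℝ≥0∞ :=
  if w = ⊤ then ⊤
  else if δ = 0 then (if w = 0 then 0 else ⊤)
  else δ * L (w.toNNReal / δ)

/-- `V(δ) = sup_ν { E_ν[f(X)] - L_δ(d_c(μ,ν)^{1/p}) }`, the supremum being over all Borel
probability measures `ν` on the path space; a `ν` with infinite penalty contributes `-∞`. -/
def robustValue {T : ℝ} {d : ℕ} (p : ℝ) (L : ℝ≥0 → ℝ≥0∞) (μ : Measure (PathSpace T d))
    (f : PathSpace T d → ℝ) (δ : ℝ≥0) : EReal :=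
  ⨆ (ν : Measure (PathSpace T d)) (_ : IsProbabilityMeasure ν),
    ((∫ ω, f ω ∂ν : ℝ) : EReal) - ((penalty L δ (causalCost p μ ν ^ (1 / p)) : ℝ≥0∞) : EReal)

/-- The convex conjugate `L*(v) = sup_{u ≥ 0} (u v - L(u))`. -/
def convexConjugate (L : ℝ≥0 → ℝ≥0∞) (v : ℝ≥0∞) : EReal :=
  ⨆ u : ℝ≥0, (((u : ℝ≥0∞) * v : ℝ≥0∞) : EReal) - ((L u : ℝ≥0∞) : EReal)

end CausalDRO

end

namespace CausalDRO

/-! ### Path space -/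

section PathSpaceBasics

variable {T : ℝ} {d : ℕ}

/-! Let π be a coupling of μ and ν with finite cost and H = Y - X. The fundamental theorem of
calculus for the pathwise Malliavin derivative (`IsPathwiseMalliavinDerivative.sub_eq_integral`)
writes f(Y) - f(X) as the time integral of the pairing of D_t f(X + H^t) with the velocity of H at
t, where H^t is H stopped at t. It comes from building H out of small jumps at grid times and
applying the mean value theorem to each jump. By Hölder's inequality D_t f(X + H^t) may be replaced
by D_t f(X) with an error that is small relative to cost^(1/p), uniformly over all couplings with
first marginal μ (`MemD1b.exists_lintegral_derivGap_le`).

Upper bound. The weak derivative is represented by a limit of left difference quotients, so the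
velocity at t depends only on the two paths up to t. Causality makes its conditional mean given X
measurable for the completed 𝓕_t, so D_t f(X) may be replaced by its conditional expectation given
the past (`MemD1b.integral_deriv_inner_leftDeriv`). With Z the norm of the optional projection and w
= d_c^(1/p), Hölder gives E_ν f - E_μ f ≤ (Z + ε) w for small w
(`MemD1b.exists_integral_sub_le_of_lt`).

Lower bound. Equality in Hölder is reached by the velocity dual to the conditional expectation. On a
grid this velocity is frozen at its value at the last node, so X + H is adapted and (X, X + H) is
causal (`isCausalCoupling_map`). Rescaled to cost w^p it gains at least (Z - ε) w
(`MemD1b.exists_measure_le_integral_sub`). The grid energies tend to Z^q because the derivative has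
left limits in time, and because conditional expectations are left-continuous in L^q outside
countably many times (`exists_countable_tendsto_eLpNorm_condExp`).

Penalization. With w = δu the value is to first order δ times the supremum of uZ - L(u), which is δ
L*(Z). For w away from zero only E_ν f - E_μ f ≤ C(w + w^p) is known
(`MemD1b.exists_integral_sub_le`), and the growth of L beyond u^p makes such w unprofitable
(`exists_penalized_le`, `exists_le_penalized`). The norm of a process sees it only at deterministic
times, so every optional projection has the norm Z. -/

instance instSecondCountableTopologyPathSpace (T : ℝ) (d : ℕ) :
    SecondCountableTopology (PathSpace T d) :=
  inferInstanceAs (SecondCountableTopology (pathSubmodule T d))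

/-- Lebesgue measure on `[0,T]`. -/
noncomputable abbrev timeMeasure (T : ℝ) : Measure (Icc (0 : ℝ) T) :=
  (volume : Measure ℝ).comap ((↑) : Icc (0 : ℝ) T → ℝ)

lemma map_coe_timeMeasure (T : ℝ) :
    (timeMeasure T).map (↑) = volume.restrict (Icc (0 : ℝ) T) :=
  map_comap_subtype_coe measurableSet_Icc _

instance instIsFiniteMeasureTimeMeasure (T : ℝ) : IsFiniteMeasure (timeMeasure T) := by
  refine ⟨?_⟩
  rw [(MeasurableEmbedding.subtype_coe (measurableSet_Icc (a := (0 : ℝ)) (b := T))).comap_apply]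
  exact (measure_mono (t := Icc (0 : ℝ) T) (by rintro _ ⟨x, -, rfl⟩; exact x.2)).trans_lt
    measure_Icc_lt_top

lemma timeMeasure_univ (T : ℝ) : timeMeasure T univ = ENNReal.ofReal T := by
  rw [← preimage_univ (f := ((↑) : Icc (0 : ℝ) T → ℝ)),
    ← (MeasurableEmbedding.subtype_coe measurableSet_Icc).map_apply, map_coe_timeMeasure]
  simp

instance instNullSingletonClassTimeMeasure (T : ℝ) : NullSingletonClass (timeMeasure T) := by
  refine ⟨fun x => ?_⟩
  rw [(MeasurableEmbedding.subtype_coe (measurableSet_Icc (a := (0 : ℝ)) (b := T))).comap_apply,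
    image_singleton, measure_singleton]

lemma ae_timeMeasure_iff {T : ℝ} {P : ℝ → Prop} :
    (∀ᵐ t : Icc (0 : ℝ) T ∂timeMeasure T, P t) ↔
      ∀ᵐ t ∂(volume.restrict (Icc (0 : ℝ) T)), P t := by
  rw [← map_coe_timeMeasure, (MeasurableEmbedding.subtype_coe measurableSet_Icc).ae_map_iff]

lemma PathSpace.norm_apply_le (ω : PathSpace T d) (t : Icc (0 : ℝ) T) : ‖ω.1 t‖ ≤ ‖ω‖ :=
  ω.1.norm_coe_le_norm t

lemma PathSpace.norm_le {ω : PathSpace T d} {r : ℝ} (hr : 0 ≤ r) :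
    ‖ω‖ ≤ r ↔ ∀ t, ‖ω.1 t‖ ≤ r :=
  ContinuousMap.norm_le _ hr

lemma PathSpace.apply_zero (ω : PathSpace T d) {t : Icc (0 : ℝ) T} (ht : (t : ℝ) = 0) :
    ω.1 t = 0 :=
  Subtype.property (p := fun ω => ω ∈ pathSubmodule T d) ω t ht

lemma PathSpace.continuous_of_continuous_uncurry {Z : Type*} [TopologicalSpace Z]
    {Φ : Z → PathSpace T d} (h : Continuous fun x : Z × Icc (0 : ℝ) T => (Φ x.1).1 x.2) :
    Continuous Φ :=
  Continuous.subtype_mk (ContinuousMap.continuous_of_continuous_uncurry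
    (fun z => (Φ z).1) h) _

lemma PathSpace.continuous_eval :
    Continuous fun x : PathSpace T d × Icc (0 : ℝ) T => x.1.1 x.2 :=
  ContinuousEval.continuous_eval.comp
    ((continuous_subtype_val.comp continuous_fst).prodMk continuous_snd)

/-- The path `h` stopped at time `t`. -/
def stopPath (t : Icc (0 : ℝ) T) (h : PathSpace T d) : PathSpace T d :=
  ⟨⟨fun s => h.1 (min s t), h.1.continuous.comp (by fun_prop)⟩, fun s hs => h.apply_zero (by
    rw [min_eq_left (Subtype.coe_le_coe.1 (hs.le.trans t.2.1) : s ≤ t), hs])⟩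

lemma stopPath_apply (t s : Icc (0 : ℝ) T) (h : PathSpace T d) :
    (stopPath t h).1 s = h.1 (min s t) := rfl

lemma norm_stopPath_le (t : Icc (0 : ℝ) T) (h : PathSpace T d) : ‖stopPath t h‖ ≤ ‖h‖ :=
  (PathSpace.norm_le (norm_nonneg _)).2 fun _ => h.norm_apply_le _

lemma stopPath_zero (t : Icc (0 : ℝ) T) : stopPath t (0 : PathSpace T d) = 0 := rfl

lemma continuous_stopPath :
    Continuous fun x : Icc (0 : ℝ) T × PathSpace T d => stopPath x.1 x.2 := by
  refine PathSpace.continuous_of_continuous_uncurry ?_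
  exact PathSpace.continuous_eval.comp (f := fun x : (Icc (0 : ℝ) T × PathSpace T d) × Icc (0 : ℝ) T =>
    (x.1.2, min x.2 x.1.1)) (by fun_prop)

end PathSpaceBasics

/-! ### The `r`-th power of the `l_r`-norm -/

section ePow

variable {d : ℕ}

/-- The `r`-th power of the `l_r`-norm. -/
noncomputable def ePow (r : ℝ) (x : Fin d → ℝ) : ℝ≥0∞ := ENNReal.ofReal (lNorm r x ^ r)

/-- The outer power cancels the root in the norm, so estimates reduce to single coordinates and no
triangle inequality for the l_r-norm is needed. -/
lemma ePow_eq_sum {r : ℝ} (hr : 0 < r) (x : Fin d → ℝ) : ePow r x = ∑ i, ‖x i‖ₑ ^ r := by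
  have h0 : 0 ≤ ∑ i, |x i| ^ r := Finset.sum_nonneg fun i _ => by positivity
  rw [ePow, lNorm, ← Real.rpow_mul h0, one_div_mul_cancel hr.ne', Real.rpow_one,
    ENNReal.ofReal_sum_of_nonneg fun i _ => by positivity]
  refine Finset.sum_congr rfl fun i _ => ?_
  rw [← ENNReal.ofReal_rpow_of_nonneg (abs_nonneg _) hr.le, Real.enorm_eq_ofReal_abs]

lemma measurable_ePow {r : ℝ} (hr : 0 < r) : Measurable (ePow r : (Fin d → ℝ) → ℝ≥0∞) := by
  simp only [funext (ePow_eq_sum (d := d) hr)]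
  fun_prop

lemma ePow_neg {r : ℝ} (hr : 0 < r) (x : Fin d → ℝ) : ePow r (-x) = ePow r x := by
  simp [ePow_eq_sum hr]

lemma ePow_zero {r : ℝ} (hr : 0 < r) : ePow r (0 : Fin d → ℝ) = 0 := by
  simp [ePow_eq_sum hr, hr]

lemma ePow_smul {r : ℝ} (hr : 0 < r) (c : ℝ) (x : Fin d → ℝ) :
    ePow r (c • x) = ‖c‖ₑ ^ r * ePow r x := by
  simp [ePow_eq_sum hr, Finset.mul_sum, ENNReal.mul_rpow_of_nonneg _ _ hr.le]

lemma enorm_rpow_le_ePow {r : ℝ} (hr : 0 < r) (x : Fin d → ℝ) : ‖x‖ₑ ^ r ≤ ePow r x := by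
  rw [ePow_eq_sum hr]
  rcases isEmpty_or_nonempty (Fin d) with h | h
  · simp [Subsingleton.elim x 0, hr]
  · obtain ⟨i, hi⟩ : ∃ i, ‖x‖ = ‖x i‖ := by
      obtain ⟨i, -, hi⟩ := Finset.exists_mem_eq_sup' Finset.univ_nonempty (fun i => ‖x i‖₊)
      refine ⟨i, ?_⟩
      rw [← coe_nnnorm, ← coe_nnnorm, Pi.nnnorm_def, ← hi, Finset.sup'_eq_sup]
    have : ‖x‖ₑ = ‖x i‖ₑ := by rw [← ofReal_norm, hi, ofReal_norm]
    rw [this]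
    exact Finset.single_le_sum (f := fun i => ‖x i‖ₑ ^ r) (fun _ _ => zero_le) (Finset.mem_univ i)

lemma ePow_le_enorm_rpow {r : ℝ} (hr : 0 < r) (x : Fin d → ℝ) : ePow r x ≤ d * ‖x‖ₑ ^ r := by
  rw [ePow_eq_sum hr]
  refine (Finset.sum_le_card_nsmul _ _ (‖x‖ₑ ^ r) fun i _ => ?_).trans (by simp)
  exact ENNReal.rpow_le_rpow (by
    rw [← ofReal_norm, ← ofReal_norm]
    exact ENNReal.ofReal_le_ofReal (norm_le_pi_norm x i)) hr.le

/-- Hölder's inequality for vector fields, with `l_q`- and `l_p`-norms on the values. -/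
lemma lintegral_enorm_inner_le {S : Type*} [MeasurableSpace S] (m : Measure S) {p q : ℝ}
    (hpq : q.HolderConjugate p) {a b : S → Fin d → ℝ} (ha : AEMeasurable a m)
    (hb : AEMeasurable b m) :
    ∫⁻ s, ‖∑ i, a s i * b s i‖ₑ ∂m ≤
      (∫⁻ s, ePow q (a s) ∂m) ^ (1 / q) * (∫⁻ s, ePow p (b s) ∂m) ^ (1 / p) := by
  have hA : AEMeasurable (fun s => ePow q (a s) ^ (1 / q)) m :=
    ((measurable_ePow hpq.pos).comp_aemeasurable ha).pow_const _
  have hB : AEMeasurable (fun s => ePow p (b s) ^ (1 / p)) m :=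
    ((measurable_ePow hpq.symm.pos).comp_aemeasurable hb).pow_const _
  have key := ENNReal.lintegral_mul_le_Lp_mul_Lq m hpq hA hB
  simp only [← ENNReal.rpow_mul, one_div_mul_cancel hpq.ne_zero,
    one_div_mul_cancel hpq.symm.ne_zero, ENNReal.rpow_one] at key
  refine le_trans (lintegral_mono fun s => ?_) key
  simp only [Pi.mul_apply]
  rw [ePow_eq_sum hpq.pos, ePow_eq_sum hpq.symm.pos]
  refine (enorm_sum_le _ _).trans ?_
  simp only [enorm_mul]
  exact ENNReal.inner_le_Lp_mul_Lq _ _ _ hpq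

end ePow

/-! ### Weak derivatives -/

section WeakDeriv

variable {T : ℝ} {d : ℕ}

/-- `g` is a weak derivative of the path `h`. -/
def IsWeakDeriv (h : PathSpace T d) (g : ℝ → Fin d → ℝ) : Prop :=
  IntegrableOn g (Icc 0 T) ∧ ∀ t : Icc (0 : ℝ) T, h.1 t = ∫ s in (0 : ℝ)..t, g s

lemma sobolevCost_def (p : ℝ) (h : PathSpace T d) :
    sobolevCost p h = ⨅ (g : ℝ → Fin d → ℝ) (_ : IsWeakDeriv h g),
      ∫⁻ s in Icc 0 T, ePow p (g s) := rfl

/-- The time `t - 1 / (n + 1)`, or `0` if this is negative. -/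
noncomputable def timeBack (n : ℕ) (t : Icc (0 : ℝ) T) : Icc (0 : ℝ) T :=
  ⟨max 0 (t - 1 / (n + 1)), le_max_left _ _, max_le (t.2.1.trans t.2.2)
    ((sub_le_self _ (by positivity)).trans t.2.2)⟩

lemma timeBack_le (n : ℕ) (t : Icc (0 : ℝ) T) : timeBack n t ≤ t :=
  Subtype.coe_le_coe.1 (max_le t.2.1 (sub_le_self _ (by positivity)))

/-- A left difference quotient of the path `h`. -/
noncomputable def diffQuotient (n : ℕ) (t : Icc (0 : ℝ) T) (h : PathSpace T d) : Fin d → ℝ :=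
  (n + 1 : ℝ) • (h.1 t - h.1 (timeBack n t))

/-- The left derivative of a path, with a junk value where it does not exist. -/
noncomputable def leftDeriv (t : Icc (0 : ℝ) T) (h : PathSpace T d) : Fin d → ℝ :=
  limUnder atTop fun n => diffQuotient n t h

lemma continuous_timeBack (n : ℕ) : Continuous (timeBack n : Icc (0 : ℝ) T → Icc (0 : ℝ) T) := by
  unfold timeBack
  fun_prop

lemma continuous_diffQuotient (n : ℕ) :
    Continuous fun x : Icc (0 : ℝ) T × PathSpace T d => diffQuotient n x.1 x.2 := by
  unfold diffQuotient
  have h1 := PathSpace.continuous_eval.comp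
    (f := fun x : Icc (0 : ℝ) T × PathSpace T d => (x.2, x.1)) (by fun_prop)
  have h2 := PathSpace.continuous_eval.comp
    (f := fun x : Icc (0 : ℝ) T × PathSpace T d => (x.2, timeBack n x.1))
    (continuous_snd.prodMk ((continuous_timeBack n).comp continuous_fst))
  exact Continuous.const_smul (M := ℝ) (h1.sub h2) (n + 1 : ℝ)

lemma measurable_leftDeriv :
    Measurable fun x : Icc (0 : ℝ) T × PathSpace T d => leftDeriv x.1 x.2 :=
  (StronglyMeasurable.limUnder fun n => (continuous_diffQuotient n).stronglyMeasurable).measurable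

attribute [irreducible] leftDeriv

lemma measurable_leftDeriv_comp {S : Type*} [MeasurableSpace S] {τ : S → Icc (0 : ℝ) T}
    {H : S → PathSpace T d} (hτ : Measurable τ) (hH : Measurable H) :
    Measurable fun s => leftDeriv (τ s) (H s) := by
  have h := measurable_leftDeriv (T := T) (d := d)
  exact h.comp (hτ.prodMk hH)

/-- By Lebesgue's differentiation theorem the slopes of the primitive converge to g at almost every
t, in particular along t - 1/(n+1). Time 0 is discarded because there is no earlier time to look
back to. This gives one jointly measurable and adapted version of every weak derivative. -/
lemma IsWeakDeriv.leftDeriv_eq {h : PathSpace T d} {g : ℝ → Fin d → ℝ} (hg : IsWeakDeriv h g) :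
    ∀ᵐ t ∂timeMeasure T, leftDeriv t h = g t := by
  rcases lt_or_ge T 0 with hT | hT
  · have : IsEmpty (Icc (0 : ℝ) T) := isEmpty_coe_sort.2 (Icc_eq_empty hT.not_ge)
    exact ae_of_all _ fun t => isEmptyElim t
  have hint : IntervalIntegrable g volume 0 T := by
    rw [intervalIntegrable_iff_integrableOn_Icc_of_le hT]
    exact hg.1
  have h1 := ae_restrict_of_ae (s := Icc (0 : ℝ) T) hint.ae_hasDerivAt_integral
  have h2 : ∀ᵐ t ∂(volume.restrict (Icc (0 : ℝ) T)), t ≠ 0 :=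
    ae_restrict_of_ae (by simp [ae_iff])
  have h3 := (ae_timeMeasure_iff (T := T)).2 (h1.and h2)
  filter_upwards [h3] with t ⟨ht, ht0⟩
  rw [uIcc_of_le hT] at ht
  have hd := (ht t.2 0 ⟨le_rfl, hT⟩)
  have htpos : 0 < (t : ℝ) := lt_of_le_of_ne t.2.1 (Ne.symm ht0)
  have hs := hd.tendsto_slope
  have hlim : Tendsto (fun n : ℕ => (t : ℝ) - 1 / (n + 1)) atTop (𝓝[≠] (t : ℝ)) := by
    refine tendsto_nhdsWithin_iff.2 ⟨?_, Eventually.of_forall fun n => ?_⟩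
    · simpa using tendsto_const_nhds.sub (tendsto_one_div_add_atTop_nhds_zero_nat (𝕜 := ℝ))
    · have : (0 : ℝ) < 1 / (n + 1) := by positivity
      simp only [mem_compl_iff, mem_singleton_iff]
      linarith
  rw [leftDeriv]
  refine Tendsto.limUnder_eq ((hs.comp hlim).congr' ?_)
  have hev : ∀ᶠ n : ℕ in atTop, 0 < (t : ℝ) - 1 / (n + 1) :=
    (tendsto_nhdsWithin_iff.1 hlim).1.eventually (lt_mem_nhds htpos)
  filter_upwards [hev] with n hn
  have hb : ((timeBack n t : Icc (0 : ℝ) T) : ℝ) = t - 1 / (n + 1) := max_eq_right hn.le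
  have hne : (n : ℝ) + 1 ≠ 0 := by positivity
  simp only [Function.comp, slope, vsub_eq_sub, diffQuotient, hg.2, hb]
  rw [show (t : ℝ) - 1 / (n + 1) - t = -(1 / (n + 1)) by ring, inv_neg, one_div, inv_inv,
    neg_smul, ← smul_neg, neg_sub]

/-- The left derivative, as a function of a real time. -/
noncomputable def leftDerivExt (h : PathSpace T d) (s : ℝ) : Fin d → ℝ :=
  if hs : s ∈ Icc (0 : ℝ) T then leftDeriv ⟨s, hs⟩ h else 0

lemma leftDerivExt_coe (h : PathSpace T d) (t : Icc (0 : ℝ) T) :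
    leftDerivExt h t = leftDeriv t h := dif_pos t.2

lemma IsWeakDeriv.leftDerivExt_ae_eq {h : PathSpace T d} {g : ℝ → Fin d → ℝ}
    (hg : IsWeakDeriv h g) : leftDerivExt h =ᵐ[volume.restrict (Icc (0 : ℝ) T)] g := by
  refine (ae_timeMeasure_iff (T := T) (P := fun t => leftDerivExt h t = g t)).1 ?_
  simpa only [leftDerivExt_coe] using hg.leftDeriv_eq

lemma IsWeakDeriv.leftDerivExt {h : PathSpace T d} {g : ℝ → Fin d → ℝ}
    (hg : IsWeakDeriv h g) : IsWeakDeriv h (leftDerivExt h) := by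
  refine ⟨hg.1.congr hg.leftDerivExt_ae_eq.symm, fun t => ?_⟩
  rw [hg.2 t, intervalIntegral.integral_of_le t.2.1, intervalIntegral.integral_of_le t.2.1]
  refine integral_congr_ae (ae_restrict_of_ae_restrict_of_subset ?_ hg.leftDerivExt_ae_eq.symm)
  exact fun s hs => ⟨hs.1.le, hs.2.trans t.2.2⟩

lemma lintegral_Icc_eq (F : ℝ → ℝ≥0∞) :
    ∫⁻ s in Icc 0 T, F s = ∫⁻ t, F t ∂timeMeasure T :=
  (lintegral_subtype_comap measurableSet_Icc F).symm

/-- All weak derivatives agree almost everywhere with the left derivative, so the infimum is over a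
nonempty family of equal numbers. -/
lemma IsWeakDeriv.sobolevCost_eq (p : ℝ) {h : PathSpace T d} {g : ℝ → Fin d → ℝ}
    (hg : IsWeakDeriv h g) : sobolevCost p h = ∫⁻ t, ePow p (leftDeriv t h) ∂timeMeasure T := by
  have key : ∀ g, IsWeakDeriv h g →
      ∫⁻ s in Icc 0 T, ePow p (g s) = ∫⁻ t, ePow p (leftDeriv t h) ∂timeMeasure T := fun g hg => by
    rw [lintegral_Icc_eq]
    refine lintegral_congr_ae ?_
    filter_upwards [hg.leftDeriv_eq] with t ht
    rw [ht]
  rw [sobolevCost_def]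
  exact le_antisymm ((iInf₂_le g hg).trans (key g hg).le)
    (le_iInf₂ fun g' hg' => (key g' hg').ge)

lemma sobolevCost_eq_top (p : ℝ) {h : PathSpace T d} (hh : ¬ ∃ g, IsWeakDeriv h g) :
    sobolevCost p h = ⊤ := by
  rw [sobolevCost_def]
  simp only [iInf_eq_top]
  exact fun g hg => (hh ⟨g, hg⟩).elim

lemma isWeakDeriv_leftDerivExt_of_sobolevCost_lt_top {p : ℝ} {h : PathSpace T d}
    (hh : sobolevCost p h < ⊤) : IsWeakDeriv h (leftDerivExt h) := by
  by_contra hc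
  refine hh.ne (sobolevCost_eq_top p ?_)
  rintro ⟨g, hg⟩
  exact hc hg.leftDerivExt

lemma IsWeakDeriv.neg {h : PathSpace T d} {g : ℝ → Fin d → ℝ} (hg : IsWeakDeriv h g) :
    IsWeakDeriv (-h) (fun s => -g s) := by
  refine ⟨hg.1.neg, fun t => ?_⟩
  rw [intervalIntegral.integral_neg, ← hg.2 t]
  rfl

lemma sobolevCost_neg {p : ℝ} (hp : 0 < p) (h : PathSpace T d) :
    sobolevCost p (-h) = sobolevCost p h := by
  have key : ∀ h : PathSpace T d, sobolevCost p (-h) ≤ sobolevCost p h := fun h => by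
    rw [sobolevCost_def, sobolevCost_def]
    refine le_iInf₂ fun g hg => (iInf₂_le _ hg.neg).trans_eq ?_
    simp only [ePow_neg hp]
  exact le_antisymm (key h) (by simpa using key (-h))

end WeakDeriv

/-! ### Measurability of the Sobolev cost and its comparison with the supremum norm. -/

section SobolevCost

variable {T : ℝ} {d : ℕ}

lemma measurable_leftDerivExt :
    Measurable fun x : ℝ × PathSpace T d => leftDerivExt x.2 x.1 := by
  have hS : MeasurableSet {x : ℝ × PathSpace T d | x.1 ∈ Icc (0 : ℝ) T} :=
    measurable_fst measurableSet_Icc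
  unfold leftDerivExt
  refine Measurable.dite (f := fun x : {x : ℝ × PathSpace T d | x.1 ∈ Icc (0 : ℝ) T} =>
    leftDeriv ⟨x.1.1, x.2⟩ x.1.2) ?_ measurable_const hS
  exact measurable_leftDeriv_comp (measurable_fst.comp measurable_subtype_coe).subtype_mk
    (measurable_snd.comp measurable_subtype_coe)

lemma measurable_lintegral_leftDeriv {F : (Fin d → ℝ) → ℝ≥0∞} (hF : Measurable F) :
    Measurable fun h : PathSpace T d => ∫⁻ t, F (leftDeriv t h) ∂timeMeasure T := by
  have h : Measurable fun x : PathSpace T d × Icc (0 : ℝ) T => F (leftDeriv x.2 x.1) :=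
    hF.comp (measurable_leftDeriv_comp measurable_snd measurable_fst)
  exact h.lintegral_prod_right'

lemma integrableOn_leftDerivExt_iff (h : PathSpace T d) :
    IntegrableOn (leftDerivExt h) (Icc 0 T) ↔ ∫⁻ t, ‖leftDeriv t h‖ₑ ∂timeMeasure T < ⊤ := by
  have hm : AEStronglyMeasurable (leftDerivExt h) (volume.restrict (Icc 0 T)) :=
    (Measurable.of_uncurry_right (f := fun (s : ℝ) (h : PathSpace T d) => leftDerivExt h s)
      measurable_leftDerivExt).aestronglyMeasurable
  have := lintegral_Icc_eq (T := T) (fun s => ‖leftDerivExt h s‖ₑ)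
  simp only [leftDerivExt_coe] at this
  rw [← this]
  exact ⟨fun hi => hi.2, fun hi => ⟨hm, hi⟩⟩

/-- The path and the primitive of its derivative are both continuous, so a countable dense set of
times decides whether they agree. This is what makes the set of weakly differentiable paths
measurable. -/
lemma isWeakDeriv_of_dense (hT : 0 ≤ T) {h : PathSpace T d}
    (hi : IntegrableOn (leftDerivExt h) (Icc 0 T)) {D : Set (Icc (0 : ℝ) T)} (hD : Dense D)
    (hh : ∀ t ∈ D, h.1 t = ∫ s in (0 : ℝ)..t, leftDerivExt h s) :
    IsWeakDeriv h (leftDerivExt h) := by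
  refine ⟨hi, fun t => ?_⟩
  have hint : IntegrableOn (leftDerivExt h) (uIcc 0 T) := by rwa [uIcc_of_le hT]
  have hc := intervalIntegral.continuousOn_primitive_interval hint
  rw [uIcc_of_le hT] at hc
  exact congrFun (Continuous.ext_on hD h.1.continuous hc.domRestrict hh) t

lemma measurableSet_isWeakDeriv (hT : 0 ≤ T) :
    MeasurableSet {h : PathSpace T d | IsWeakDeriv h (leftDerivExt h)} := by
  obtain ⟨D, hDc, hDd⟩ := TopologicalSpace.exists_countable_dense (Icc (0 : ℝ) T)
  have heq : {h : PathSpace T d | IsWeakDeriv h (leftDerivExt h)} =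
      {h | ∫⁻ t, ‖leftDeriv t h‖ₑ ∂timeMeasure T < ⊤} ∩
        ⋂ t ∈ D, {h | h.1 t = ∫ s in (0 : ℝ)..t, leftDerivExt h s} := by
    ext h
    simp only [mem_ofPred_eq, mem_inter_iff, mem_iInter]
    rw [← integrableOn_leftDerivExt_iff]
    exact ⟨fun hw => ⟨hw.1, fun t _ => hw.2 t⟩, fun hw => isWeakDeriv_of_dense hT hw.1 hDd hw.2⟩
  rw [heq]
  refine (measurableSet_lt (measurable_lintegral_leftDeriv measurable_enorm)
    measurable_const).inter (MeasurableSet.biInter hDc fun t _ => ?_)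
  refine measurableSet_eq_fun (stronglyMeasurable_eval t).measurable ?_
  simp only [intervalIntegral.integral_of_le t.2.1]
  refine StronglyMeasurable.measurable ?_
  exact StronglyMeasurable.integral_prod_right' (f := fun x : PathSpace T d × ℝ =>
    leftDerivExt x.1 x.2) (measurable_leftDerivExt.comp measurable_swap).stronglyMeasurable

open Classical in
lemma measurable_sobolevCost (hT : 0 ≤ T) {p : ℝ} (hp : 0 < p) :
    Measurable (sobolevCost p : PathSpace T d → ℝ≥0∞) := by
  have : (sobolevCost p : PathSpace T d → ℝ≥0∞) = fun h =>
      if IsWeakDeriv h (leftDerivExt h) then ∫⁻ t, ePow p (leftDeriv t h) ∂timeMeasure T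
      else ⊤ := by
    funext h
    split_ifs with hh
    · exact hh.sobolevCost_eq p
    · refine sobolevCost_eq_top p ?_
      rintro ⟨g, hg⟩
      exact hh hg.leftDerivExt
  rw [this]
  exact Measurable.ite (measurableSet_isWeakDeriv hT)
    (measurable_lintegral_leftDeriv (measurable_ePow hp)) measurable_const

lemma enorm_le_lintegral_leftDeriv {h : PathSpace T d} (hw : IsWeakDeriv h (leftDerivExt h)) :
    ‖h‖ₑ ≤ ∫⁻ t, ‖leftDeriv t h‖ₑ ∂timeMeasure T := by
  have hfin := (integrableOn_leftDerivExt_iff h).1 hw.1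
  rw [← ofReal_norm, ENNReal.ofReal_le_iff_le_toReal hfin.ne,
    PathSpace.norm_le ENNReal.toReal_nonneg]
  intro t
  rw [hw.2 t, intervalIntegral.integral_of_le t.2.1,
    ← ENNReal.ofReal_le_iff_le_toReal hfin.ne, ofReal_norm]
  refine (enorm_integral_le_lintegral_enorm _).trans ?_
  refine (lintegral_mono_set (t := Icc 0 T) fun s hs => ⟨hs.1.le, hs.2.trans t.2.2⟩).trans ?_
  rw [lintegral_Icc_eq]
  simp only [leftDerivExt_coe, le_refl]

/-- The supremum norm is dominated by the Sobolev cost. -/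
lemma enorm_rpow_le_sobolevCost (hT : 0 < T) {p : ℝ} (hp : 1 < p) (h : PathSpace T d) :
    ‖h‖ₑ ^ p ≤ timeMeasure T univ ^ (p - 1) * sobolevCost p h := by
  -- Positivity of T matters in the infinite case: a vanishing factor would turn the right side into
  -- 0 · ∞ = 0.
  rcases eq_or_ne (sobolevCost p h) ⊤ with htop | htop
  · rw [htop, ENNReal.mul_top]
    · exact le_top
    · refine (ENNReal.rpow_pos ?_ (measure_ne_top _ _)).ne'
      rw [timeMeasure_univ]
      simpa using hT
  have hw := isWeakDeriv_leftDerivExt_of_sobolevCost_lt_top (lt_top_iff_ne_top.2 htop)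
  have hpq := Real.HolderConjugate.conjExponent hp
  have hm : Measurable fun t : Icc (0 : ℝ) T => leftDeriv t h :=
    measurable_leftDeriv_comp measurable_id measurable_const
  -- Hölder against the constant 1 leaves, after raising to the power p, the factor T^(p/q), and p/q
  -- = p - 1.
  have hH := ENNReal.lintegral_mul_le_Lp_mul_Lq (timeMeasure T) hpq (g := 1)
    hm.enorm.aemeasurable measurable_one.aemeasurable
  simp only [Pi.mul_apply, Pi.one_apply, mul_one, ENNReal.one_rpow, lintegral_one] at hH
  have h1 := ENNReal.rpow_le_rpow ((enorm_le_lintegral_leftDeriv hw).trans hH)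
    (zero_le_one.trans hp.le)
  rw [ENNReal.mul_rpow_of_nonneg _ _ (zero_le_one.trans hp.le), ← ENNReal.rpow_mul,
    ← ENNReal.rpow_mul, one_div_mul_cancel hpq.ne_zero, ENNReal.rpow_one,
    one_div_mul_eq_div, hpq.div_conj_eq_sub_one, mul_comm] at h1
  refine h1.trans (mul_le_mul_right ?_ _)
  rw [hw.sobolevCost_eq p]
  exact lintegral_mono fun t => enorm_rpow_le_ePow hpq.pos _

end SobolevCost

/-! ### Uniform time grids -/

section Grid

variable {T : ℝ}

/-- The point `k T / (n + 1)` of the uniform grid on `[0,T]`. -/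
noncomputable def gridNode (hT : 0 ≤ T) (n k : ℕ) : Icc (0 : ℝ) T :=
  projIcc 0 T hT (k * T / (n + 1))

/-- The index of the last point of the uniform grid before `s`. -/
noncomputable def gridIndex (T : ℝ) (n : ℕ) (s : ℝ) : ℕ := ⌈s * (n + 1) / T⌉₊ - 1

lemma measurable_gridIndex (T : ℝ) (n : ℕ) : Measurable (gridIndex T n) := by
  unfold gridIndex
  exact (measurable_from_nat (f := fun k => k - 1)).comp (Nat.measurable_ceil.comp (by fun_prop))

/-- The ceiling minus one makes the cells open on the left and closed on the right, so the grid
point lies strictly before s. Strictness is what allows the use of left limits in time. -/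
lemma gridIndex_spec (hT : 0 < T) (n : ℕ) {s : ℝ} (hs : 0 < s) :
    gridIndex T n s * T / (n + 1) < s ∧ s ≤ (gridIndex T n s + 1) * T / (n + 1) := by
  have hn : (0 : ℝ) < n + 1 := by positivity
  have hx : 0 < s * (n + 1) / T := by positivity
  have hc : 1 ≤ ⌈s * (n + 1) / T⌉₊ := Nat.one_le_ceil_iff.2 hx
  have hcast : ((gridIndex T n s : ℕ) : ℝ) + 1 = ⌈s * (n + 1) / T⌉₊ := by
    rw [gridIndex]
    exact_mod_cast Nat.sub_add_cancel hc
  have h1 : s * (n + 1) / T ≤ ⌈s * (n + 1) / T⌉₊ := Nat.le_ceil _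
  have h2 : (⌈s * (n + 1) / T⌉₊ : ℝ) < s * (n + 1) / T + 1 := Nat.ceil_lt_add_one hx.le
  constructor
  · rw [div_lt_iff₀ hn]
    rw [← hcast, add_lt_add_iff_right, lt_div_iff₀ hT] at h2
    exact h2
  · rw [le_div_iff₀ hn]
    rw [← hcast, div_le_iff₀ hT] at h1
    exact h1

lemma gridIndex_eq (hT : 0 < T) {n k : ℕ} {s : ℝ} (h1 : k * T / (n + 1) < s)
    (h2 : s ≤ (k + 1) * T / (n + 1)) : gridIndex T n s = k := by
  have hn : (0 : ℝ) < n + 1 := by positivity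
  have : ⌈s * (n + 1) / T⌉₊ = k + 1 := by
    rw [Nat.ceil_eq_iff (by simp)]
    rw [div_lt_iff₀ hn, ← lt_div_iff₀ hT] at h1
    rw [le_div_iff₀ hn, ← div_le_iff₀ hT] at h2
    simpa using ⟨h1, h2⟩
  simp [gridIndex, this]

lemma gridIndex_lt (hT : 0 < T) (n : ℕ) {s : ℝ} (hs : s ≤ T) : gridIndex T n s < n + 1 := by
  have hn : (0 : ℝ) < n + 1 := by positivity
  have : ⌈s * (n + 1) / T⌉₊ ≤ n + 1 := by
    refine Nat.ceil_le.2 ?_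
    rw [div_le_iff₀ hT]
    push_cast
    nlinarith
  rw [gridIndex]
  lia

/-- Truncated subtraction puts time 0 into the first cell. -/
lemma gridIndex_zero (T : ℝ) (n : ℕ) : gridIndex T n 0 = 0 := by simp [gridIndex]

lemma coe_gridNode (hT : 0 ≤ T) {n k : ℕ} (hk : k ≤ n + 1) :
    (gridNode hT n k : ℝ) = k * T / (n + 1) := by
  rw [gridNode, projIcc_of_mem hT]
  have hn : (0 : ℝ) < n + 1 := by positivity
  refine ⟨by positivity, ?_⟩
  rw [div_le_iff₀ hn, mul_comm]
  exact mul_le_mul_of_nonneg_left (by exact_mod_cast hk) hT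

/-- The last point of the uniform grid before `t`. -/
noncomputable def gridPoint (hT : 0 ≤ T) (n : ℕ) (t : Icc (0 : ℝ) T) : Icc (0 : ℝ) T :=
  gridNode hT n (gridIndex T n t)

lemma coe_gridPoint (hT : 0 < T) (n : ℕ) (t : Icc (0 : ℝ) T) :
    (gridPoint hT.le n t : ℝ) = gridIndex T n t * T / (n + 1) :=
  coe_gridNode hT.le (gridIndex_lt hT n t.2.2).le

lemma gridPoint_lt (hT : 0 < T) (n : ℕ) {t : Icc (0 : ℝ) T} (ht : 0 < (t : ℝ)) :
    gridPoint hT.le n t < t := by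
  rw [← Subtype.coe_lt_coe, coe_gridPoint hT]
  exact (gridIndex_spec hT n ht).1

lemma tendsto_const_div_add_one (T : ℝ) : Tendsto (fun n : ℕ => T / (n + 1 : ℝ)) atTop (𝓝 0) := by
  simpa [div_eq_mul_inv] using (tendsto_one_div_add_atTop_nhds_zero_nat (𝕜 := ℝ)).const_mul T

lemma tendsto_gridPoint (hT : 0 < T) {t : Icc (0 : ℝ) T} (ht : 0 < (t : ℝ)) :
    Tendsto (fun n => gridPoint hT.le n t) atTop (𝓝[<] t) := by
  refine tendsto_nhdsWithin_iff.2 ⟨?_, Eventually.of_forall fun n => gridPoint_lt hT n ht⟩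
  rw [tendsto_subtype_rng]
  have h : Tendsto (fun n : ℕ => (t : ℝ) - T / (n + 1 : ℝ)) atTop (𝓝 t) := by
    simpa using tendsto_const_nhds.sub (tendsto_const_div_add_one T)
  refine tendsto_of_tendsto_of_tendsto_of_le_of_le h tendsto_const_nhds (fun n => ?_) fun n => ?_
  · have := (gridIndex_spec hT n ht).2
    simp only [coe_gridPoint hT]
    rw [add_mul, add_div, one_mul] at this
    linarith
  · exact (gridPoint_lt hT n ht).le

/-- Sampling at grid points factors through a measurable map to ℕ, on which every function is
measurable. Hence nothing is asked of g, which later allows conditional expectations chosen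
separately at each time. -/
lemma measurable_comp_gridPoint (hT : 0 ≤ T) (n : ℕ) {E : Type*} [MeasurableSpace E]
    (g : Icc (0 : ℝ) T → E) : Measurable fun t => g (gridPoint hT n t) :=
  (measurable_from_nat (f := fun k => g (gridNode hT n k))).comp
    ((measurable_gridIndex T n).comp measurable_subtype_coe)

end Grid

/-! ### Functions with left limits -/

section LeftLimits

/-- A function with left limits differs from them at countably many points only. -/
lemma countable_ne_leftLim {ι E : Type*} [LinearOrder ι] [TopologicalSpace ι] [OrderTopology ι]
    [SecondCountableTopology ι] [MetricSpace E] {g l : ι → E}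
    (hl : ∀ t, Tendsto g (𝓝[<] t) (𝓝 (l t))) : {t | g t ≠ l t}.Countable := by
  have hbad : ∀ m : ℕ, {t | (𝓝[<] t).NeBot ∧ 1 / (m + 1 : ℝ) < dist (g t) (l t)}.Countable := by
    intro m
    set S := {t | (𝓝[<] t).NeBot ∧ 1 / (m + 1 : ℝ) < dist (g t) (l t)} with hS
    -- Each point t of S is isolated in S from the left: just before t, both the values of g and its
    -- left limits are within ε/2 of l t, so the two cannot differ by more than ε there.
    have h := countable_setOfPred_isolated_left_within (s := S)
    refine h.mono ?_
    intro t ht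
    refine ⟨ht, ?_⟩
    set ε : ℝ := 1 / (m + 1 : ℝ) with hε
    have hεpos : 0 < ε := by positivity
    have h1 : ∀ᶠ s in 𝓝[<] t, dist (g s) (l t) < ε / 2 := by
      exact (hl t).eventually (Metric.ball_mem_nhds _ (by positivity))
    have hne := ht.1
    have h2 : ∀ᶠ s in 𝓝[<] t, s ∉ S := by
      obtain ⟨a, ha, hat⟩ : ∃ a < t, ∀ s ∈ Ioo a t, dist (g s) (l t) < ε / 2 := by
        obtain ⟨b, hb⟩ := (self_mem_nhdsWithin : Iio t ∈ 𝓝[<] t) |> hne.nonempty_of_mem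
        obtain ⟨a, ha, hat⟩ := (mem_nhdsLT_iff_exists_Ioo_subset' hb).1 h1
        exact ⟨a, ha, fun s hs => hat hs⟩
      filter_upwards [Ioo_mem_nhdsLT ha] with s hs hsS
      have hsne := hsS.1
      have h3 : ∀ᶠ r in 𝓝[<] s, dist (g r) (l t) ≤ ε / 2 := by
        filter_upwards [Ioo_mem_nhdsLT hs.1] with r hr
        exact (hat r ⟨hr.1, hr.2.trans hs.2⟩).le
      have h4 : dist (l s) (l t) ≤ ε / 2 :=
        le_of_tendsto ((hl s).dist tendsto_const_nhds) h3
      have h5 := dist_triangle_right (g s) (l s) (l t)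
      have h6 := hat s hs
      have h7 := hsS.2
      linarith
    rw [inter_comm, nhdsWithin_inter', inf_principal_eq_bot]
    exact h2
  have h0 : {t : ι | 𝓝[<] t = ⊥}.Countable := countable_setOfPred_isolated_left
  refine (h0.union (countable_iUnion hbad)).mono fun t ht => ?_
  by_cases hne : (𝓝[<] t).NeBot
  · obtain ⟨m, hm⟩ := exists_nat_one_div_lt (dist_pos.2 ht)
    exact Or.inr (mem_iUnion.2 ⟨m, hne, hm⟩)
  · exact Or.inl (not_neBot.1 hne)

variable {T : ℝ} {E : Type*} [NormedAddCommGroup E]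

/-- The left limit is the pointwise limit of the grid samples of g, and g differs from it only on a
countable set. -/
lemma measurable_of_leftLim [MeasurableSpace E] [BorelSpace E] (hT : 0 < T)
    {g l : Icc (0 : ℝ) T → E} (hl : ∀ t, Tendsto g (𝓝[<] t) (𝓝 (l t))) : Measurable g := by
  classical
  -- Nothing lies to the left of 0, so l is arbitrary there, and the value of g is kept instead.
  set l' : Icc (0 : ℝ) T → E := fun t => if (t : ℝ) = 0 then g t else l t with hl'
  have hmeas : Measurable l' := by
    refine measurable_of_tendsto_metrizable (fun n => measurable_comp_gridPoint hT.le n g)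
      (tendsto_pi_nhds.2 fun t => ?_)
    by_cases ht : (t : ℝ) = 0
    · have : ∀ n, gridPoint hT.le n t = t := fun n => by
        apply Subtype.ext
        rw [coe_gridPoint hT, ht, gridIndex_zero]
        simp
      simp [hl', ht, this]
    · simp only [hl', ht, if_false]
      exact (hl t).comp (tendsto_gridPoint hT (lt_of_le_of_ne t.2.1 (Ne.symm ht)))
  refine hmeas.measurable_of_countable_ne ((countable_ne_leftLim hl).mono fun t ht => ?_)
  by_cases h0 : (t : ℝ) = 0
  · simp [hl', h0] at ht
  · simpa [hl', h0, eq_comm] using ht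

lemma ae_tendsto_gridPoint_of_leftLim (hT : 0 < T)
    {g l : Icc (0 : ℝ) T → E} (hl : ∀ t, Tendsto g (𝓝[<] t) (𝓝 (l t))) :
    ∀ᵐ t ∂timeMeasure T, Tendsto (fun n => g (gridPoint hT.le n t)) atTop (𝓝 (g t)) := by
  have h1 : ∀ᵐ t ∂timeMeasure T, g t = l t :=
    ((countable_ne_leftLim hl).measure_zero (timeMeasure T) :)
  have h2 : ∀ᵐ t ∂timeMeasure T, t ≠ (⟨0, le_rfl, hT.le⟩ : Icc (0 : ℝ) T) := by
    simp [ae_iff]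
  filter_upwards [h1, h2] with t ht ht0
  rw [ht]
  refine (hl t).comp (tendsto_gridPoint hT (lt_of_le_of_ne t.2.1 fun h => ht0 ?_))
  exact Subtype.ext h.symm

end LeftLimits

/-! ### Step approximations of a path -/

section StepApproximation

variable {T : ℝ} {d : ℕ}

lemma sum_range_ite_le_telescope {E : Type*} [AddCommGroup E] (H : ℕ → E) (h0 : H 0 = 0)
    (m k : ℕ) :
    ∑ j ∈ Finset.range k, (if j ≤ m then H (j + 1) - H j else 0) = H (min k (m + 1)) := by
  induction k with
  | zero => simp [h0]
  | succ k ih =>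
    rw [Finset.sum_range_succ, ih]
    split_ifs with hk
    · rw [min_eq_left (by lia), min_eq_left (by lia)]
      abel
    · rw [min_eq_right (by lia), min_eq_right (by lia), add_zero]

/-- The increment of the path `h` over the `k`-th interval of the uniform grid. -/
noncomputable def gridIncrement (hT : 0 ≤ T) (n : ℕ) (h : PathSpace T d) (k : ℕ) : Fin d → ℝ :=
  h.1 (gridNode hT n (k + 1)) - h.1 (gridNode hT n k)

/-- The step path with the first `k` increments of `h` on the uniform grid, and the fraction `c` of
the next one. -/
noncomputable def gridPath (hT : 0 ≤ T) (n : ℕ) (h : PathSpace T d) (k : ℕ) (c : ℝ) :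
    CadlagSpace T d :=
  ∑ j ∈ Finset.range k, stepPath (gridNode hT n j) (gridIncrement hT n h j) +
    c • stepPath (gridNode hT n k) (gridIncrement hT n h k)

lemma gridNode_le_iff (hT : 0 < T) {n j : ℕ} (hj : j ≤ n + 1) (u : Icc (0 : ℝ) T) :
    gridNode hT.le n j ≤ u ↔ j ≤ ⌊(u : ℝ) * (n + 1) / T⌋₊ := by
  have hn : (0 : ℝ) < n + 1 := by positivity
  have hu := u.2.1
  rw [← Subtype.coe_le_coe, coe_gridNode hT.le hj, Nat.le_floor_iff (by positivity),
    div_le_iff₀ hn, le_div_iff₀ hT]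

lemma gridNode_zero (hT : 0 ≤ T) (n : ℕ) : (gridNode hT n 0 : ℝ) = 0 := by
  rw [coe_gridNode hT (Nat.zero_le _)]
  simp

/-- The steps present at time u telescope. The step at a node carries the whole increment over the
cell that starts there, which is why the floor is increased by one. -/
lemma gridPath_apply (hT : 0 < T) {n k : ℕ} (hk : k ≤ n + 1) (h : PathSpace T d) (c : ℝ)
    (u : Icc (0 : ℝ) T) :
    (gridPath hT.le n h k c).1 u =
      h.1 (gridNode hT.le n (min k (⌊(u : ℝ) * (n + 1) / T⌋₊ + 1))) +
        c • (if gridNode hT.le n k ≤ u then gridIncrement hT.le n h k else 0) := by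
  have h0 : (fun j => h.1 (gridNode hT.le n j)) 0 = 0 := h.apply_zero (gridNode_zero hT.le n)
  rw [← sum_range_ite_le_telescope (fun j => h.1 (gridNode hT.le n j)) h0]
  simp only [gridPath, Submodule.coe_add, Submodule.coe_smul, Pi.add_apply, Pi.smul_apply,
    AddSubmonoidClass.coe_finsetSum, Finset.sum_apply]
  congr 1
  refine Finset.sum_congr rfl fun j hj => ?_
  have hj' : j ≤ n + 1 := (Finset.mem_range.1 hj).le.trans hk
  simp only [stepPath, gridNode_le_iff hT hj', gridIncrement]

lemma norm_gridIncrement_le (hT : 0 ≤ T) (n : ℕ) (h : PathSpace T d) (k : ℕ) :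
    ‖gridIncrement hT n h k‖ ≤ 2 * ‖h‖ := by
  refine (norm_sub_le _ _).trans ?_
  have h1 := h.norm_apply_le (gridNode hT n (k + 1))
  have h2 := h.norm_apply_le (gridNode hT n k)
  linarith

lemma norm_smul_ite_le {c : ℝ} (hc : c ∈ Icc (0 : ℝ) 1) (P : Prop) [Decidable P]
    (e : Fin d → ℝ) : ‖c • (if P then e else 0)‖ ≤ ‖e‖ := by
  rw [norm_smul, Real.norm_of_nonneg hc.1]
  split_ifs
  · exact mul_le_of_le_one_left (norm_nonneg _) hc.2
  · simp

lemma norm_gridPath_le (hT : 0 < T) {n k : ℕ} (hk : k ≤ n + 1) (h : PathSpace T d) {c : ℝ}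
    (hc : c ∈ Icc (0 : ℝ) 1) (u : Icc (0 : ℝ) T) :
    ‖(gridPath hT.le n h k c).1 u‖ ≤ 3 * ‖h‖ := by
  rw [gridPath_apply hT hk]
  refine (norm_add_le _ _).trans ?_
  have h1 := h.norm_apply_le (gridNode hT.le n (min k (⌊(u : ℝ) * (n + 1) / T⌋₊ + 1)))
  have h2 := (norm_smul_ite_le hc (gridNode hT.le n k ≤ u) (gridIncrement hT.le n h k)).trans
    (norm_gridIncrement_le hT.le n h k)
  linarith

lemma dist_gridNode_succ_le (hT : 0 ≤ T) (n k : ℕ) :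
    dist (gridNode hT n (k + 1)) (gridNode hT n k) ≤ T / (n + 1) := by
  refine (((LipschitzWith.projIcc hT).dist_le_mul _ _).trans ?_)
  rw [NNReal.coe_one, one_mul, Real.dist_eq]
  push_cast
  rw [← sub_div, add_mul, add_sub_cancel_left, one_mul, abs_of_nonneg (by positivity)]

/-- Both points are projections of minima of two times, and the minimum is 1-Lipschitz for the
maximum distance. The two arguments are each off by at most one mesh width. -/
lemma dist_gridNode_min_le (hT : 0 < T) {n k : ℕ} {s u : Icc (0 : ℝ) T}
    (hs : |k * T / (n + 1) - (s : ℝ)| ≤ T / (n + 1)) :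
    dist (gridNode hT.le n (min k (⌊(u : ℝ) * (n + 1) / T⌋₊ + 1))) (min u s) ≤ T / (n + 1) := by
  have hn : (0 : ℝ) < n + 1 := by positivity
  have hm : min u s = projIcc 0 T hT.le (min (s : ℝ) u) := by
    rw [projIcc_of_mem hT.le (x := min (s : ℝ) u) ⟨le_min s.2.1 u.2.1, min_le_of_left_le s.2.2⟩]
    apply Subtype.ext
    rw [min_comm]
    exact (Subtype.mono_coe _).map_min
  have hu : (0 : ℝ) ≤ (u : ℝ) * (n + 1) / T := by
    have := u.2.1
    positivity
  have h1 := Nat.floor_le hu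
  have h2 := Nat.lt_floor_add_one ((u : ℝ) * (n + 1) / T)
  rw [le_div_iff₀ hT, ← div_le_iff₀ hn] at h1
  rw [div_lt_iff₀ hT, ← lt_div_iff₀ hn] at h2
  rw [hm, gridNode]
  refine (((LipschitzWith.projIcc hT.le).dist_le_mul _ _).trans ?_)
  rw [NNReal.coe_one, one_mul, Real.dist_eq]
  have h3 : (((min k (⌊(u : ℝ) * (n + 1) / T⌋₊ + 1) : ℕ) : ℝ)) * T / (n + 1) =
      min (k * T / (n + 1)) ((⌊(u : ℝ) * (n + 1) / T⌋₊ + 1) * T / (n + 1)) := by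
    have hmono : Monotone fun x : ℝ => x * T / (n + 1) := fun x y hxy => by
      simp only
      gcongr
    push_cast
    exact hmono.map_min
  rw [h3]
  refine (abs_min_sub_min_le_max _ _ _ _).trans (max_le hs ?_)
  rw [abs_of_nonneg (by linarith)]
  rw [add_mul, add_div, one_mul]
  linarith

/-- Uniform continuity of h makes a time shift by one mesh width, and a fraction of one increment,
small simultaneously in all parameters. The uniformity in c is needed because mean value points are
not controlled. -/
lemma eventually_norm_gridPath_sub_le (hT : 0 < T) (h : PathSpace T d) {ε : ℝ} (hε : 0 < ε) :
    ∀ᶠ n : ℕ in atTop, ∀ k ≤ n + 1, ∀ s : Icc (0 : ℝ) T,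
      |k * T / (n + 1) - (s : ℝ)| ≤ T / (n + 1) → ∀ c ∈ Icc (0 : ℝ) 1, ∀ u : Icc (0 : ℝ) T,
        ‖(gridPath hT.le n h k c).1 u - (stopPath s h).1 u‖ < ε := by
  have huc := CompactSpace.uniformContinuous_of_continuous h.1.continuous
  obtain ⟨δ, hδ, hh⟩ := Metric.uniformContinuous_iff.1 huc (ε / 2) (by positivity)
  filter_upwards [(tendsto_const_div_add_one T).eventually (gt_mem_nhds hδ)] with n hn k hk s hs c
    hc u
  rw [gridPath_apply hT hk, stopPath_apply, add_sub_right_comm]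
  refine (norm_add_le _ _).trans_lt ?_
  have h1 := hh (lt_of_le_of_lt (dist_gridNode_min_le (u := u) hT hs) hn)
  have h2 := hh (lt_of_le_of_lt (dist_gridNode_succ_le hT.le n k) hn)
  have h3 := norm_smul_ite_le hc (gridNode hT.le n k ≤ u) (gridIncrement hT.le n h k)
  rw [dist_eq_norm] at h1 h2
  change ‖gridIncrement hT.le n h k‖ < ε / 2 at h2
  change ‖h.1 _ - h.1 _‖ < ε / 2 at h1
  linarith

end StepApproximation

/-! ### The fundamental theorem of calculus for the pathwise Malliavin derivative -/

section PathFTC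

variable {T : ℝ} {d : ℕ} {F : CadlagSpace T d → ℝ}
  {DF : Icc (0 : ℝ) T → CadlagSpace T d → Fin d → ℝ}

lemma IsPathwiseMalliavinDerivative.hasDerivAt (hD : IsPathwiseMalliavinDerivative F DF)
    (ω : CadlagSpace T d) (t : Icc (0 : ℝ) T) (e : Fin d → ℝ) (c : ℝ) :
    HasDerivAt (fun c : ℝ => F (ω + c • stepPath t e))
      (∑ i, DF t (ω + c • stepPath t e) i * e i) c := by
  rw [hasDerivAt_iff_tendsto_slope_zero]
  refine (hD t (ω + c • stepPath t e) e).congr fun ε => ?_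
  rw [smul_eq_mul, div_eq_inv_mul, add_smul, add_assoc]

lemma IsPathwiseMalliavinDerivative.exists_mean_value (hD : IsPathwiseMalliavinDerivative F DF)
    (ω : CadlagSpace T d) (t : Icc (0 : ℝ) T) (e : Fin d → ℝ) :
    ∃ c ∈ Icc (0 : ℝ) 1, F (ω + stepPath t e) - F ω =
      ∑ i, DF t (ω + c • stepPath t e) i * e i := by
  obtain ⟨c, hc, hc'⟩ := exists_hasDerivAt_eq_slope (fun c : ℝ => F (ω + c • stepPath t e)) _
    (zero_lt_one' ℝ)
    (fun x _ => (hD.hasDerivAt ω t e x).continuousAt.continuousWithinAt)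
    (fun x _ => hD.hasDerivAt ω t e x)
  refine ⟨c, Ioo_subset_Icc_self hc, ?_⟩
  simpa using hc'.symm

/-- The increments of h are added one at a time, the mean value theorem is used along each jump, and
the differences telescope. -/
lemma exists_sum_eq_of_grid (hD : IsPathwiseMalliavinDerivative F DF) (hT : 0 ≤ T)
    (ω : CadlagSpace T d) (h : PathSpace T d) (n : ℕ) :
    ∃ c : ℕ → ℝ, (∀ k, c k ∈ Icc (0 : ℝ) 1) ∧ ∀ N, F (ω + gridPath hT n h N 0) - F ω =
      ∑ k ∈ Finset.range N, ∑ i, DF (gridNode hT n k) (ω + gridPath hT n h k (c k)) i *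
        gridIncrement hT n h k i := by
  choose c hc hc' using fun k => hD.exists_mean_value (ω + gridPath hT n h k 0)
    (gridNode hT n k) (gridIncrement hT n h k)
  have hsplit : ∀ k r, gridPath hT n h k r =
      gridPath hT n h k 0 + r • stepPath (gridNode hT n k) (gridIncrement hT n h k) := fun k r => by
    simp [gridPath]
  have hsucc : ∀ k, gridPath hT n h (k + 1) 0 =
      gridPath hT n h k 0 + stepPath (gridNode hT n k) (gridIncrement hT n h k) := fun k => by
    simp [gridPath, Finset.sum_range_succ]
  refine ⟨c, hc, fun N => ?_⟩
  have h0 : ω + gridPath hT n h 0 0 = ω := by simp [gridPath]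
  have := Finset.sum_range_sub (fun k => F (ω + gridPath hT n h k 0)) N
  rw [h0] at this
  rw [← this]
  refine Finset.sum_congr rfl fun k _ => ?_
  rw [hsucc, ← add_assoc, hc' k, hsplit k (c k), add_assoc]

lemma IsWeakDeriv.integrable {h : PathSpace T d} {g : ℝ → Fin d → ℝ} (hg : IsWeakDeriv h g) :
    Integrable (fun t : Icc (0 : ℝ) T => g t) (timeMeasure T) := by
  have := hg.1
  rw [IntegrableOn, ← map_coe_timeMeasure] at this
  exact (MeasurableEmbedding.subtype_coe measurableSet_Icc).integrable_map_iff.1 this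

lemma norm_inner_le_mul {M : ℝ} {x y : Fin d → ℝ} (hx : ‖x‖ ≤ M) :
    ‖∑ i, x i * y i‖ ≤ d * M * ‖y‖ := by
  refine (norm_sum_le _ _).trans ((Finset.sum_le_card_nsmul _ _ (M * ‖y‖) fun i _ => ?_).trans ?_)
  · rw [norm_mul]
    exact mul_le_mul ((norm_le_pi_norm x i).trans hx) (norm_le_pi_norm y i) (norm_nonneg _)
      ((norm_nonneg _).trans hx)
  · simp [mul_assoc]

lemma gridIncrement_eq_integral (hT : 0 ≤ T) {h : PathSpace T d} {g : ℝ → Fin d → ℝ}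
    (hg : IsWeakDeriv h g) {n k : ℕ} (hk : k < n + 1) :
    gridIncrement hT n h k = ∫ s in (k * T / (n + 1))..((k + 1) * T / (n + 1)), g s := by
  have hint : IntervalIntegrable g volume 0 T := by
    rw [intervalIntegrable_iff_integrableOn_Icc_of_le hT]
    exact hg.1
  have hsub : ∀ j ≤ n + 1, IntervalIntegrable g volume 0 (j * T / (n + 1)) := fun j hj => by
    have := (gridNode hT n j).2
    rw [coe_gridNode hT hj] at this
    refine hint.mono_set ?_
    rw [uIcc_of_le hT, uIcc_of_le this.1]
    exact Icc_subset_Icc_right this.2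
  have h1 := hsub (k + 1) hk
  push_cast at h1
  rw [gridIncrement, hg.2, hg.2, coe_gridNode hT hk, coe_gridNode hT hk.le]
  push_cast
  exact intervalIntegral.integral_interval_sub_left h1 (hsub k hk.le)

lemma integral_timeMeasure (hT : 0 ≤ T) (φ : ℝ → ℝ) :
    ∫ t, φ t ∂timeMeasure T = ∫ s in (0 : ℝ)..T, φ s := by
  rw [integral_subtype_comap measurableSet_Icc, intervalIntegral.integral_of_le hT,
    integral_Icc_eq_integral_Ioc]

/-- An increment is the integral of the velocity over its cell, where the coefficient is constant.
In integral form the sum is accessible to dominated convergence. -/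
lemma gridSum_eq_integral (hT : 0 < T) {h : PathSpace T d} {g : ℝ → Fin d → ℝ}
    (hg : IsWeakDeriv h g) (n : ℕ) (A : ℕ → Fin d → ℝ) :
    ∑ k ∈ Finset.range (n + 1), ∑ i, A k i * gridIncrement hT.le n h k i =
      ∫ t, ∑ i, A (gridIndex T n t) i * g t i ∂timeMeasure T := by
  rw [integral_timeMeasure hT.le (fun s => ∑ i, A (gridIndex T n s) i * g s i)]
  have hint : IntervalIntegrable g volume 0 T := by
    rw [intervalIntegrable_iff_integrableOn_Icc_of_le hT.le]
    exact hg.1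
  have hn : (0 : ℝ) < n + 1 := by positivity
  have hmono : ∀ k : ℕ, (k : ℝ) * T / (n + 1) ≤ ((k + 1 : ℕ) : ℝ) * T / (n + 1) := fun k => by
    push_cast
    gcongr
    linarith
  have hsub : ∀ k < n + 1, IntervalIntegrable g volume (k * T / (n + 1))
      (((k + 1 : ℕ) : ℝ) * T / (n + 1)) := fun k hk => by
    have h1 := (gridNode hT.le n k).2
    have h2 := (gridNode hT.le n (k + 1)).2
    rw [coe_gridNode hT.le hk.le] at h1
    rw [coe_gridNode hT.le hk] at h2
    refine hint.mono_set ?_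
    rw [uIcc_of_le hT.le, uIcc_of_le (hmono k)]
    exact Icc_subset_Icc h1.1 h2.2
  have hcongr : ∀ k, EqOn (fun s => ∑ i, A k i * g s i)
      (fun s => ∑ i, A (gridIndex T n s) i * g s i)
      (Ioc (k * T / (n + 1)) (((k + 1 : ℕ) : ℝ) * T / (n + 1))) := fun k s hs => by
    have h2 := hs.2
    push_cast at h2
    simp only [gridIndex_eq hT hs.1 h2]
  have hcoord : ∀ k < n + 1, ∀ i, IntervalIntegrable (fun s => A k i * g s i) volume
      (k * T / (n + 1)) (((k + 1 : ℕ) : ℝ) * T / (n + 1)) := fun k hk i => by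
    have := hsub k hk
    exact ⟨(Integrable.eval this.1 i).const_mul _, (Integrable.eval this.2 i).const_mul _⟩
  have hsum : ∀ k < n + 1, IntervalIntegrable (fun s => ∑ i, A k i * g s i) volume
      (k * T / (n + 1)) (((k + 1 : ℕ) : ℝ) * T / (n + 1)) := fun k hk => by
    have := IntervalIntegrable.sum Finset.univ (fun i _ => hcoord k hk i)
    simpa [Finset.sum_fn] using this
  have hadj := intervalIntegral.sum_integral_adjacent_intervals (μ := volume)
    (f := fun s => ∑ i, A (gridIndex T n s) i * g s i) (a := fun k : ℕ => (k : ℝ) * T / (n + 1))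
    (n := n + 1) (fun k hk => (hsum k hk).congr (by
      rw [uIoc_of_le (hmono k)]
      exact hcongr k))
  have hend : ((n + 1 : ℕ) : ℝ) * T / (n + 1) = T := by
    push_cast
    field_simp
  simp only [hend, Nat.cast_zero, zero_mul, zero_div] at hadj
  rw [← hadj]
  refine Finset.sum_congr rfl fun k hk => ?_
  have hk' := Finset.mem_range.1 hk
  have hcongr' := intervalIntegral.integral_congr_ae (μ := volume)
    (f := fun s => ∑ i, A k i * g s i) (g := fun s => ∑ i, A (gridIndex T n s) i * g s i)
    (a := k * T / (n + 1)) (b := ((k + 1 : ℕ) : ℝ) * T / (n + 1)) (ae_of_all _ fun s hs => by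
      rw [uIoc_of_le (hmono k)] at hs
      exact hcongr k hs)
  rw [← hcongr', intervalIntegral.integral_finsetSum fun i _ => hcoord k hk' i]
  refine Finset.sum_congr rfl fun i _ => ?_
  rw [intervalIntegral.integral_const_mul, gridIncrement_eq_integral hT.le hg hk']
  congr 1
  push_cast
  have h3 := hsub k hk'
  push_cast at h3
  exact ((ContinuousLinearMap.proj (R := ℝ) (φ := fun _ : Fin d => ℝ) i).intervalIntegral_comp_comm
    h3).symm

end PathFTC

/-! ### Passage to the limit along refining grids. -/

section PathFTC

variable {T : ℝ} {d : ℕ} {F : CadlagSpace T d → ℝ}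
  {DF : Icc (0 : ℝ) T → CadlagSpace T d → Fin d → ℝ}

lemma uniformlyTendsto_add_gridPath (hT : 0 < T) (ω h : PathSpace T d) (s : Icc (0 : ℝ) T)
    {k : ℕ → ℕ} {c : ℕ → ℝ} (hk : ∀ n, k n ≤ n + 1)
    (hs : ∀ n : ℕ, |k n * T / (n + 1) - (s : ℝ)| ≤ T / (n + 1)) (hc : ∀ n, c n ∈ Icc (0 : ℝ) 1) :
    UniformlyTendsto (fun n => ω.toCadlag + gridPath hT.le n h (k n) (c n))
      (ω + stopPath s h).toCadlag := by
  refine Metric.tendstoUniformly_iff.2 fun ε hε => ?_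
  filter_upwards [eventually_norm_gridPath_sub_le hT h hε] with n hn u
  have := hn (k n) (hk n) s (hs n) (c n) (hc n) u
  rw [dist_comm, dist_eq_norm]
  refine lt_of_eq_of_lt (congrArg norm ?_) this
  change (ω.1 u + (gridPath hT.le n h (k n) (c n)).1 u) - (ω.1 u + (stopPath s h).1 u) = _
  abel

lemma uniformlyTendsto_toCadlag {ωs : ℕ → PathSpace T d} {ω : PathSpace T d}
    (h : Tendsto ωs atTop (𝓝 ω)) :
    UniformlyTendsto (fun n => (ωs n).toCadlag) ω.toCadlag := by
  refine Metric.tendstoUniformly_iff.2 fun ε hε => ?_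
  filter_upwards [(Metric.tendsto_nhds.1 h) ε hε] with n hn u
  rw [dist_comm] at hn
  rw [dist_eq_norm] at hn ⊢
  exact ((ω - ωs n).norm_apply_le u).trans_lt hn

/-- The left limits of a path-dependent functional along stopped perturbations. -/
lemma HasLeftLimits.tendsto_stopPath (hl : HasLeftLimits DF) (ω h : PathSpace T d) :
    ∃ l : Icc (0 : ℝ) T → Fin d → ℝ, ∀ t,
      Tendsto (fun s => DF s (ω + stopPath s h).toCadlag) (𝓝[<] t) (𝓝 (l t)) ∧
      ∀ (ts : ℕ → Icc (0 : ℝ) T) (ωs : ℕ → CadlagSpace T d), Tendsto ts atTop (𝓝[<] t) →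
        UniformlyTendsto ωs (ω + stopPath t h).toCadlag →
          Tendsto (fun n => DF (ts n) (ωs n)) atTop (𝓝 (l t)) := by
  choose l hl' using fun t => hl t (ω + stopPath t h).toCadlag
  refine ⟨l, fun t => ⟨tendsto_of_seq_tendsto fun ts hts => ?_, hl' t⟩⟩
  refine hl' t ts _ hts (uniformlyTendsto_toCadlag (tendsto_const_nhds.add ?_))
  have hc : Continuous fun s : Icc (0 : ℝ) T => stopPath s h :=
    continuous_stopPath.comp (continuous_id.prodMk continuous_const)
  exact (hc.tendsto t).comp (tendsto_nhdsWithin_iff.1 hts).1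

lemma norm_toCadlag_add_le {K : ℝ} (ω : PathSpace T d) {γ : CadlagSpace T d}
    (hγ : ∀ u, ‖γ.1 u‖ ≤ K) (u : Icc (0 : ℝ) T) : ‖(ω.toCadlag + γ).1 u‖ ≤ ‖ω‖ + K :=
  (norm_add_le _ _).trans (add_le_add (ω.norm_apply_le u) (hγ u))

lemma stopPath_of_eq_right {t : Icc (0 : ℝ) T} (ht : (t : ℝ) = T) (h : PathSpace T d) :
    stopPath t h = h := by
  refine Subtype.ext (ContinuousMap.ext fun s => ?_)
  change h.1 (min s t) = h.1 s
  rw [min_eq_left (Subtype.coe_le_coe.1 (s.2.2.trans_eq ht.symm) : s ≤ t)]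

/-- The fundamental theorem of calculus for the pathwise Malliavin derivative. -/
theorem IsPathwiseMalliavinDerivative.sub_eq_integral (hD : IsPathwiseMalliavinDerivative F DF)
    (hF : UniformlyContinuousFunctional F) (hl : HasLeftLimits DF) (hb : BoundednessPreserving DF)
    (hT : 0 < T) (ω : PathSpace T d) {h : PathSpace T d} {g : ℝ → Fin d → ℝ}
    (hg : IsWeakDeriv h g) :
    F (ω + h).toCadlag - F ω.toCadlag =
      ∫ t, ∑ i, DF t (ω + stopPath t h).toCadlag i * g t i ∂timeMeasure T := by
  -- All approximating paths stay in this ball: a grid value of h contributes ‖h‖ and a fraction of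
  -- an increment at most 2‖h‖. The bound M supplies the dominating function.
  obtain ⟨M, hM⟩ := hb (‖ω‖ + 3 * ‖h‖)
  obtain ⟨l, hl'⟩ := hl.tendsto_stopPath ω h
  choose c hc hsum using fun n => exists_sum_eq_of_grid hD hT.le ω.toCadlag h n
  let A : ℕ → ℕ → Fin d → ℝ := fun n k =>
    DF (gridNode hT.le n k) (ω.toCadlag + gridPath hT.le n h k (c n k))
  have hA : ∀ n k, k ≤ n + 1 → ‖A n k‖ ≤ M := fun n k hk =>
    hM _ _ (norm_toCadlag_add_le ω (norm_gridPath_le hT hk h (hc n k)))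
  have h1 : Tendsto (fun n => F (ω.toCadlag + gridPath hT.le n h (n + 1) 0) - F ω.toCadlag) atTop
      (𝓝 (F (ω + h).toCadlag - F ω.toCadlag)) := by
    refine (hF _ _ ?_).sub_const _
    have := uniformlyTendsto_add_gridPath hT ω h ⟨T, hT.le, le_rfl⟩ (k := fun n => n + 1)
      (c := fun _ => 0) (fun n => le_rfl) (fun n => ?_) (fun n => ⟨le_rfl, zero_le_one⟩)
    · rwa [stopPath_of_eq_right rfl] at this
    · have hn : (0 : ℝ) < n + 1 := by positivity
      push_cast
      rw [mul_div_assoc, mul_div_cancel₀ _ hn.ne', sub_self, abs_zero]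
      positivity
  have h2 : ∀ n, F (ω.toCadlag + gridPath hT.le n h (n + 1) 0) - F ω.toCadlag =
      ∫ t, ∑ i, A n (gridIndex T n t) i * g t i ∂timeMeasure T := fun n => by
    rw [hsum, ← gridSum_eq_integral hT hg n (A n)]
  have hgm := hg.integrable
  have hidx : ∀ n (t : Icc (0 : ℝ) T), gridIndex T n t ≤ n + 1 := fun n t =>
    (gridIndex_lt hT n t.2.2).le
  have hlim : ∀ᵐ t : Icc (0 : ℝ) T ∂timeMeasure T, Tendsto (fun n => A n (gridIndex T n t)) atTop
      (𝓝 (DF t (ω + stopPath t h).toCadlag)) := by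
    -- The derivative along the stopped perturbations need not be continuous in time, but it equals
    -- its left limit off a countable set, which is null.
    have h3 : ∀ᵐ t : Icc (0 : ℝ) T ∂timeMeasure T, DF t (ω + stopPath t h).toCadlag = l t :=
      ((countable_ne_leftLim fun t => (hl' t).1).measure_zero (timeMeasure T) :)
    have h4 : ∀ᵐ t ∂timeMeasure T, t ≠ (⟨0, le_rfl, hT.le⟩ : Icc (0 : ℝ) T) := by
      simp [ae_iff]
    filter_upwards [h3, h4] with t ht ht0
    have htpos : 0 < (t : ℝ) :=
      lt_of_le_of_ne t.2.1 fun h => ht0 (Subtype.ext h.symm)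
    rw [ht]
    refine (hl' t).2 _ _ (tendsto_gridPoint hT htpos)
      (uniformlyTendsto_add_gridPath hT ω h t (fun n => hidx n t) (fun n => ?_) fun n => hc n _)
    have hs := gridIndex_spec hT n htpos
    rw [abs_le]
    rw [add_mul, add_div, one_mul] at hs
    have : 0 ≤ T / ((n : ℝ) + 1) := by positivity
    constructor <;> linarith [hs.1, hs.2]
  refine tendsto_nhds_unique h1 ?_
  simp only [h2]
  refine tendsto_integral_of_dominated_convergence (fun t => d * M * ‖g t‖) (fun n => ?_)
    (hgm.norm.const_mul _) (fun n => ae_of_all _ fun t => norm_inner_le_mul (hA n _ (hidx n t))) ?_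
  · refine Finset.aestronglyMeasurable_fun_sum _ fun i _ => AEStronglyMeasurable.mul ?_
      (Integrable.eval hgm i).1
    exact ((measurable_from_nat (f := fun k => A n k i)).comp
      ((measurable_gridIndex T n).comp measurable_subtype_coe)).aestronglyMeasurable
  · filter_upwards [hlim] with t ht
    refine tendsto_finsetSum _ fun i _ => ((tendsto_pi_nhds.1 ht) i).mul_const _

end PathFTC

/-! ### Consequences for functionals in `𝔻¹_b` -/

section MemD1b

variable {T : ℝ} {d : ℕ} {f : PathSpace T d → ℝ} {Df : Icc (0 : ℝ) T → PathSpace T d → Fin d → ℝ}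

lemma MemD1b.continuous (hf : MemD1b f Df) : Continuous f := by
  obtain ⟨F, DF, hFf, -, -, hF, -⟩ := hf
  refine continuous_iff_seqContinuous.2 fun ωs ω h => ?_
  have := hF _ _ (uniformlyTendsto_toCadlag h)
  simpa only [hFf, Function.comp_def] using this

lemma MemD1b.continuous_deriv (hf : MemD1b f Df) (t : Icc (0 : ℝ) T) : Continuous (Df t) := by
  obtain ⟨F, DF, -, hDf, -, -, hDF, -⟩ := hf
  refine continuous_iff_seqContinuous.2 fun ωs ω h => ?_
  have := hDF t _ _ (uniformlyTendsto_toCadlag h)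
  simpa only [hDf, Function.comp_def] using this

lemma MemD1b.exists_leftLim (hf : MemD1b f Df) (ω : PathSpace T d) :
    ∃ l : Icc (0 : ℝ) T → Fin d → ℝ, ∀ t, Tendsto (fun s => Df s ω) (𝓝[<] t) (𝓝 (l t)) := by
  obtain ⟨F, DF, -, hDf, -, -, -, hl, -⟩ := hf
  obtain ⟨l, hl'⟩ := hl.tendsto_stopPath ω 0
  refine ⟨l, fun t => ?_⟩
  simpa only [stopPath_zero, add_zero, hDf] using (hl' t).1

/-- The derivative is a Carathéodory function: continuous in the path at each time, and measurable
in time along each path because it has left limits. -/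
lemma MemD1b.measurable_deriv (hf : MemD1b f Df) (hT : 0 < T) :
    Measurable fun x : PathSpace T d × Icc (0 : ℝ) T => Df x.2 x.1 := by
  refine measurable_uncurry_of_continuous_of_measurable (u := fun ω t => Df t ω)
    (fun t => hf.continuous_deriv t) fun ω => ?_
  obtain ⟨l, hl⟩ := hf.exists_leftLim ω
  exact measurable_of_leftLim hT hl

lemma MemD1b.ae_tendsto_gridPoint (hf : MemD1b f Df) (hT : 0 < T) (ω : PathSpace T d) :
    ∀ᵐ t ∂timeMeasure T, Tendsto (fun n => Df (gridPoint hT.le n t) ω) atTop (𝓝 (Df t ω)) := by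
  obtain ⟨l, hl⟩ := hf.exists_leftLim ω
  exact ae_tendsto_gridPoint_of_leftLim hT hl

/-- Stopped continuous perturbations remain continuous paths, so the formula no longer refers to the
càdlàg extension. -/
lemma MemD1b.sub_eq_integral (hf : MemD1b f Df) (hT : 0 < T) (ω : PathSpace T d)
    {h : PathSpace T d} {g : ℝ → Fin d → ℝ} (hg : IsWeakDeriv h g) :
    f (ω + h) - f ω = ∫ t, ∑ i, Df t (ω + stopPath t h) i * leftDeriv t h i ∂timeMeasure T := by
  obtain ⟨F, DF, hFf, hDf, hD, hF, -, hl, hb⟩ := hf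
  have := hD.sub_eq_integral hF hl hb hT ω hg
  simp only [hFf, hDf] at this
  rw [this]
  refine integral_congr_ae ?_
  filter_upwards [hg.leftDeriv_eq] with t ht
  rw [ht]

end MemD1b

/-! ### Continuity and quasi-subadditivity of the power of the norm. -/

section ePow

variable {d : ℕ}

lemma continuous_ePow {r : ℝ} (hr : 0 < r) : Continuous (ePow r : (Fin d → ℝ) → ℝ≥0∞) := by
  simp only [funext (ePow_eq_sum (d := d) hr)]
  refine continuous_finsetSum _ fun i _ => ?_
  exact ENNReal.continuous_rpow_const.comp (continuous_enorm.comp (continuous_apply i))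

lemma ePow_sub_le {r : ℝ} (hr : 1 ≤ r) (x y : Fin d → ℝ) :
    ePow r (x - y) ≤ 2 ^ (r - 1) * (ePow r x + ePow r y) := by
  have hr0 : 0 < r := zero_lt_one.trans_le hr
  rw [ePow_eq_sum hr0, ePow_eq_sum hr0, ePow_eq_sum hr0, ← Finset.sum_add_distrib, Finset.mul_sum]
  refine Finset.sum_le_sum fun i _ => ?_
  refine le_trans (ENNReal.rpow_le_rpow ?_ hr0.le) (ENNReal.rpow_add_le_mul_rpow_add_rpow _ _ hr)
  simpa [sub_eq_add_neg] using enorm_add_le (x i) (-y i)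

end ePow

/-! ### Growth of the derivative and its modulus of continuity -/

section Modulus

variable {T : ℝ} {d : ℕ} {f : PathSpace T d → ℝ} {Df : Icc (0 : ℝ) T → PathSpace T d → Fin d → ℝ}
  {p q : ℝ}

lemma enorm_add_rpow_le {E : Type*} [NormedAddCommGroup E] {r : ℝ} (hr : 1 ≤ r) (x y : E) :
    ‖x + y‖ₑ ^ r ≤ 2 ^ (r - 1) * (‖x‖ₑ ^ r + ‖y‖ₑ ^ r) :=
  (ENNReal.rpow_le_rpow (enorm_add_le x y) (zero_le_one.trans hr)).trans
    (ENNReal.rpow_add_le_mul_rpow_add_rpow _ _ hr)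

/-- Growth of order p - 1 becomes growth of order p after raising to the power q, because (p - 1) q
= p. This is exactly what the moment assumption on μ integrates. -/
lemma exists_ePow_deriv_le (hpq : q.HolderConjugate p)
    (hg : ∃ C : ℝ, ∀ t ω, ‖Df t ω‖ ≤ C * (1 + ‖ω‖ ^ (p - 1))) :
    ∃ K : ℝ≥0, ∀ t ω, ePow q (Df t ω) ≤ K * (1 + ‖ω‖ₑ ^ p) := by
  obtain ⟨C, hC⟩ := hg
  have hq1 : 1 ≤ q := hpq.lt.le
  have hp1 : 0 ≤ p - 1 := sub_nonneg.2 hpq.symm.lt.le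
  refine ⟨d * (Real.toNNReal C ^ q * 2 ^ (q - 1)), fun t ω => (ePow_le_enorm_rpow hpq.pos _).trans ?_⟩
  have h1 : ‖Df t ω‖ₑ ≤ ENNReal.ofReal C * (1 + ‖ω‖ₑ ^ (p - 1)) := by
    rw [← ofReal_norm, ← ofReal_norm, ENNReal.ofReal_rpow_of_nonneg (norm_nonneg _) hp1,
      ← ENNReal.ofReal_one, ← ENNReal.ofReal_add zero_le_one (by positivity),
      ← ENNReal.ofReal_mul' (by positivity)]
    exact ENNReal.ofReal_le_ofReal (hC t ω)
  have h2 : ‖Df t ω‖ₑ ^ q ≤ ENNReal.ofReal C ^ q * (2 ^ (q - 1) * (1 + ‖ω‖ₑ ^ p)) := by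
    refine (ENNReal.rpow_le_rpow h1 hpq.nonneg).trans ?_
    rw [ENNReal.mul_rpow_of_nonneg _ _ hpq.nonneg]
    refine mul_le_mul_right ?_ _
    refine (ENNReal.rpow_add_le_mul_rpow_add_rpow _ _ hq1).trans_eq ?_
    rw [ENNReal.one_rpow, ← ENNReal.rpow_mul, hpq.symm.sub_one_mul_conj]
  refine (mul_le_mul_right h2 _).trans_eq ?_
  push_cast
  rw [ENNReal.coe_rpow_of_nonneg _ hpq.nonneg, ENNReal.coe_rpow_of_nonneg _ (sub_nonneg.2 hq1),
    ENNReal.ofReal, ENNReal.coe_ofNat]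
  ring

/-- The `q`-th power of the `L^q`-distance of the derivative along the stopped perturbations `x + h`
from the derivative at `x`. -/
noncomputable def derivGap (q : ℝ) (Df : Icc (0 : ℝ) T → PathSpace T d → Fin d → ℝ)
    (x h : PathSpace T d) : ℝ≥0∞ :=
  ∫⁻ t, ePow q (Df t (x + stopPath t h) - Df t x) ∂timeMeasure T

lemma measurable_add_stopPath : Measurable fun y : (PathSpace T d × PathSpace T d) × Icc (0 : ℝ) T =>
    y.1.1 + stopPath y.2 y.1.2 := by
  have h1 : Continuous fun y : (PathSpace T d × PathSpace T d) × Icc (0 : ℝ) T =>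
      stopPath y.2 y.1.2 :=
    continuous_stopPath.comp (f := fun y : (PathSpace T d × PathSpace T d) × Icc (0 : ℝ) T =>
      (y.2, y.1.2)) (by fun_prop)
  have h2 : Continuous fun y : (PathSpace T d × PathSpace T d) × Icc (0 : ℝ) T =>
      y.1.1 + stopPath y.2 y.1.2 := (continuous_fst.comp continuous_fst).add h1
  exact h2.measurable

lemma MemD1b.measurable_deriv_stopPath (hf : MemD1b f Df) (hT : 0 < T) :
    Measurable fun y : (PathSpace T d × PathSpace T d) × Icc (0 : ℝ) T =>
      Df y.2 (y.1.1 + stopPath y.2 y.1.2) :=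
  (hf.measurable_deriv hT).comp (measurable_add_stopPath.prodMk measurable_snd)

lemma MemD1b.measurable_deriv_fst (hf : MemD1b f Df) (hT : 0 < T) :
    Measurable fun y : (PathSpace T d × PathSpace T d) × Icc (0 : ℝ) T => Df y.2 y.1.1 :=
  (hf.measurable_deriv hT).comp ((measurable_fst.comp measurable_fst).prodMk measurable_snd)

lemma MemD1b.measurable_derivGap_integrand (hf : MemD1b f Df) (hT : 0 < T) (hq : 0 < q) :
    Measurable fun y : (PathSpace T d × PathSpace T d) × Icc (0 : ℝ) T =>
      ePow q (Df y.2 (y.1.1 + stopPath y.2 y.1.2) - Df y.2 y.1.1) :=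
  (measurable_ePow hq).comp ((hf.measurable_deriv_stopPath hT).sub (hf.measurable_deriv_fst hT))

lemma derivGap_zero (hq : 0 < q) (x : PathSpace T d) : derivGap q Df x 0 = 0 := by
  simp [derivGap, stopPath_zero, ePow_zero hq]

lemma enorm_stopPath_le (t : Icc (0 : ℝ) T) (h : PathSpace T d) : ‖stopPath t h‖ₑ ≤ ‖h‖ₑ := by
  rw [← ofReal_norm, ← ofReal_norm]
  exact ENNReal.ofReal_le_ofReal (norm_stopPath_le t h)

lemma exists_ePow_deriv_stopPath_le (hpq : q.HolderConjugate p)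
    (hg : ∃ C : ℝ, ∀ t ω, ‖Df t ω‖ ≤ C * (1 + ‖ω‖ ^ (p - 1))) :
    ∃ K : ℝ≥0, ∀ t x h, ePow q (Df t (x + stopPath t h)) ≤ K * (1 + ‖x‖ₑ ^ p + ‖h‖ₑ ^ p) := by
  obtain ⟨K, hK⟩ := exists_ePow_deriv_le hpq hg
  have hp1 : 1 ≤ p := hpq.symm.lt.le
  refine ⟨K * 2 ^ (p - 1), fun t x h => (hK _ _).trans ?_⟩
  have h1 : (1 : ℝ≥0∞) ≤ 2 ^ (p - 1) := 
    ENNReal.one_le_rpow one_le_two (sub_pos.2 hpq.symm.lt)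
  have h2 := enorm_add_rpow_le hp1 x (stopPath t h)
  have h3 : ‖stopPath t h‖ₑ ^ p ≤ ‖h‖ₑ ^ p :=
    ENNReal.rpow_le_rpow (enorm_stopPath_le t h) hpq.symm.nonneg
  rw [ENNReal.coe_mul, ENNReal.coe_rpow_of_nonneg _ (sub_nonneg.2 hp1), ENNReal.coe_ofNat, mul_assoc]
  refine mul_le_mul_right ?_ _
  calc 1 + ‖x + stopPath t h‖ₑ ^ p
      ≤ 2 ^ (p - 1) * 1 + 2 ^ (p - 1) * (‖x‖ₑ ^ p + ‖h‖ₑ ^ p) :=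
        add_le_add (by rwa [mul_one]) (h2.trans (by gcongr))
    _ = _ := by ring

lemma exists_ePow_sub_le (hpq : q.HolderConjugate p)
    (hg : ∃ C : ℝ, ∀ t ω, ‖Df t ω‖ ≤ C * (1 + ‖ω‖ ^ (p - 1))) :
    ∃ K : ℝ≥0, ∀ t x h, ePow q (Df t (x + stopPath t h) - Df t x) ≤
      K * (1 + ‖x‖ₑ ^ p + ‖h‖ₑ ^ p) := by
  obtain ⟨K, hK⟩ := exists_ePow_deriv_stopPath_le hpq hg
  have hq1 : 1 ≤ q := hpq.lt.le
  refine ⟨2 ^ (q - 1) * (K + K), fun t x h => (ePow_sub_le hq1 _ _).trans ?_⟩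
  rw [ENNReal.coe_mul, ENNReal.coe_rpow_of_nonneg _ (sub_nonneg.2 hq1), ENNReal.coe_ofNat, mul_assoc]
  refine mul_le_mul_right ?_ _
  rw [ENNReal.coe_add, add_mul]
  refine add_le_add (hK t x h) ?_
  have := hK t x 0
  rw [stopPath_zero, add_zero, enorm_zero, ENNReal.zero_rpow_of_pos hpq.symm.pos, add_zero] at this
  exact this.trans (mul_le_mul_right le_self_add _)

lemma exists_derivGap_le (hpq : q.HolderConjugate p)
    (hg : ∃ C : ℝ, ∀ t ω, ‖Df t ω‖ ≤ C * (1 + ‖ω‖ ^ (p - 1))) :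
    ∃ K : ℝ≥0, ∀ x h, derivGap q Df x h ≤ K * (1 + ‖x‖ₑ ^ p + ‖h‖ₑ ^ p) := by
  obtain ⟨K, hK⟩ := exists_ePow_sub_le hpq hg
  refine ⟨K * Real.toNNReal T, fun x h => (lintegral_mono fun t => hK t x h).trans_eq ?_⟩
  rw [lintegral_const, timeMeasure_univ, ENNReal.coe_mul, ENNReal.ofReal]
  ring

/-- Dominated convergence in time: each integrand is continuous, and the growth bound is locally
bounded by a constant. -/
lemma MemD1b.continuous_derivGap (hf : MemD1b f Df) (hT : 0 < T) (hpq : q.HolderConjugate p)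
    (hg : ∃ C : ℝ, ∀ t ω, ‖Df t ω‖ ≤ C * (1 + ‖ω‖ ^ (p - 1))) :
    Continuous fun z : PathSpace T d × PathSpace T d => derivGap q Df z.1 z.2 := by
  obtain ⟨K, hK⟩ := exists_ePow_sub_le hpq hg
  refine continuous_iff_continuousAt.2 fun z => ?_
  have hcont : Continuous fun y : PathSpace T d × PathSpace T d =>
      (K : ℝ≥0∞) * (1 + ‖y.1‖ₑ ^ p + ‖y.2‖ₑ ^ p) := by
    refine (ENNReal.continuous_const_mul ENNReal.coe_ne_top).comp ?_
    have h1 : Continuous fun y : PathSpace T d × PathSpace T d => ‖y.1‖ₑ ^ p :=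
      ENNReal.continuous_rpow_const.comp (continuous_enorm.comp continuous_fst)
    have h2 : Continuous fun y : PathSpace T d × PathSpace T d => ‖y.2‖ₑ ^ p :=
      ENNReal.continuous_rpow_const.comp (continuous_enorm.comp continuous_snd)
    exact (continuous_const.add h1).add h2
  have hfin : (K : ℝ≥0∞) * (1 + ‖z.1‖ₑ ^ p + ‖z.2‖ₑ ^ p) < ⊤ := by
    have := hpq.symm.nonneg
    finiteness
  obtain ⟨B, hB, hBtop⟩ := exists_between hfin
  have hev := (hcont.tendsto z).eventually (gt_mem_nhds hB)
  unfold derivGap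
  refine tendsto_lintegral_filter_of_dominated_convergence (fun _ => B) (Eventually.of_forall
    fun y => ?_) ?_ ?_ ?_
  · have h := (hf.measurable_derivGap_integrand hT hpq.pos).comp (measurable_prodMk_left (x := y))
    simpa only [Function.comp_def] using h
  · filter_upwards [hev] with y hy
    exact ae_of_all _ fun t => (hK t y.1 y.2).trans hy.le
  · rw [lintegral_const]
    finiteness
  · refine ae_of_all _ fun t => Continuous.tendsto ?_ z
    have h1 : Continuous fun y : PathSpace T d × PathSpace T d => stopPath t y.2 :=
      continuous_stopPath.comp (f := fun y : PathSpace T d × PathSpace T d => (t, y.2))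
        (by fun_prop)
    exact (continuous_ePow hpq.pos).comp (((hf.continuous_deriv t).comp
      (continuous_fst.add h1)).sub ((hf.continuous_deriv t).comp continuous_fst))

end Modulus

/-! ### Uniformity of the modulus over couplings. -/

section UniformModulus

variable {T : ℝ} {d : ℕ} {f : PathSpace T d → ℝ} {Df : Icc (0 : ℝ) T → PathSpace T d → Fin d → ℝ}
  {p q : ℝ}

/-- Along couplings with a fixed first marginal, the modulus of continuity of the derivative is
small as soon as the transport cost is. -/
lemma MemD1b.exists_lintegral_derivGap_le (hf : MemD1b f Df) (hT : 0 < T)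
    (hpq : q.HolderConjugate p) (hg : ∃ C : ℝ, ∀ t ω, ‖Df t ω‖ ≤ C * (1 + ‖ω‖ ^ (p - 1)))
    (μ : Measure (PathSpace T d)) [IsProbabilityMeasure μ] (hμ : ∫⁻ x, ‖x‖ₑ ^ p ∂μ ≠ ⊤)
    {ε : ℝ≥0∞} (hε : ε ≠ 0) :
    ∃ η : ℝ≥0∞, η ≠ 0 ∧ ∀ π : Measure (PathSpace T d × PathSpace T d), π.map Prod.fst = μ →
      ∫⁻ z, sobolevCost p (z.2 - z.1) ∂π ≤ η →
        ∫⁻ z, derivGap q Df z.1 (z.2 - z.1) ∂π ≤ ε := by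
  obtain ⟨K, hK⟩ := exists_derivGap_le hpq hg
  have hp0 := hpq.symm.nonneg
  set A : PathSpace T d → ℝ≥0∞ := fun x => 1 + ‖x‖ₑ ^ p with hA
  have hAc : Continuous A :=
    continuous_const.add (ENNReal.continuous_rpow_const.comp continuous_enorm)
  have hAfin : ∫⁻ x, A x ∂μ ≠ ⊤ := by
    rw [lintegral_add_left measurable_const]
    simpa using hμ
  have : IsFiniteMeasure (μ.withDensity A) := isFiniteMeasure_withDensity hAfin
  -- On S k the weight is bounded and perturbations of norm below 1/(k+1) barely move the
  -- derivative. These closed sets increase to the whole space, so the complement of one of them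
  -- carries little of the weighted measure A μ.
  let S : ℕ → Set (PathSpace T d) := fun k =>
    {x | A x ≤ k} ∩ ⋂ h : PathSpace T d, ⋂ _ : ‖h‖ < 1 / (k + 1 : ℝ), {x | derivGap q Df x h ≤ ε / 2 / 2}
  have hgc := hf.continuous_derivGap hT hpq hg
  have hSclosed : ∀ k, IsClosed (S k) := fun k =>
    (isClosed_le hAc continuous_const).inter (isClosed_iInter fun h => isClosed_iInter fun _ =>
      isClosed_le (hgc.comp (f := fun x => (x, h)) (by fun_prop)) continuous_const)
  have hSmono : Monotone S := by
    intro j k hjk x hx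
    have hxj : A x ≤ j := hx.1
    have hxk : A x ≤ k := hxj.trans (by exact_mod_cast hjk)
    refine ⟨hxk, mem_iInter₂.2 fun h hh => ?_⟩
    exact mem_iInter₂.1 hx.2 h (hh.trans_le (one_div_le_one_div_of_le (by positivity)
      (by gcongr)))
  have hSuniv : ⋂ k, (S k)ᶜ = ∅ := by
    rw [← compl_iUnion, compl_empty_iff]
    refine eq_univ_of_forall fun x => ?_
    obtain ⟨k₁, hk₁⟩ := ENNReal.exists_nat_gt (r := A x) (by simp only [hA]; finiteness)
    have h0 : Tendsto (fun h => derivGap q Df x h) (𝓝 0) (𝓝 0) := by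
      have h1 : Continuous fun h => derivGap q Df x h :=
        hgc.comp (f := fun h => (x, h)) (by fun_prop)
      simpa [derivGap_zero hpq.pos] using h1.tendsto 0
    have hε4 : 0 < ε / 2 / 2 := by simpa using hε
    obtain ⟨r, hr, hball⟩ := Metric.eventually_nhds_iff.1 (h0.eventually (gt_mem_nhds hε4))
    obtain ⟨k₂, hk₂⟩ := exists_nat_one_div_lt hr
    refine mem_iUnion.2 ⟨max k₁ k₂, ⟨hk₁.le.trans (by exact_mod_cast le_max_left _ _),
      mem_iInter₂.2 fun h hh => (hball ?_).le⟩⟩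
    rw [dist_zero_right]
    refine (hh.trans_le (one_div_le_one_div_of_le (by positivity) ?_)).trans hk₂
    gcongr
    exact le_max_right _ _
  have hlim : Tendsto (fun k => (K : ℝ≥0∞) * μ.withDensity A (S k)ᶜ) atTop (𝓝 0) := by
    have h1 := tendsto_measure_iInter_atTop (μ := μ.withDensity A) (s := fun k => (S k)ᶜ)
      (fun k => (hSclosed k).measurableSet.compl.nullMeasurableSet)
      (fun j k hjk => compl_subset_compl.2 (hSmono hjk)) ⟨0, measure_ne_top _ _⟩
    rw [hSuniv, measure_empty] at h1
    simpa using ENNReal.Tendsto.const_mul h1 (Or.inr ENNReal.coe_ne_top)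
  obtain ⟨k, hk⟩ := (hlim.eventually (gt_mem_nhds (by simpa using hε : 0 < ε / 2 / 2))).exists
  -- For x in S k a perturbation of norm at least 1/(k+1) satisfies 1 ≤ ((k+1)‖h‖)^p, so the growth
  -- bound is absorbed into R‖h‖^p, and then by M into the transport cost.
  set R : ℝ≥0∞ := K * (1 + k * (k + 1) ^ p) with hR
  set M : ℝ≥0∞ := R * timeMeasure T univ ^ (p - 1) with hM
  have hMfin : M ≠ ⊤ := by
    rw [hM, hR, timeMeasure_univ]
    have := hpq.symm.lt.le
    have h2 : 0 ≤ p - 1 := by linarith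
    finiteness
  have hpt : ∀ x h, derivGap q Df x h ≤
      ε / 2 / 2 + K * (S k)ᶜ.indicator A x + R * ‖h‖ₑ ^ p := by
    intro x h
    by_cases hx : x ∈ S k
    · by_cases hh : ‖h‖ < 1 / (k + 1 : ℝ)
      · exact (mem_iInter₂.1 hx.2 h hh : derivGap q Df x h ≤ ε / 2 / 2).trans
          (by rw [add_assoc]; exact le_self_add)
      · have h1 : (1 : ℝ≥0∞) ≤ (k + 1) ^ p * ‖h‖ₑ ^ p := by
          rw [← ENNReal.mul_rpow_of_nonneg _ _ hp0]
          refine ENNReal.one_le_rpow ?_ hpq.symm.pos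
          rw [not_lt, div_le_iff₀ (by positivity), mul_comm] at hh
          have h2 := ENNReal.ofReal_le_ofReal hh
          rw [ENNReal.ofReal_mul (by positivity), ofReal_norm, ENNReal.ofReal_one,
            ENNReal.ofReal_add (by positivity) zero_le_one, ENNReal.ofReal_natCast,
            ENNReal.ofReal_one] at h2
          exact h2
        refine le_trans ((hK x h).trans ?_) le_add_self
        rw [hR, mul_assoc]
        refine mul_le_mul_right ?_ _
        rw [add_mul, one_mul, add_comm, mul_assoc]
        refine add_le_add le_rfl ((hx.1 : A x ≤ k).trans ?_)
        exact le_mul_of_one_le_right' h1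
    · rw [indicator_of_mem (show x ∈ (S k)ᶜ from hx)]
      refine (hK x h).trans ?_
      rw [mul_add, add_assoc]
      refine le_add_left (add_le_add le_rfl (mul_le_mul_left ?_ _))
      rw [hR, mul_add, mul_one]
      exact le_self_add
  -- Adding 1 excludes a zero denominator. Perturbations of large norm consume ε/2, and the two
  -- remaining terms ε/4 each.
  refine ⟨ε / 2 / (M + 1), (ENNReal.div_pos (ENNReal.div_pos hε (by norm_num)).ne'
    (by finiteness)).ne', fun π hπ hcost => ?_⟩
  have hπ1 : π univ = 1 := by
    rw [← preimage_univ (f := Prod.fst), ← Measure.map_apply measurable_fst MeasurableSet.univ, hπ,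
      measure_univ]
  have hAm : Measurable ((S k)ᶜ.indicator A) :=
    hAc.measurable.indicator (hSclosed k).measurableSet.compl
  have hI2 : ∫⁻ z, K * (S k)ᶜ.indicator A z.1 ∂π ≤ ε / 2 / 2 := by
    rw [lintegral_const_mul' _ _ ENNReal.coe_ne_top,
      ← lintegral_map (f := (S k)ᶜ.indicator A) (g := Prod.fst) hAm measurable_fst, hπ,
      lintegral_indicator (hSclosed k).measurableSet.compl,
      ← withDensity_apply _ (hSclosed k).measurableSet.compl]
    exact hk.le
  have hI3 : ∫⁻ z, R * ‖z.2 - z.1‖ₑ ^ p ∂π ≤ ε / 2 := by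
    calc ∫⁻ z, R * ‖z.2 - z.1‖ₑ ^ p ∂π
        ≤ ∫⁻ z, M * sobolevCost p (z.2 - z.1) ∂π := lintegral_mono fun z => by
          rw [hM, mul_assoc R]
          exact mul_le_mul_right (enorm_rpow_le_sobolevCost hT hpq.symm.lt _) _
      _ = M * ∫⁻ z, sobolevCost p (z.2 - z.1) ∂π := lintegral_const_mul' _ _ hMfin
      _ ≤ (M + 1) * (ε / 2 / (M + 1)) := mul_le_mul' le_self_add hcost
      _ ≤ ε / 2 := ENNReal.mul_div_le
  calc ∫⁻ z, derivGap q Df z.1 (z.2 - z.1) ∂π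
      ≤ ∫⁻ z, (ε / 2 / 2 + K * (S k)ᶜ.indicator A z.1 + R * ‖z.2 - z.1‖ₑ ^ p) ∂π :=
        lintegral_mono fun z => hpt _ _
    _ = ε / 2 / 2 + ∫⁻ z, K * (S k)ᶜ.indicator A z.1 ∂π + ∫⁻ z, R * ‖z.2 - z.1‖ₑ ^ p ∂π := by
        have h1 : Measurable fun z : PathSpace T d × PathSpace T d =>
          K * (S k)ᶜ.indicator A z.1 := (hAm.comp measurable_fst).const_mul _
        have h2 : Measurable fun z : PathSpace T d × PathSpace T d =>
          ε / 2 / 2 + K * (S k)ᶜ.indicator A z.1 := measurable_const.add h1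
        rw [lintegral_add_left h2,
          lintegral_add_left measurable_const, lintegral_const, hπ1, mul_one]
    _ ≤ ε / 2 / 2 + ε / 2 / 2 + ε / 2 := add_le_add (add_le_add le_rfl hI2) hI3
    _ = ε := by
        rw [ENNReal.add_halves, ENNReal.add_halves]

end UniformModulus

/-! ### First-order expansion along couplings -/

section Expansion

variable {T : ℝ} {d : ℕ} {f : PathSpace T d → ℝ} {Df : Icc (0 : ℝ) T → PathSpace T d → Fin d → ℝ}
  {p q : ℝ}

lemma measurable_pathIncrement :
    Measurable fun z : PathSpace T d × PathSpace T d => z.2 - z.1 :=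
  (continuous_snd.sub continuous_fst).measurable

lemma measurable_leftDeriv_increment :
    Measurable fun y : (PathSpace T d × PathSpace T d) × Icc (0 : ℝ) T =>
      leftDeriv y.2 (y.1.2 - y.1.1) :=
  measurable_leftDeriv_comp measurable_snd (measurable_pathIncrement.comp measurable_fst)

lemma ae_isWeakDeriv (hT : 0 ≤ T) (hp : 0 < p) {π : Measure (PathSpace T d × PathSpace T d)}
    (hc : ∫⁻ z, sobolevCost p (z.2 - z.1) ∂π ≠ ⊤) :
    ∀ᵐ z ∂π, IsWeakDeriv (z.2 - z.1) (leftDerivExt (z.2 - z.1)) := by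
  filter_upwards [ae_lt_top ((measurable_sobolevCost hT hp).comp measurable_pathIncrement) hc]
    with z hz
  exact isWeakDeriv_leftDerivExt_of_sobolevCost_lt_top hz

lemma lintegral_ePow_leftDeriv_eq (hT : 0 ≤ T) (hp : 0 < p)
    {π : Measure (PathSpace T d × PathSpace T d)} [SFinite π]
    (hc : ∫⁻ z, sobolevCost p (z.2 - z.1) ∂π ≠ ⊤) :
    ∫⁻ y, ePow p (leftDeriv y.2 (y.1.2 - y.1.1)) ∂(π.prod (timeMeasure T)) =
      ∫⁻ z, sobolevCost p (z.2 - z.1) ∂π := by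
  have hm : Measurable fun y : (PathSpace T d × PathSpace T d) × Icc (0 : ℝ) T =>
      ePow p (leftDeriv y.2 (y.1.2 - y.1.1)) :=
    (measurable_ePow hp).comp measurable_leftDeriv_increment
  rw [lintegral_prod _ hm.aemeasurable]
  refine lintegral_congr_ae ?_
  filter_upwards [ae_isWeakDeriv hT hp hc] with z hz
  rw [hz.sobolevCost_eq p]

/-- The pairing of the derivative at the path `x + stopPath t h` with the derivative of `h`. -/
noncomputable def derivPairing (Df : Icc (0 : ℝ) T → PathSpace T d → Fin d → ℝ)
    (x h : PathSpace T d) (t : Icc (0 : ℝ) T) : ℝ :=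
  ∑ i, Df t (x + stopPath t h) i * leftDeriv t h i

lemma measurable_inner {S : Type*} [MeasurableSpace S] {a b : S → Fin d → ℝ} (ha : Measurable a)
    (hb : Measurable b) : Measurable fun s => ∑ i, a s i * b s i := by
  fun_prop

lemma MemD1b.measurable_derivPairing (hf : MemD1b f Df) (hT : 0 < T) :
    Measurable fun y : (PathSpace T d × PathSpace T d) × Icc (0 : ℝ) T =>
      derivPairing Df y.1.1 (y.1.2 - y.1.1) y.2 := by
  have h1 : Measurable fun y : (PathSpace T d × PathSpace T d) × Icc (0 : ℝ) T =>
      (((y.1.1, y.1.2 - y.1.1), y.2) : (PathSpace T d × PathSpace T d) × Icc (0 : ℝ) T) :=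
    ((measurable_fst.comp measurable_fst).prodMk
      (measurable_pathIncrement.comp measurable_fst)).prodMk measurable_snd
  have h2 := (hf.measurable_deriv_stopPath hT).comp h1
  exact measurable_inner h2 measurable_leftDeriv_increment

lemma integrable_of_growth (hf : Continuous f)
    (hfg : ∃ C : ℝ, ∀ ω, |f ω| ≤ C * (1 + ‖ω‖ ^ p)) {μ : Measure (PathSpace T d)}
    [IsFiniteMeasure μ] (hμ : Integrable (fun ω => ‖ω‖ ^ p) μ) : Integrable f μ := by
  obtain ⟨C, hC⟩ := hfg
  refine Integrable.mono' (((integrable_const (1 : ℝ)).add hμ).const_mul C)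
    hf.measurable.aestronglyMeasurable (ae_of_all _ fun ω => ?_)
  simpa using hC ω

variable {μ : Measure (PathSpace T d)} {π : Measure (PathSpace T d × PathSpace T d)}

/-- The terms of the first-order expansion are integrable, with Hölder bounds. -/
lemma lintegral_derivPairing_le (hT : 0 < T) (hpq : q.HolderConjugate p) [SFinite π]
    (hc : ∫⁻ z, sobolevCost p (z.2 - z.1) ∂π ≠ ⊤)
    {a : (PathSpace T d × PathSpace T d) × Icc (0 : ℝ) T → Fin d → ℝ} (ha : Measurable a) :
    ∫⁻ y, ‖∑ i, a y i * leftDeriv y.2 (y.1.2 - y.1.1) i‖ₑ ∂(π.prod (timeMeasure T)) ≤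
      (∫⁻ z, ∫⁻ t, ePow q (a (z, t)) ∂timeMeasure T ∂π) ^ (1 / q) *
        (∫⁻ z, sobolevCost p (z.2 - z.1) ∂π) ^ (1 / p) := by
  have h1 := lintegral_enorm_inner_le (π.prod (timeMeasure T)) hpq ha.aemeasurable
    measurable_leftDeriv_increment.aemeasurable
  rw [lintegral_ePow_leftDeriv_eq hT.le hpq.symm.pos hc] at h1
  have h2 : Measurable fun y => ePow q (a y) := (measurable_ePow hpq.pos).comp ha
  rwa [lintegral_prod _ h2.aemeasurable] at h1

lemma lintegral_enorm_rpow_increment_le (hT : 0 < T) (hp : 1 < p) :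
    ∫⁻ z, ‖z.2 - z.1‖ₑ ^ p ∂π ≤
      timeMeasure T univ ^ (p - 1) * ∫⁻ z, sobolevCost p (z.2 - z.1) ∂π := by
  have hfin : timeMeasure T univ ^ (p - 1) ≠ ⊤ := by
    have h2 : 0 ≤ p - 1 := by linarith
    finiteness
  rw [← lintegral_const_mul' _ _ hfin]
  exact lintegral_mono fun z => enorm_rpow_le_sobolevCost hT hp _

lemma lintegral_comp_fst (hπ : π.map Prod.fst = μ) {F : PathSpace T d → ℝ≥0∞}
    (hF : Measurable F) : ∫⁻ z, F z.1 ∂π = ∫⁻ x, F x ∂μ := by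
  rw [← hπ, lintegral_map hF measurable_fst]

lemma isProbabilityMeasure_of_map_fst [IsProbabilityMeasure μ] (hπ : π.map Prod.fst = μ) :
    IsProbabilityMeasure π := by
  refine ⟨?_⟩
  rw [← preimage_univ (f := Prod.fst), ← Measure.map_apply measurable_fst MeasurableSet.univ, hπ,
    measure_univ]

/-- The growth bound involves ‖X‖^p, integrated by the moment of μ, and ‖Y - X‖^p, dominated by the
cost. The constant is therefore common to all couplings with first marginal μ. -/
lemma exists_lintegral_deriv_stopPath_le (hpq : q.HolderConjugate p) (hT : 0 < T)
    [IsProbabilityMeasure μ] (hμ : ∫⁻ x, ‖x‖ₑ ^ p ∂μ ≠ ⊤)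
    (hg : ∃ C : ℝ, ∀ t ω, ‖Df t ω‖ ≤ C * (1 + ‖ω‖ ^ (p - 1))) :
    ∃ K : ℝ≥0∞, K ≠ ⊤ ∧ ∀ π : Measure (PathSpace T d × PathSpace T d), π.map Prod.fst = μ →
      ∫⁻ z, ∫⁻ t, ePow q (Df t (z.1 + stopPath t (z.2 - z.1))) ∂timeMeasure T ∂π ≤
        K * (1 + ∫⁻ z, sobolevCost p (z.2 - z.1) ∂π) ∧
      ∫⁻ z, ∫⁻ t, ePow q (Df t z.1) ∂timeMeasure T ∂π ≤ K := by
  obtain ⟨K, hK⟩ := exists_ePow_deriv_stopPath_le hpq hg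
  set m := ∫⁻ x, ‖x‖ₑ ^ p ∂μ
  set c := timeMeasure T univ ^ (p - 1) with hc
  have hcfin : c ≠ ⊤ := by
    have h2 : 0 ≤ p - 1 := by linarith [hpq.symm.lt]
    finiteness
  have hKfin : (K : ℝ≥0∞) * timeMeasure T univ ≠ ⊤ := by finiteness
  have hbound : ∀ x h : PathSpace T d,
      ∫⁻ t, ePow q (Df t (x + stopPath t h)) ∂timeMeasure T ≤
        K * timeMeasure T univ * (1 + ‖x‖ₑ ^ p + ‖h‖ₑ ^ p) := fun x h => by
    refine (lintegral_mono fun t => hK t x h).trans_eq ?_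
    rw [lintegral_const]
    ring
  have hnm : Measurable fun x : PathSpace T d => ‖x‖ₑ ^ p :=
    (ENNReal.continuous_rpow_const.comp continuous_enorm).measurable
  have hnm1 : Measurable fun z : PathSpace T d × PathSpace T d => ‖z.1‖ₑ ^ p :=
    hnm.comp measurable_fst
  refine ⟨K * timeMeasure T univ * (1 + m + c), by finiteness, fun π hπ => ⟨?_, ?_⟩⟩
  · have hπ1 := isProbabilityMeasure_of_map_fst hπ
    have hsplit : ∫⁻ z, (1 + ‖z.1‖ₑ ^ p + ‖z.2 - z.1‖ₑ ^ p) ∂π ≤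
        1 + m + c * ∫⁻ z, sobolevCost p (z.2 - z.1) ∂π := by
      have h2 : Measurable fun z : PathSpace T d × PathSpace T d => 1 + ‖z.1‖ₑ ^ p :=
        measurable_const.add hnm1
      rw [lintegral_add_left h2, lintegral_add_left measurable_const, lintegral_const,
        measure_univ, mul_one, lintegral_comp_fst hπ hnm]
      exact add_le_add le_rfl (lintegral_enorm_rpow_increment_le hT hpq.symm.lt)
    have hle : ∫⁻ z, ∫⁻ t, ePow q (Df t (z.1 + stopPath t (z.2 - z.1))) ∂timeMeasure T ∂π ≤
        ∫⁻ z, K * timeMeasure T univ * (1 + ‖z.1‖ₑ ^ p + ‖z.2 - z.1‖ₑ ^ p) ∂π :=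
      lintegral_mono fun z => hbound z.1 (z.2 - z.1)
    refine hle.trans ?_
    rw [lintegral_const_mul' _ _ hKfin, mul_assoc ((K : ℝ≥0∞) * timeMeasure T univ)]
    refine mul_le_mul_right (hsplit.trans ?_) _
    rw [mul_add, mul_one]
    exact add_le_add le_self_add (mul_le_mul_left le_add_self _)
  · have hπ1 := isProbabilityMeasure_of_map_fst hπ
    have h0 : ∀ z : PathSpace T d × PathSpace T d, ∫⁻ t, ePow q (Df t z.1) ∂timeMeasure T ≤
        K * timeMeasure T univ * (1 + ‖z.1‖ₑ ^ p) := fun z => by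
      have := hbound z.1 0
      simpa only [stopPath_zero, add_zero, enorm_zero, ENNReal.zero_rpow_of_pos hpq.symm.pos]
        using this
    refine (lintegral_mono h0).trans ?_
    rw [lintegral_const_mul' _ _ hKfin, lintegral_add_left measurable_const, lintegral_const,
      hπ1.measure_univ, mul_one, lintegral_comp_fst hπ hnm]
    exact mul_le_mul_right le_self_add _

/-- The pathwise formula holds almost surely because finite expected cost forces weak
differentiability. Fubini's theorem integrates it, and integrability of f under the second marginal
follows from that of the difference. -/
theorem MemD1b.expansion (hf : MemD1b f Df) (hT : 0 < T) (hpq : q.HolderConjugate p)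
    [IsProbabilityMeasure π]
    (hfi : Integrable (fun z => f z.1) π) (hc : ∫⁻ z, sobolevCost p (z.2 - z.1) ∂π ≠ ⊤)
    (hi : Integrable (fun y : (PathSpace T d × PathSpace T d) × Icc (0 : ℝ) T =>
      derivPairing Df y.1.1 (y.1.2 - y.1.1) y.2) (π.prod (timeMeasure T))) :
    Integrable (fun z => f z.2) π ∧ ∫ z, f z.2 ∂π - ∫ z, f z.1 ∂π =
      ∫ y, derivPairing Df y.1.1 (y.1.2 - y.1.1) y.2 ∂(π.prod (timeMeasure T)) := by
  have hae : (fun z => f z.2 - f z.1) =ᵐ[π]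
      fun z => ∫ t, derivPairing Df z.1 (z.2 - z.1) t ∂timeMeasure T := by
    filter_upwards [ae_isWeakDeriv hT.le hpq.symm.pos hc] with z hz
    have := hf.sub_eq_integral hT z.1 hz
    rwa [add_sub_cancel] at this
  have h1 := hi.integral_prod_left
  have h2 : Integrable (fun z => f z.2 - f z.1) π := h1.congr hae.symm
  have h3 : Integrable (fun z => f z.2) π := by
    refine (h2.add hfi).congr (ae_of_all _ fun z => ?_)
    simp
  refine ⟨h3, ?_⟩
  rw [← integral_sub h3 hfi, integral_congr_ae hae, integral_prod _ hi]

/-- An a priori bound on the change of the expectation along a coupling. -/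
theorem MemD1b.exists_enorm_integral_sub_le (hf : MemD1b f Df) (hT : 0 < T)
    (hpq : q.HolderConjugate p) (hg : ∃ C : ℝ, ∀ t ω, ‖Df t ω‖ ≤ C * (1 + ‖ω‖ ^ (p - 1)))
    [IsProbabilityMeasure μ] (hμ : ∫⁻ x, ‖x‖ₑ ^ p ∂μ ≠ ⊤) (hfμ : Integrable f μ) :
    ∃ K : ℝ≥0∞, K ≠ ⊤ ∧ ∀ π : Measure (PathSpace T d × PathSpace T d), π.map Prod.fst = μ →
      ∫⁻ z, sobolevCost p (z.2 - z.1) ∂π ≠ ⊤ →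
        ‖∫ z, f z.2 ∂π - ∫ z, f z.1 ∂π‖ₑ ≤
          (K * (1 + ∫⁻ z, sobolevCost p (z.2 - z.1) ∂π)) ^ (1 / q) *
            (∫⁻ z, sobolevCost p (z.2 - z.1) ∂π) ^ (1 / p) ∧
        Integrable (fun y : (PathSpace T d × PathSpace T d) × Icc (0 : ℝ) T =>
          ∑ i, Df y.2 y.1.1 i * leftDeriv y.2 (y.1.2 - y.1.1) i) (π.prod (timeMeasure T)) ∧
        ‖∫ z, f z.2 ∂π - ∫ z, f z.1 ∂π - ∫ y, ∑ i, Df y.2 y.1.1 i *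
            leftDeriv y.2 (y.1.2 - y.1.1) i ∂(π.prod (timeMeasure T))‖ₑ ≤
          (∫⁻ z, derivGap q Df z.1 (z.2 - z.1) ∂π) ^ (1 / q) *
            (∫⁻ z, sobolevCost p (z.2 - z.1) ∂π) ^ (1 / p) := by
  obtain ⟨K, hKtop, hK⟩ := exists_lintegral_deriv_stopPath_le hpq hT hμ hg
  refine ⟨K, hKtop, fun π hπ hc => ?_⟩
  obtain ⟨hK1, hK2⟩ := hK π hπ
  have hπ1 := isProbabilityMeasure_of_map_fst hπ
  have hq1 : 0 ≤ 1 / q := one_div_nonneg.2 hpq.nonneg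
  have hp1 : 0 ≤ 1 / p := one_div_nonneg.2 hpq.symm.nonneg
  have hfi : Integrable (fun z : PathSpace T d × PathSpace T d => f z.1) π :=
    Integrable.comp_measurable (g := f) (f := Prod.fst) (by rwa [hπ]) measurable_fst
  have hma : Measurable fun y : (PathSpace T d × PathSpace T d) × Icc (0 : ℝ) T =>
      Df y.2 (y.1.1 + stopPath y.2 (y.1.2 - y.1.1)) := by
    have h1 : Measurable fun y : (PathSpace T d × PathSpace T d) × Icc (0 : ℝ) T =>
        (((y.1.1, y.1.2 - y.1.1), y.2) : (PathSpace T d × PathSpace T d) × Icc (0 : ℝ) T) :=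
      ((measurable_fst.comp measurable_fst).prodMk
        (measurable_pathIncrement.comp measurable_fst)).prodMk measurable_snd
    exact (hf.measurable_deriv_stopPath hT).comp h1
  have hmb := hf.measurable_deriv_fst hT
  have hB1 := lintegral_derivPairing_le hT hpq hc hma
  have hB2 := lintegral_derivPairing_le hT hpq hc hmb
  have hB3 := lintegral_derivPairing_le hT hpq hc (hma.sub hmb)
  have hi1 : Integrable (fun y : (PathSpace T d × PathSpace T d) × Icc (0 : ℝ) T =>
      derivPairing Df y.1.1 (y.1.2 - y.1.1) y.2) (π.prod (timeMeasure T)) := by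
    refine ⟨(hf.measurable_derivPairing hT).aestronglyMeasurable, lt_of_le_of_lt hB1 ?_⟩
    exact (ENNReal.mul_ne_top (ENNReal.rpow_ne_top_of_nonneg hq1 (ne_top_of_le_ne_top
      (by finiteness) hK1)) (ENNReal.rpow_ne_top_of_nonneg hp1 hc)).lt_top
  have hi2 : Integrable (fun y : (PathSpace T d × PathSpace T d) × Icc (0 : ℝ) T =>
      ∑ i, Df y.2 y.1.1 i * leftDeriv y.2 (y.1.2 - y.1.1) i) (π.prod (timeMeasure T)) := by
    refine ⟨(measurable_inner hmb measurable_leftDeriv_increment).aestronglyMeasurable,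
      lt_of_le_of_lt hB2 ?_⟩
    exact (ENNReal.mul_ne_top (ENNReal.rpow_ne_top_of_nonneg hq1 (ne_top_of_le_ne_top
      hKtop hK2)) (ENNReal.rpow_ne_top_of_nonneg hp1 hc)).lt_top
  obtain ⟨-, hexp⟩ := hf.expansion hT hpq hfi hc hi1
  refine ⟨?_, hi2, ?_⟩
  · rw [hexp]
    refine (enorm_integral_le_lintegral_enorm _).trans (hB1.trans ?_)
    gcongr
  · rw [hexp, ← integral_sub hi1 hi2]
    refine (enorm_integral_le_lintegral_enorm _).trans (le_trans (le_of_eq ?_) hB3)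
    refine lintegral_congr fun y => ?_
    rw [derivPairing, ← Finset.sum_sub_distrib]
    simp only [Pi.sub_apply, sub_mul]

end Expansion

/-! ### Causality -/

section Causality

lemma stronglyMeasurable_integral_kernel {α β : Type*} [MeasurableSpace α] [MeasurableSpace β]
    (κ : Kernel α β) [IsMarkovKernel κ] {g : α × β → ℝ} (hg : StronglyMeasurable g) :
    StronglyMeasurable fun x => ∫ y, g (x, y) ∂κ x :=
  hg.integral_kernel_prod_right'

/-- Causality controls the kernel only on events of n. Trimmed to n, it is a genuine kernel from m
to n, and measurability of parameter integrals applies to that kernel. -/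
lemma stronglyMeasurable_integral_of_measurable_coe {α β : Type*} {m : MeasurableSpace α}
    {n mβ : MeasurableSpace β} (hn : n ≤ mβ) (κ : α → Measure[mβ] β)
    [∀ x, IsProbabilityMeasure (κ x)]
    (hκ : ∀ U, MeasurableSet[n] U → Measurable[m] fun x => κ x U) {g : α × β → ℝ}
    (hg : StronglyMeasurable[m.prod n] g) :
    StronglyMeasurable[m] fun x => ∫ y, g (x, y) ∂κ x := by
  have hκm : @Measurable _ _ m (@Measure.instMeasurableSpace β n) fun x => (κ x).trim hn := by
    refine @Measure.measurable_of_measurable_coe β α n m _ fun U hU => ?_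
    simp only [trim_measurableSet_eq hn hU]
    exact hκ U hU
  have hprob : ∀ x, @IsProbabilityMeasure β n ((κ x).trim hn) := fun x =>
    ⟨by rw [trim_measurableSet_eq hn MeasurableSet.univ, measure_univ]⟩
  have hK : @IsMarkovKernel α β m n (@Kernel.mk α β m n _ hκm) :=
    @IsMarkovKernel.mk α β m n _ hprob
  have h := @stronglyMeasurable_integral_kernel α β m n (@Kernel.mk α β m n _ hκm) hK g hg
  have heq : (fun x => ∫ y, g (x, y) ∂κ x) = fun x => @integral β ℝ _ _ n ((κ x).trim hn)
      fun y => g (x, y) := by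
    funext x
    refine integral_trim hn ?_
    exact hg.comp_measurable (@measurable_prodMk_left α β m n x)
  rw [heq]
  exact h

/-- Under a kernel that is adapted in the sense of causality, conditioning the first component on
the past does not affect the pairing with functions of the past of both components. -/
lemma integral_mul_eq_integral_condExp_mul {α β : Type*} {m mα : MeasurableSpace α}
    {n mβ : MeasurableSpace β} (hm : m ≤ mα) (hn : n ≤ mβ) {μ : Measure α} [IsProbabilityMeasure μ]
    {κ : Kernel α β} [IsMarkovKernel κ]
    (hκ : ∀ U, MeasurableSet[n] U → Measurable[m] fun x => κ x U) {r s : ℝ≥0∞}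
    [r.HolderConjugate s] {φ : α → ℝ} (hφ : MemLp φ r μ) {g : α × β → ℝ}
    (hg : StronglyMeasurable[m.prod n] g) (hgs : MemLp g s (μ ⊗ₘ κ)) :
    ∫ z, φ z.1 * g z ∂(μ ⊗ₘ κ) = ∫ z, (μ[φ | m]) z.1 * g z ∂(μ ⊗ₘ κ) := by
  have hr : 1 ≤ r := ENNReal.HolderConjugate.one_le r s
  have hfst : MeasurePreserving Prod.fst (μ ⊗ₘ κ) μ := ⟨measurable_fst, Measure.fst_compProd μ κ⟩
  -- Integrating out the second component first leaves a pairing under μ of ψ with an m-measurable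
  -- function. Such a pairing does not change when φ is replaced by its conditional expectation
  -- given m.
  have key : ∀ ψ : α → ℝ, MemLp ψ r μ → Integrable (fun x => ψ x * ∫ y, g (x, y) ∂κ x) μ ∧
      ∫ z, ψ z.1 * g z ∂(μ ⊗ₘ κ) = ∫ x, ψ x * ∫ y, g (x, y) ∂κ x ∂μ := fun ψ hψ => by
    have hi : Integrable (fun z : α × β => ψ z.1 * g z) (μ ⊗ₘ κ) :=
      (hψ.comp_measurePreserving hfst).integrable_mul hgs
    have h1 : Integrable (fun x => ψ x * ∫ y, g (x, y) ∂κ x) μ := by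
      have := Integrable.integral_compProd (κ := Kernel.const Unit μ)
        (η := Kernel.prodMkLeft Unit κ) (a := ()) hi
      simpa [integral_const_mul] using this
    refine ⟨h1, ?_⟩
    rw [Measure.integral_compProd hi]
    simp only [integral_const_mul]
  have hM := stronglyMeasurable_integral_of_measurable_coe hn (fun x => κ x) hκ hg
  have h1 := key φ hφ
  have h2 := key _ (hφ.condExp hr (m := m))
  rw [h1.2, h2.2, ← integral_condExp hm]
  exact integral_congr_ae (condExp_mul_of_stronglyMeasurable_right hM h1.1 (hφ.integrable hr))

end Causality

/-! ### The first-order term under a causal coupling. -/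

section UpperBound

variable {T : ℝ} {d : ℕ} {f : PathSpace T d → ℝ} {Df : Icc (0 : ℝ) T → PathSpace T d → Fin d → ℝ}
  {p q : ℝ}

lemma measurable_eval_canonicalFiltration {s t : Icc (0 : ℝ) T} (hst : s ≤ t) :
    Measurable[canonicalFiltration T d t] fun ω : PathSpace T d => ω.1 s := by
  have h1 : Measurable[Filtration.natural (fun t (ω : PathSpace T d) => ω.1 t)
      stronglyMeasurable_eval t] fun ω : PathSpace T d => ω.1 s :=
    ((Filtration.stronglyAdapted_natural stronglyMeasurable_eval s).mono
      (Filtration.mono _ hst)).measurable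
  exact h1.mono (Filtration.le_rightCont _ t) le_rfl

lemma canonicalFiltration_le_completedFiltration (μ : Measure (PathSpace T d))
    (t : Icc (0 : ℝ) T) : canonicalFiltration T d t ≤ completedFiltration μ t :=
  le_inf (fun U hU => ⟨U, hU, ae_eq_refl _⟩) ((canonicalFiltration T d).le t)

/-- Left difference quotients use the path only up to time t. This is the reason for preferring left
derivatives: adaptedness holds at t itself. -/
lemma stronglyMeasurable_leftDeriv {S : Type*} {m : MeasurableSpace S} {H : S → PathSpace T d}
    {t : Icc (0 : ℝ) T} (hH : ∀ s ≤ t, Measurable fun x => (H x).1 s) :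
    StronglyMeasurable fun x => leftDeriv t (H x) := by
  have h : ∀ n, StronglyMeasurable fun x => diffQuotient n t (H x) := fun n => by
    have h1 := ((hH t le_rfl).sub (hH _ (timeBack_le n t))).const_smul ((n : ℝ) + 1)
    exact h1.stronglyMeasurable
  unfold leftDeriv
  exact StronglyMeasurable.limUnder h

lemma memLp_of_lintegral_ePow {S : Type*} [MeasurableSpace S] {ν : Measure S} {r : ℝ} (hr : 0 < r)
    {a : S → Fin d → ℝ} (ha : AEStronglyMeasurable a ν) (h : ∫⁻ s, ePow r (a s) ∂ν ≠ ⊤) :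
    MemLp a (ENNReal.ofReal r) ν := by
  refine ⟨ha, (eLpNorm_lt_top_iff_lintegral_rpow_enorm_lt_top (by simpa using hr)
    ENNReal.ofReal_ne_top).2 ?_⟩
  rw [ENNReal.toReal_ofReal hr.le]
  exact (lintegral_mono fun s => enorm_rpow_le_ePow hr _).trans_lt h.lt_top

lemma memLp_apply {S : Type*} [MeasurableSpace S] {ν : Measure S} {r : ℝ≥0∞}
    {a : S → Fin d → ℝ} (ha : MemLp a r ν) (i : Fin d) : MemLp (fun s => a s i) r ν :=
  ha.mono ((continuous_apply i).comp_aestronglyMeasurable ha.1)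
    (ae_of_all _ fun s => norm_le_pi_norm (a s) i)

variable {μ : Measure (PathSpace T d)}

lemma MemD1b.memLp_deriv (hf : MemD1b f Df) (hpq : q.HolderConjugate p)
    (hg : ∃ C : ℝ, ∀ t ω, ‖Df t ω‖ ≤ C * (1 + ‖ω‖ ^ (p - 1))) [IsProbabilityMeasure μ]
    (hμ : ∫⁻ x, ‖x‖ₑ ^ p ∂μ ≠ ⊤) (t : Icc (0 : ℝ) T) :
    MemLp (Df t) (ENNReal.ofReal q) μ := by
  obtain ⟨K, hK⟩ := exists_ePow_deriv_le hpq hg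
  refine memLp_of_lintegral_ePow hpq.pos (hf.continuous_deriv t).measurable.aestronglyMeasurable ?_
  refine ne_top_of_le_ne_top ?_ (lintegral_mono fun x => hK t x)
  rw [lintegral_const_mul' _ _ ENNReal.coe_ne_top, lintegral_add_left measurable_const,
    lintegral_const, measure_univ]
  finiteness

lemma condExp_apply_ae_eq {S : Type*} {m m0 : MeasurableSpace S} {ν : Measure S}
    {a : S → Fin d → ℝ} (ha : Integrable a ν) (i : Fin d) :
    (fun s => (ν[a | m]) s i) =ᵐ[ν] ν[fun s => a s i | m] :=
  (ContinuousLinearMap.proj (R := ℝ) (φ := fun _ : Fin d => ℝ) i).comp_condExp_comm ha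

/-- Under a causal coupling the derivative may be replaced by its conditional expectation. -/
lemma MemD1b.integral_deriv_inner_leftDeriv (hf : MemD1b f Df) (hpq : q.HolderConjugate p)
    (hg : ∃ C : ℝ, ∀ t ω, ‖Df t ω‖ ≤ C * (1 + ‖ω‖ ^ (p - 1))) [IsProbabilityMeasure μ]
    (hμ : ∫⁻ x, ‖x‖ₑ ^ p ∂μ ≠ ⊤) {ν : Measure (PathSpace T d)}
    {π : Measure (PathSpace T d × PathSpace T d)} (hπ : IsCausalCoupling μ ν π)
    (t : Icc (0 : ℝ) T)
    (ht : ∫⁻ z, ePow p (leftDeriv t (z.2 - z.1)) ∂π ≠ ⊤) :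
    ∫ z, ∑ i, Df t z.1 i * leftDeriv t (z.2 - z.1) i ∂π =
      ∫ z, ∑ i, (μ[Df t | completedFiltration μ t]) z.1 i * leftDeriv t (z.2 - z.1) i ∂π := by
  obtain ⟨hπ1, -, κ, hκ, rfl, hcaus⟩ := hπ
  have hconj := hpq.ennrealOfReal
  have hq1 : 1 ≤ ENNReal.ofReal q := by simpa using hpq.lt.le
  have hg1 : StronglyMeasurable[(completedFiltration μ t).prod (canonicalFiltration T d t)]
      fun z : PathSpace T d × PathSpace T d => leftDeriv t (z.2 - z.1) := by
    refine stronglyMeasurable_leftDeriv (m := (completedFiltration μ t).prod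
      (canonicalFiltration T d t)) (H := fun z : PathSpace T d × PathSpace T d => z.2 - z.1) ?_
    intro s hs
    have h1 : Measurable[(completedFiltration μ t).prod (canonicalFiltration T d t)]
        fun z : PathSpace T d × PathSpace T d => z.1.1 s :=
      ((measurable_eval_canonicalFiltration hs).mono
        (canonicalFiltration_le_completedFiltration μ t) le_rfl).comp
        (@measurable_fst _ _ (completedFiltration μ t) (canonicalFiltration T d t))
    have h2 : Measurable[(completedFiltration μ t).prod (canonicalFiltration T d t)]
        fun z : PathSpace T d × PathSpace T d => z.2.1 s :=
      (measurable_eval_canonicalFiltration hs).comp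
        (@measurable_snd _ _ (completedFiltration μ t) (canonicalFiltration T d t))
    exact h2.sub h1
  have hgLp : MemLp (fun z : PathSpace T d × PathSpace T d => leftDeriv t (z.2 - z.1))
      (ENNReal.ofReal p) (μ ⊗ₘ κ) :=
    memLp_of_lintegral_ePow hpq.symm.pos (measurable_leftDeriv_comp measurable_const
      measurable_pathIncrement).aestronglyMeasurable ht
  have hfst : MeasurePreserving Prod.fst (μ ⊗ₘ κ) μ := ⟨measurable_fst, Measure.fst_compProd μ κ⟩
  have hD := hf.memLp_deriv hpq hg hμ t
  have hint : ∀ φ : PathSpace T d → Fin d → ℝ, MemLp φ (ENNReal.ofReal q) μ → ∀ i,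
      Integrable (fun z : PathSpace T d × PathSpace T d => φ z.1 i * leftDeriv t (z.2 - z.1) i)
        (μ ⊗ₘ κ) := fun φ hφ i =>
    ((memLp_apply hφ i).comp_measurePreserving hfst).integrable_mul (memLp_apply hgLp i)
  rw [integral_finsetSum _ fun i _ => hint _ hD i,
    integral_finsetSum _ fun i _ => hint _ (hD.condExp hq1) i]
  refine Finset.sum_congr rfl fun i _ => ?_
  have h1 := integral_mul_eq_integral_condExp_mul ((completedFiltration μ).le t)
    ((canonicalFiltration T d).le t) (hcaus t) (memLp_apply hD i)
    (g := fun z => leftDeriv t (z.2 - z.1) i)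
    ((continuous_apply i).comp_stronglyMeasurable hg1) (memLp_apply hgLp i)
  rw [h1]
  refine integral_congr_ae ?_
  have h2 := hfst.quasiMeasurePreserving.ae (condExp_apply_ae_eq (m := completedFiltration μ t)
    (hD.integrable hq1) i)
  filter_upwards [h2] with z hz
  rw [hz]

/-- At almost every t the velocity is p-integrable, so the derivative can be conditioned on the past
and Hölder applied over the coupling; a second Hölder inequality is over time. The latter needs
`hZ`, because the conditional expectations are chosen separately for each t. -/
lemma MemD1b.enorm_integral_deriv_inner_le (hf : MemD1b f Df) (hT : 0 < T)
    (hpq : q.HolderConjugate p)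
    (hg : ∃ C : ℝ, ∀ t ω, ‖Df t ω‖ ≤ C * (1 + ‖ω‖ ^ (p - 1))) [IsProbabilityMeasure μ]
    (hμ : ∫⁻ x, ‖x‖ₑ ^ p ∂μ ≠ ⊤) {ν : Measure (PathSpace T d)}
    {π : Measure (PathSpace T d × PathSpace T d)} (hπ : IsCausalCoupling μ ν π)
    (hc : ∫⁻ z, sobolevCost p (z.2 - z.1) ∂π ≠ ⊤)
    (hi : Integrable (fun y : (PathSpace T d × PathSpace T d) × Icc (0 : ℝ) T =>
          ∑ i, Df y.2 y.1.1 i * leftDeriv y.2 (y.1.2 - y.1.1) i) (π.prod (timeMeasure T)))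
    (hZ : AEMeasurable (fun t => ∫⁻ x, ePow q ((μ[Df t | completedFiltration μ t]) x) ∂μ)
      (timeMeasure T)) :
    ‖∫ y, ∑ i, Df y.2 y.1.1 i * leftDeriv y.2 (y.1.2 - y.1.1) i ∂(π.prod (timeMeasure T))‖ₑ ≤
      processNorm q μ (fun t => μ[Df t | completedFiltration μ t]) *
        (∫⁻ z, sobolevCost p (z.2 - z.1) ∂π) ^ (1 / p) := by
  have hπ1 := isProbabilityMeasure_of_map_fst hπ.1
  have hm : Measurable fun y : (PathSpace T d × PathSpace T d) × Icc (0 : ℝ) T =>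
      ePow p (leftDeriv y.2 (y.1.2 - y.1.1)) :=
    (measurable_ePow hpq.symm.pos).comp measurable_leftDeriv_increment
  have hW := lintegral_ePow_leftDeriv_eq hT.le hpq.symm.pos hc
  rw [lintegral_prod_symm _ hm.aemeasurable] at hW
  have hbm : Measurable fun t => ∫⁻ z, ePow p (leftDeriv t (z.2 - z.1)) ∂π :=
    hm.lintegral_prod_left'
  have hbfin : ∀ᵐ t ∂timeMeasure T, ∫⁻ z, ePow p (leftDeriv t (z.2 - z.1)) ∂π < ⊤ :=
    ae_lt_top hbm (by rwa [hW])
  have hbound : ∀ᵐ t ∂timeMeasure T,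
      ‖∫ z, ∑ i, Df t z.1 i * leftDeriv t (z.2 - z.1) i ∂π‖ₑ ≤
        (∫⁻ x, ePow q ((μ[Df t | completedFiltration μ t]) x) ∂μ) ^ (1 / q) *
          (∫⁻ z, ePow p (leftDeriv t (z.2 - z.1)) ∂π) ^ (1 / p) := by
    filter_upwards [hbfin] with t ht
    rw [hf.integral_deriv_inner_leftDeriv hpq hg hμ hπ t ht.ne]
    refine (enorm_integral_le_lintegral_enorm _).trans ?_
    have hZm : Measurable (μ[Df t | completedFiltration μ t]) :=
      (stronglyMeasurable_condExp.mono ((completedFiltration μ).le t)).measurable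
    have hH := lintegral_enorm_inner_le π hpq (hZm.comp measurable_fst).aemeasurable
      (measurable_leftDeriv_comp (measurable_const (a := t)) measurable_pathIncrement).aemeasurable
    refine hH.trans_eq ?_
    rw [← lintegral_comp_fst hπ.1 (F := fun x => ePow q ((μ[Df t | completedFiltration μ t]) x))
      ((measurable_ePow hpq.pos).comp hZm)]
    rfl
  rw [integral_prod_symm _ hi]
  refine (enorm_integral_le_lintegral_enorm _).trans ((lintegral_mono_ae hbound).trans ?_)
  have hH := ENNReal.lintegral_mul_le_Lp_mul_Lq (timeMeasure T) hpq (hZ.pow_const (1 / q))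
    (hbm.pow_const (1 / p)).aemeasurable
  simp only [Pi.mul_apply, ← ENNReal.rpow_mul, one_div_mul_cancel hpq.ne_zero,
    one_div_mul_cancel hpq.symm.ne_zero, ENNReal.rpow_one] at hH
  refine hH.trans_eq ?_
  rw [hW]
  rfl

end UpperBound

/-! ### Left continuity of conditional expectations in time -/

section CondExpLimits

variable {Ω ι : Type*} {m0 : MeasurableSpace Ω} {μ : Measure Ω}

lemma lintegral_enorm_sq_eq {ξ : Ω → ℝ} (hξ : MemLp ξ 2 μ) :
    ∫⁻ ω, ‖ξ ω‖ₑ ^ (2 : ℝ) ∂μ = ENNReal.ofReal (∫ ω, ξ ω ^ 2 ∂μ) := by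
  rw [ofReal_integral_eq_lintegral_ofReal hξ.integrable_sq (ae_of_all _ fun ω => sq_nonneg _)]
  refine lintegral_congr fun ω => ?_
  rw [← sq_abs, ENNReal.ofReal_pow (abs_nonneg _), ← Real.enorm_eq_ofReal_abs,
    ← ENNReal.rpow_two]

variable [IsProbabilityMeasure μ]

/-- Pythagoras' theorem for nested conditional expectations. -/
lemma integral_sq_condExp_sub {m₁ m₂ : MeasurableSpace Ω} (h12 : m₁ ≤ m₂) (h2 : m₂ ≤ m0)
    {ξ : Ω → ℝ} (hξ : MemLp ξ 2 μ) :
    ∫ ω, ((μ[ξ | m₂]) ω - (μ[ξ | m₁]) ω) ^ 2 ∂μ =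
      ∫ ω, (μ[ξ | m₂]) ω ^ 2 ∂μ - ∫ ω, (μ[ξ | m₁]) ω ^ 2 ∂μ := by
  have hA : MemLp (μ[ξ | m₂]) 2 μ := hξ.condExp one_le_two
  have hB : MemLp (μ[ξ | m₁]) 2 μ := hξ.condExp one_le_two
  have hAB : Integrable (fun ω => (μ[ξ | m₂]) ω * (μ[ξ | m₁]) ω) μ := hA.integrable_mul hB
  -- Conditioning the product on the smaller σ-algebra and using the tower property replaces the
  -- finer conditional expectation by the coarser one.
  have hcross : ∫ ω, (μ[ξ | m₂]) ω * (μ[ξ | m₁]) ω ∂μ = ∫ ω, (μ[ξ | m₁]) ω ^ 2 ∂μ := by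
    rw [← integral_condExp (h12.trans h2)]
    refine integral_congr_ae ?_
    have h3 := condExp_mul_of_stronglyMeasurable_right (μ := μ) (m := m₁)
      stronglyMeasurable_condExp hAB (hA.integrable one_le_two)
    filter_upwards [h3, condExp_condExp_of_le (f := ξ) (μ := μ) h12 h2] with ω h4 h5
    have h6 : (μ[fun ω => (μ[ξ | m₂]) ω * (μ[ξ | m₁]) ω | m₁]) ω =
      (μ[μ[ξ | m₂] | m₁]) ω * (μ[ξ | m₁]) ω := h4
    rw [h6, h5, sq]
  have hexp : ∀ ω, ((μ[ξ | m₂]) ω - (μ[ξ | m₁]) ω) ^ 2 = (μ[ξ | m₂]) ω ^ 2 -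
      2 * ((μ[ξ | m₂]) ω * (μ[ξ | m₁]) ω) + (μ[ξ | m₁]) ω ^ 2 := fun ω => by ring
  simp only [hexp]
  have hsub : Integrable (fun ω => (μ[ξ | m₂]) ω ^ 2 - 2 * ((μ[ξ | m₂]) ω * (μ[ξ | m₁]) ω)) μ :=
    hA.integrable_sq.sub (hAB.const_mul 2)
  rw [integral_add hsub hB.integrable_sq,
    integral_sub hA.integrable_sq (hAB.const_mul 2), integral_const_mul, hcross]
  ring

lemma monotone_integral_sq_condExp [Preorder ι] (𝓕 : Filtration ι m0) {ξ : Ω → ℝ}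
    (hξ : MemLp ξ 2 μ) : Monotone fun t => ∫ ω, (μ[ξ | 𝓕 t]) ω ^ 2 ∂μ := by
  intro s t hst
  have h := integral_sq_condExp_sub (𝓕.mono hst) (𝓕.le t) hξ
  have h0 : 0 ≤ ∫ ω, ((μ[ξ | 𝓕 t]) ω - (μ[ξ | 𝓕 s]) ω) ^ 2 ∂μ :=
    integral_nonneg fun ω => sq_nonneg _
  simp only
  linarith

/-- Convergence in `L²` of uniformly bounded functions implies convergence in all `L^q`. -/
lemma tendsto_eLpNorm_of_bounded {q : ℝ} (hq : 0 < q) {u : ℕ → Ω → ℝ}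
    (hu : ∀ n, AEStronglyMeasurable (u n) μ) {R : ℝ≥0∞} (hR : R ≠ ⊤)
    (hb : ∀ n, ∀ᵐ ω ∂μ, ‖u n ω‖ₑ ≤ R)
    (h2 : Tendsto (fun n => ∫⁻ ω, ‖u n ω‖ₑ ^ (2 : ℝ) ∂μ) atTop (𝓝 0)) :
    Tendsto (fun n => eLpNorm (u n) (ENNReal.ofReal q) μ) atTop (𝓝 0) := by
  -- On a probability space the L^q-norm is at most the L^r-norm, and since r ≥ 2 the bound R gives
  -- |u|^r ≤ R^(r-2) |u|^2.
  set r : ℝ := max q 2 with hr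
  have hr2 : 2 ≤ r := le_max_right _ _
  have hr0 : 0 < r := by linarith
  have hbound : ∀ n, eLpNorm (u n) (ENNReal.ofReal q) μ ≤
      (R ^ (r - 2) * ∫⁻ ω, ‖u n ω‖ₑ ^ (2 : ℝ) ∂μ) ^ (1 / r) := fun n => by
    refine (eLpNorm_le_eLpNorm_of_exponent_le
      (ENNReal.ofReal_le_ofReal (le_max_left q 2)) (hu n)).trans ?_
    rw [eLpNorm_eq_lintegral_rpow_enorm_toReal (by simp) ENNReal.ofReal_ne_top,
      ENNReal.toReal_ofReal hr0.le]
    refine ENNReal.rpow_le_rpow ?_ (by positivity)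
    have hRfin : R ^ (r - 2) ≠ ⊤ := ENNReal.rpow_ne_top_of_nonneg (by linarith) hR
    rw [← lintegral_const_mul' _ _ hRfin]
    refine lintegral_mono_ae ?_
    filter_upwards [hb n] with ω hω
    calc ‖u n ω‖ₑ ^ r = ‖u n ω‖ₑ ^ (r - 2) * ‖u n ω‖ₑ ^ (2 : ℝ) := by
          rw [← ENNReal.rpow_add_of_nonneg _ _ (by linarith) zero_le_two, sub_add_cancel]
      _ ≤ R ^ (r - 2) * ‖u n ω‖ₑ ^ (2 : ℝ) := by gcongr
  refine tendsto_of_tendsto_of_tendsto_of_le_of_le tendsto_const_nhds ?_ (fun n => zero_le) hbound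
  have h3 : Tendsto (fun n => R ^ (r - 2) * ∫⁻ ω, ‖u n ω‖ₑ ^ (2 : ℝ) ∂μ) atTop (𝓝 0) := by
    simpa using ENNReal.Tendsto.const_mul h2
      (Or.inr (ENNReal.rpow_ne_top_of_nonneg (by linarith) hR))
  have h4 := h3.ennrpow_const (1 / r)
  rwa [ENNReal.zero_rpow_of_pos (by positivity)] at h4

variable [LinearOrder ι] [TopologicalSpace ι]

/-- For a bounded random variable the conditional expectations converge along times increasing to
a time of continuity. -/
lemma tendsto_eLpNorm_condExp_of_continuousAt (𝓕 : Filtration ι m0) {q : ℝ} (hq : 0 < q)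
    {ξ : Ω → ℝ} (hξm : AEStronglyMeasurable ξ μ) {R : ℝ≥0} (hR : ∀ᵐ ω ∂μ, |ξ ω| ≤ R) {t : ι}
    (ht : ContinuousAt (fun t => ∫ ω, (μ[ξ | 𝓕 t]) ω ^ 2 ∂μ) t) {ts : ℕ → ι}
    (hts : Tendsto ts atTop (𝓝[<] t)) :
    Tendsto (fun n => eLpNorm (μ[ξ | 𝓕 (ts n)] - μ[ξ | 𝓕 t]) (ENNReal.ofReal q) μ)
      atTop (𝓝 0) := by
  have hξ : MemLp ξ 2 μ := MemLp.of_bound hξm R (by simpa using hR)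
  have hsm : ∀ s, AEStronglyMeasurable (μ[ξ | 𝓕 s]) μ := fun s => integrable_condExp.1
  have hts' := tendsto_nhdsWithin_iff.1 hts
  refine tendsto_eLpNorm_of_bounded hq (fun n => (hsm _).sub (hsm _)) (R := R + R) (by finiteness)
    (fun n => ?_) ?_
  · filter_upwards [ae_bdd_abs_condExp_of_ae_bdd_abs (m := 𝓕 (ts n)) hR,
      ae_bdd_abs_condExp_of_ae_bdd_abs (m := 𝓕 t) hR] with ω h1 h2
    have h3 : ∀ x : ℝ, |x| ≤ R → ‖x‖ₑ ≤ R := fun x hx => by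
      rw [Real.enorm_eq_ofReal_abs, ← ENNReal.ofReal_coe_nnreal]
      exact ENNReal.ofReal_le_ofReal hx
    exact (enorm_sub_le).trans (add_le_add (h3 _ h1) (h3 _ h2))
  · have h1 : Tendsto (fun n => ENNReal.ofReal (∫ ω, (μ[ξ | 𝓕 t]) ω ^ 2 ∂μ -
        ∫ ω, (μ[ξ | 𝓕 (ts n)]) ω ^ 2 ∂μ)) atTop (𝓝 0) := by
      rw [← ENNReal.ofReal_zero, ← sub_self (∫ ω, (μ[ξ | 𝓕 t]) ω ^ 2 ∂μ)]
      exact (ENNReal.continuous_ofReal.tendsto _).comp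
        (tendsto_const_nhds.sub (ht.tendsto.comp hts'.1))
    refine h1.congr' ?_
    filter_upwards [hts'.2] with n hn
    have hle : ts n ≤ t := le_of_lt hn
    have h2 := integral_sq_condExp_sub (𝓕.mono hle) (𝓕.le t) hξ
    have h3 := lintegral_enorm_sq_eq ((hξ.condExp one_le_two (m := 𝓕 t)).sub
      (hξ.condExp one_le_two (m := 𝓕 (ts n))))
    simp only [Pi.sub_apply] at h3
    rw [← h2, ← h3]
    refine lintegral_congr fun ω => ?_
    rw [Pi.sub_apply, enorm_sub_rev]

/-- Outside a countable set of times, conditional expectations are left-continuous in `L^q`. -/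
lemma exists_countable_tendsto_eLpNorm_condExp [OrderTopology ι] [SecondCountableTopology ι]
    (𝓕 : Filtration ι m0) [IsSeparable μ] {q : ℝ}
    (hq : 1 ≤ q) :
    ∃ N : Set ι, N.Countable ∧ ∀ t ∉ N, ∀ ξ : Ω → ℝ, MemLp ξ (ENNReal.ofReal q) μ →
      ∀ ts : ℕ → ι, Tendsto ts atTop (𝓝[<] t) →
        Tendsto (fun n => eLpNorm (μ[ξ | 𝓕 (ts n)] - μ[ξ | 𝓕 t]) (ENNReal.ofReal q) μ)
          atTop (𝓝 0) := by
  have hq0 : 0 < q := by linarith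
  have hq1 : 1 ≤ ENNReal.ofReal q := by simpa using hq
  have : Fact (1 ≤ ENNReal.ofReal q) := ⟨hq1⟩
  have : Fact (ENNReal.ofReal q ≠ ⊤) := ⟨ENNReal.ofReal_ne_top⟩
  obtain ⟨D, hDc, hDd⟩ := TopologicalSpace.exists_countable_dense
    (Lp.simpleFunc ℝ (ENNReal.ofReal q) μ)
  -- One exceptional set serves every ξ. For each φ in a countable dense family of simple functions
  -- the second moment of the conditional expectation is monotone in time, so it has countably many
  -- discontinuities. Contractivity in L^q then carries the convergence over to all ξ.
  let N : Set ι := ⋃ φ ∈ D, {t | ¬ ContinuousAt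
    (fun t => ∫ ω, (μ[Lp.simpleFunc.toSimpleFunc φ | 𝓕 t]) ω ^ 2 ∂μ) t}
  have hbdd : ∀ φ : SimpleFunc Ω ℝ, ∃ R : ℝ≥0, ∀ ω, |φ ω| ≤ R := fun φ => by
    obtain ⟨C, hC⟩ := φ.exists_forall_norm_le
    exact ⟨C.toNNReal, fun ω => (hC ω).trans (Real.le_coe_toNNReal C)⟩
  have hL2 : ∀ φ : SimpleFunc Ω ℝ, MemLp φ 2 μ := fun φ => by
    obtain ⟨C, hC⟩ := φ.exists_forall_norm_le
    exact MemLp.of_bound φ.stronglyMeasurable.aestronglyMeasurable C (ae_of_all _ hC)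
  refine ⟨N, hDc.biUnion fun φ _ => ?_, fun t ht ξ hξ ts hts => ?_⟩
  · exact (monotone_integral_sq_condExp 𝓕 (hL2 _)).countable_not_continuousAt
  · refine ENNReal.tendsto_nhds_zero.2 fun ε hε => ?_
    have hε3 : 0 < ε / 3 := ENNReal.div_pos hε.ne' (by norm_num)
    have hdense : DenseRange (fun φ : D => ((φ : Lp.simpleFunc ℝ (ENNReal.ofReal q) μ) :
        Lp ℝ (ENNReal.ofReal q) μ)) :=
      (Lp.simpleFunc.denseRange ENNReal.ofReal_ne_top).comp hDd.denseRange_val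
        continuous_subtype_val
    obtain ⟨φ, hφ⟩ := hdense.exists_mem_open (Metric.isOpen_eball (x := hξ.toLp ξ) (ε := ε / 3))
      ⟨_, Metric.mem_eball_self hε3⟩
    set ψ : Ω → ℝ := ⇑(Lp.simpleFunc.toSimpleFunc (φ : Lp.simpleFunc ℝ (ENNReal.ofReal q) μ)) with hψ
    have hψm : AEStronglyMeasurable ψ μ :=
      (Lp.simpleFunc.toSimpleFunc _).stronglyMeasurable.aestronglyMeasurable
    have hψL : MemLp ψ (ENNReal.ofReal q) μ := Lp.simpleFunc.memLp _
    have hclose : eLpNorm (ξ - ψ) (ENNReal.ofReal q) μ ≤ ε / 3 := by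
      have h1 : edist (φ : Lp ℝ (ENNReal.ofReal q) μ) (hξ.toLp ξ) < ε / 3 := hφ
      rw [edist_comm, Lp.edist_def] at h1
      refine le_trans (le_of_eq (eLpNorm_congr_ae ?_)) h1.le
      exact hξ.coeFn_toLp.symm.sub (Lp.simpleFunc.toSimpleFunc_eq_toFun _)
    obtain ⟨R, hR⟩ := hbdd (Lp.simpleFunc.toSimpleFunc (φ : Lp.simpleFunc ℝ (ENNReal.ofReal q) μ))
    have hcont : ContinuousAt (fun t => ∫ ω, (μ[ψ | 𝓕 t]) ω ^ 2 ∂μ) t := by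
      by_contra hc
      exact ht (mem_iUnion₂.2 ⟨φ, φ.2, hc⟩)
    have hlim := tendsto_eLpNorm_condExp_of_continuousAt 𝓕 hq0 hψm (ae_of_all _ hR) hcont hts
    filter_upwards [(ENNReal.tendsto_nhds_zero.1 hlim) (ε / 3) hε3] with n hn
    have hsub : ∀ s, eLpNorm (μ[ξ | 𝓕 s] - μ[ψ | 𝓕 s]) (ENNReal.ofReal q) μ ≤ ε / 3 := fun s => by
      refine le_trans ?_ hclose
      rw [← eLpNorm_congr_ae (condExp_sub (hξ.integrable hq1) (hψL.integrable hq1) (𝓕 s))]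
      exact eLpNorm_condExp_le_eLpNorm _ hq1
    have hsm : ∀ (ζ : Ω → ℝ) s, AEStronglyMeasurable (μ[ζ | 𝓕 s]) μ :=
      fun ζ s => integrable_condExp.1
    have hdecomp : μ[ξ | 𝓕 (ts n)] - μ[ξ | 𝓕 t] = (μ[ξ | 𝓕 (ts n)] - μ[ψ | 𝓕 (ts n)]) +
        (μ[ψ | 𝓕 (ts n)] - μ[ψ | 𝓕 t]) - (μ[ξ | 𝓕 t] - μ[ψ | 𝓕 t]) := by abel
    rw [hdecomp]
    refine (eLpNorm_sub_le (((hsm _ _).sub (hsm _ _)).add ((hsm _ _).sub (hsm _ _)))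
      ((hsm _ _).sub (hsm _ _)) hq1).trans ?_
    refine (add_le_add (eLpNorm_add_le ((hsm _ _).sub (hsm _ _)) ((hsm _ _).sub (hsm _ _)) hq1)
      le_rfl).trans ?_
    exact (add_le_add (add_le_add (hsub _) hn) (hsub _)).trans_eq (ENNReal.add_thirds ε)

end CondExpLimits

/-! ### Convergence of conditional expectations of the derivative along grids -/

section CondExpConvergence

variable {Ω : Type*} {m0 : MeasurableSpace Ω} {μ : Measure Ω}

lemma tendsto_eLpNorm_of_tendsto_sub {r : ℝ≥0∞} (hr : 1 ≤ r) {u : ℕ → Ω → ℝ} {v : Ω → ℝ}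
    (hu : ∀ n, AEStronglyMeasurable (u n) μ) (hv : MemLp v r μ)
    (h : Tendsto (fun n => eLpNorm (u n - v) r μ) atTop (𝓝 0)) :
    Tendsto (fun n => eLpNorm (u n) r μ) atTop (𝓝 (eLpNorm v r μ)) := by
  have h1 := ENNReal.Tendsto.sub (tendsto_const_nhds (x := eLpNorm v r μ)) h (Or.inl hv.2.ne)
  have h2 := (tendsto_const_nhds (x := eLpNorm v r μ)).add h
  rw [tsub_zero] at h1
  rw [add_zero] at h2
  refine tendsto_of_tendsto_of_tendsto_of_le_of_le h1 h2 (fun n => ?_) fun n => ?_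
  · refine tsub_le_iff_right.2 ?_
    calc eLpNorm v r μ = eLpNorm (u n - (u n - v)) r μ := by rw [sub_sub_cancel]
      _ ≤ _ := eLpNorm_sub_le (hu n) ((hu n).sub hv.1) hr
  · calc eLpNorm (u n) r μ = eLpNorm (v + (u n - v)) r μ := by rw [add_sub_cancel]
      _ ≤ _ := eLpNorm_add_le hv.1 ((hu n).sub hv.1) hr

/-- The random variable and the σ-algebra vary together. Contractivity of conditional expectation
handles the first, so only the convergence for the fixed ξ has to be supplied. -/
lemma tendsto_eLpNorm_condExp [IsProbabilityMeasure μ] {r : ℝ≥0∞} (hr : 1 ≤ r)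
    {m : ℕ → MeasurableSpace Ω} {m' : MeasurableSpace Ω}
    {u : ℕ → Ω → ℝ} {ξ : Ω → ℝ} (hu : ∀ n, MemLp (u n) r μ) (hξ : MemLp ξ r μ)
    (h : Tendsto (fun n => eLpNorm (u n - ξ) r μ) atTop (𝓝 0))
    (h' : Tendsto (fun n => eLpNorm (μ[ξ | m n] - μ[ξ | m']) r μ) atTop (𝓝 0)) :
    Tendsto (fun n => eLpNorm (μ[u n | m n]) r μ) atTop (𝓝 (eLpNorm (μ[ξ | m']) r μ)) := by
  have hsm : ∀ (ζ : Ω → ℝ) (m' : MeasurableSpace Ω), AEStronglyMeasurable[m0] (μ[ζ | m']) μ := fun ζ s => integrable_condExp.1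
  refine tendsto_eLpNorm_of_tendsto_sub hr (fun n => hsm _ _) (hξ.condExp hr) ?_
  have h1 := h.add h'
  rw [add_zero] at h1
  refine tendsto_of_tendsto_of_tendsto_of_le_of_le tendsto_const_nhds h1 (fun n => zero_le)
    fun n => ?_
  have h2 : μ[u n | m n] - μ[ξ | m'] = (μ[u n | m n] - μ[ξ | m n]) + (μ[ξ | m n] - μ[ξ | m']) := by
    abel
  simp only [h2]
  refine (eLpNorm_add_le ((hsm _ _).sub (hsm _ _)) ((hsm _ _).sub (hsm _ _)) hr).trans ?_
  gcongr
  rw [← eLpNorm_congr_ae (condExp_sub ((hu n).integrable hr) (hξ.integrable hr) (m n))]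
  exact eLpNorm_condExp_le_eLpNorm _ hr

lemma lintegral_ePow_eq_sum_eLpNorm {d : ℕ} {r : ℝ} (hr : 0 < r) {a : Ω → Fin d → ℝ}
    (ha : AEMeasurable a μ) :
    ∫⁻ x, ePow r (a x) ∂μ = ∑ i, eLpNorm (fun x => a x i) (ENNReal.ofReal r) μ ^ r := by
  simp only [ePow_eq_sum hr]
  have h : ∀ i, AEMeasurable (fun x => ‖a x i‖ₑ ^ r) μ := fun i =>
    ((aemeasurable_pi_iff.1 ha i).enorm).pow_const r
  rw [lintegral_finsetSum' _ fun i _ => h i]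
  refine Finset.sum_congr rfl fun i _ => ?_
  rw [eLpNorm_eq_lintegral_rpow_enorm_toReal (by simpa using hr) ENNReal.ofReal_ne_top,
    ENNReal.toReal_ofReal hr.le, ← ENNReal.rpow_mul, one_div_mul_cancel hr.ne', ENNReal.rpow_one]

lemma lintegral_ePow_condExp_le {d : ℕ} [IsProbabilityMeasure μ] {r : ℝ} (hr : 1 ≤ r)
    {m : MeasurableSpace Ω} {a : Ω → Fin d → ℝ} (ha : MemLp a (ENNReal.ofReal r) μ) :
    ∫⁻ x, ePow r ((μ[a | m]) x) ∂μ ≤ ∫⁻ x, ePow r (a x) ∂μ := by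
  have hr0 : 0 < r := by linarith
  have hr1 : 1 ≤ ENNReal.ofReal r := by simpa using hr
  rw [lintegral_ePow_eq_sum_eLpNorm hr0 ha.1.aemeasurable,
    lintegral_ePow_eq_sum_eLpNorm hr0 integrable_condExp.1.aemeasurable]
  refine Finset.sum_le_sum fun i _ => ENNReal.rpow_le_rpow ?_ hr0.le
  rw [eLpNorm_congr_ae (condExp_apply_ae_eq (ha.integrable hr1) i)]
  exact eLpNorm_condExp_le_eLpNorm _ hr1

end CondExpConvergence

/-! ### The predicted derivative along grids. -/

section Deriv

variable {T : ℝ} {d : ℕ} {f : PathSpace T d → ℝ} {Df : Icc (0 : ℝ) T → PathSpace T d → Fin d → ℝ}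
  {p q : ℝ} {μ : Measure (PathSpace T d)} [IsProbabilityMeasure μ]

/-- Every set of the completed σ-algebra agrees with one of 𝓕_t up to a null set, which no set
integral detects. The upper bound uses the completion and the lower bound the raw filtration, so the
two must be identified. -/
lemma condExp_completedFiltration_ae_eq {E : Type*} [NormedAddCommGroup E] [NormedSpace ℝ E]
    [CompleteSpace E] {φ : PathSpace T d → E} (hφ : Integrable φ μ) (t : Icc (0 : ℝ) T) :
    μ[φ | completedFiltration μ t] =ᵐ[μ] μ[φ | canonicalFiltration T d t] := by
  have hle := canonicalFiltration_le_completedFiltration μ t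
  refine (ae_eq_condExp_of_forall_setIntegral_eq ((completedFiltration μ).le t) hφ
    (fun s _ _ => integrable_condExp.integrableOn) (fun s hs _ => ?_)
    (stronglyMeasurable_condExp.mono hle).aestronglyMeasurable).symm
  obtain ⟨⟨s', hs', hss'⟩, -⟩ : MeasurableSet[@eventuallyMeasurableSpace _
    (canonicalFiltration T d t) (ae μ) _] s ∧ MeasurableSet[instMeasurableSpacePathSpace T d] s := by
    exact MeasurableSpace.measurableSet_inf.1 hs
  rw [setIntegral_congr_set hss', setIntegral_congr_set hss',
    setIntegral_condExp ((canonicalFiltration T d).le t) hφ hs']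

lemma lintegral_const_mul_one_add_ne_top (hμ : ∫⁻ x, ‖x‖ₑ ^ p ∂μ ≠ ⊤) {K : ℝ≥0∞} (hK : K ≠ ⊤) :
    ∫⁻ x, K * (1 + ‖x‖ₑ ^ p) ∂μ ≠ ⊤ := by
  rw [lintegral_const_mul' _ _ hK, lintegral_add_left measurable_const, lintegral_const,
    measure_univ]
  finiteness

lemma exists_ePow_deriv_sub_le (hpq : q.HolderConjugate p)
    (hg : ∃ C : ℝ, ∀ t ω, ‖Df t ω‖ ≤ C * (1 + ‖ω‖ ^ (p - 1))) :
    ∃ K : ℝ≥0∞, K ≠ ⊤ ∧ ∀ s t ω, ePow q (Df s ω - Df t ω) ≤ K * (1 + ‖ω‖ₑ ^ p) := by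
  obtain ⟨K, hK⟩ := exists_ePow_deriv_le hpq hg
  refine ⟨2 ^ (q - 1) * (K + K), ?_, fun s t ω => (ePow_sub_le hpq.lt.le _ _).trans ?_⟩
  · have : 0 ≤ q - 1 := sub_nonneg.2 hpq.lt.le
    finiteness
  · rw [mul_assoc, add_mul]
    gcongr <;> exact hK _ _

lemma MemD1b.ae_tendsto_lintegral_ePow_sub (hf : MemD1b f Df) (hT : 0 < T)
    (hpq : q.HolderConjugate p)
    (hg : ∃ C : ℝ, ∀ t ω, ‖Df t ω‖ ≤ C * (1 + ‖ω‖ ^ (p - 1)))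
    (hμ : ∫⁻ x, ‖x‖ₑ ^ p ∂μ ≠ ⊤) :
    ∀ᵐ t ∂timeMeasure T, Tendsto (fun n => ∫⁻ x, ePow q (Df (gridPoint hT.le n t) x - Df t x) ∂μ)
      atTop (𝓝 0) := by
  obtain ⟨K, hK, hb⟩ := exists_ePow_deriv_sub_le hpq hg
  have hmg : ∀ n, Measurable fun y : PathSpace T d × Icc (0 : ℝ) T =>
      Df (gridPoint hT.le n y.2) y.1 := fun n => by
    have h1 : Measurable fun y : PathSpace T d × Icc (0 : ℝ) T => (y.1, gridPoint hT.le n y.2) :=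
      measurable_fst.prodMk ((measurable_comp_gridPoint hT.le n id).comp measurable_snd)
    exact (hf.measurable_deriv hT).comp h1
  have hset : MeasurableSet {y : PathSpace T d × Icc (0 : ℝ) T |
      Tendsto (fun n => Df (gridPoint hT.le n y.2) y.1) atTop (𝓝 (Df y.2 y.1))} :=
    measurableSet_tendsto_fun hmg (hf.measurable_deriv hT)
  -- Along each path the exceptional times form a null set depending on the path. Fubini turns this
  -- into a null set of times outside which convergence holds for almost every path.
  have hae : ∀ᵐ t ∂timeMeasure T, ∀ᵐ x ∂μ,
      Tendsto (fun n => Df (gridPoint hT.le n t) x) atTop (𝓝 (Df t x)) :=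
    (Measure.ae_ae_comm (μ := μ) (ν := timeMeasure T) (p := fun x t =>
      Tendsto (fun n => Df (gridPoint hT.le n t) x) atTop (𝓝 (Df t x))) hset).1
      (ae_of_all _ fun x => hf.ae_tendsto_gridPoint hT x)
  filter_upwards [hae] with t ht
  have h0 : ∫⁻ _ : PathSpace T d, (0 : ℝ≥0∞) ∂μ = 0 := lintegral_zero
  rw [← h0]
  refine tendsto_lintegral_of_dominated_convergence (fun x => K * (1 + ‖x‖ₑ ^ p)) (fun n => ?_)
    (fun n => ae_of_all _ fun x => hb _ _ _) (lintegral_const_mul_one_add_ne_top hμ hK) ?_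
  · exact (measurable_ePow hpq.pos).comp
      ((hf.continuous_deriv _).measurable.sub (hf.continuous_deriv _).measurable)
  · filter_upwards [ht] with x hx
    have h2 : Tendsto (fun n => Df (gridPoint hT.le n t) x - Df t x) atTop (𝓝 0) := by
      simpa using hx.sub_const (Df t x)
    have h3 := ((continuous_ePow hpq.pos).tendsto (0 : Fin d → ℝ)).comp h2
    rwa [ePow_zero hpq.pos] at h3

lemma MemD1b.tendsto_lintegral_lintegral_ePow_sub (hf : MemD1b f Df) (hT : 0 < T)
    (hpq : q.HolderConjugate p)
    (hg : ∃ C : ℝ, ∀ t ω, ‖Df t ω‖ ≤ C * (1 + ‖ω‖ ^ (p - 1)))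
    (hμ : ∫⁻ x, ‖x‖ₑ ^ p ∂μ ≠ ⊤) :
    Tendsto (fun n => ∫⁻ t, ∫⁻ x, ePow q (Df (gridPoint hT.le n t) x - Df t x) ∂μ ∂timeMeasure T)
      atTop (𝓝 0) := by
  obtain ⟨K, hK, hb⟩ := exists_ePow_deriv_sub_le hpq hg
  have h0 : ∫⁻ _ : Icc (0 : ℝ) T, (0 : ℝ≥0∞) ∂timeMeasure T = 0 := lintegral_zero
  rw [← h0]
  refine tendsto_lintegral_of_dominated_convergence (fun _ => ∫⁻ x, K * (1 + ‖x‖ₑ ^ p) ∂μ)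
    (fun n => ?_) (fun n => ae_of_all _ fun t => lintegral_mono fun x => hb _ _ _) ?_
    (hf.ae_tendsto_lintegral_ePow_sub hT hpq hg hμ)
  · have h1 : Measurable fun y : PathSpace T d × Icc (0 : ℝ) T => (y.1, gridPoint hT.le n y.2) :=
      measurable_fst.prodMk ((measurable_comp_gridPoint hT.le n id).comp measurable_snd)
    have h2 := (measurable_ePow hpq.pos).comp
      (((hf.measurable_deriv hT).comp h1).sub (hf.measurable_deriv hT))
    exact h2.lintegral_prod_left'
  · rw [lintegral_const]
    have := lintegral_const_mul_one_add_ne_top hμ hK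
    finiteness

/-- Two limits are combined coordinate by coordinate: the derivative at the grid point tends to that
at t in L^q, and conditioning at times increasing to t tends to conditioning at t outside a
countable set. -/
lemma MemD1b.ae_tendsto_lintegral_ePow_condExp (hf : MemD1b f Df) (hT : 0 < T)
    (hpq : q.HolderConjugate p)
    (hg : ∃ C : ℝ, ∀ t ω, ‖Df t ω‖ ≤ C * (1 + ‖ω‖ ^ (p - 1)))
    (hμ : ∫⁻ x, ‖x‖ₑ ^ p ∂μ ≠ ⊤) :
    ∀ᵐ t ∂timeMeasure T, Tendsto (fun n => ∫⁻ x, ePow q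
        ((μ[Df (gridPoint hT.le n t) | canonicalFiltration T d (gridPoint hT.le n t)]) x) ∂μ)
      atTop (𝓝 (∫⁻ x, ePow q ((μ[Df t | completedFiltration μ t]) x) ∂μ)) := by
  have hq1 : 1 ≤ ENNReal.ofReal q := by simpa using hpq.lt.le
  have hL := hf.memLp_deriv hpq hg hμ
  obtain ⟨N, hN, hNt⟩ := exists_countable_tendsto_eLpNorm_condExp (μ := μ)
    (canonicalFiltration T d) hpq.lt.le
  have hpos : ∀ᵐ t : Icc (0 : ℝ) T ∂timeMeasure T, (0 : ℝ) < t := by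
    have h1 : ∀ᵐ t ∂timeMeasure T, t ≠ ⟨0, le_rfl, hT.le⟩ := by
      simp [ae_iff]
    filter_upwards [h1] with t ht
    exact lt_of_le_of_ne t.2.1 fun h => ht (Subtype.ext h.symm)
  filter_upwards [hf.ae_tendsto_lintegral_ePow_sub hT hpq hg hμ, hN.ae_notMem (timeMeasure T), hpos]
    with t ht htN ht0
  have hme : ∀ s (m : MeasurableSpace (PathSpace T d)), AEMeasurable (μ[Df s | m]) μ :=
    fun s m => integrable_condExp.1.aemeasurable
  have hc := condExp_completedFiltration_ae_eq ((hL t).integrable hq1) t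
  have hc' : ∫⁻ x, ePow q ((μ[Df t | completedFiltration μ t]) x) ∂μ =
      ∫⁻ x, ePow q ((μ[Df t | canonicalFiltration T d t]) x) ∂μ :=
    lintegral_congr_ae (hc.fun_comp (ePow q))
  rw [hc']
  simp only [lintegral_ePow_eq_sum_eLpNorm hpq.pos (hme _ _)]
  have hm2 : ∀ n, AEMeasurable (fun x => Df (gridPoint hT.le n t) x - Df t x) μ := fun n =>
    ((hL _).1.sub (hL t).1).aemeasurable
  simp only [lintegral_ePow_eq_sum_eLpNorm hpq.pos (hm2 _)] at ht
  refine tendsto_finsetSum _ fun i _ => Tendsto.ennrpow_const q ?_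
  have hci : ∀ s m, eLpNorm (fun x => (μ[Df s | m]) x i) (ENNReal.ofReal q) μ =
      eLpNorm (μ[fun x => Df s x i | m]) (ENNReal.ofReal q) μ := fun s m =>
    eLpNorm_congr_ae (condExp_apply_ae_eq ((hL s).integrable hq1) i)
  simp only [hci]
  refine tendsto_eLpNorm_condExp hq1 (fun n => memLp_apply (hL _) i) (memLp_apply (hL t) i) ?_
    (hNt t htN _ (memLp_apply (hL t) i) _ (tendsto_gridPoint hT ht0))
  have h3 : Tendsto (fun n => eLpNorm (fun x => (Df (gridPoint hT.le n t) x - Df t x) i)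
      (ENNReal.ofReal q) μ ^ q) atTop (𝓝 0) := by
    refine tendsto_of_tendsto_of_tendsto_of_le_of_le tendsto_const_nhds ht (fun n => zero_le)
      fun n => ?_
    exact Finset.single_le_sum (f := fun i => eLpNorm (fun x =>
      (Df (gridPoint hT.le n t) x - Df t x) i) (ENNReal.ofReal q) μ ^ q)
      (fun _ _ => zero_le) (Finset.mem_univ i)
  have h4 := h3.ennrpow_const (1 / q)
  rw [ENNReal.zero_rpow_of_pos (by have := hpq.pos; positivity)] at h4
  simp only [← ENNReal.rpow_mul, mul_one_div_cancel hpq.ne_zero, ENNReal.rpow_one] at h4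
  exact h4

/-- Versions chosen separately at each t need not be jointly measurable, but their moments are
almost everywhere limits of functions of the grid index. -/
lemma MemD1b.aemeasurable_lintegral_ePow_condExp (hf : MemD1b f Df) (hT : 0 < T)
    (hpq : q.HolderConjugate p)
    (hg : ∃ C : ℝ, ∀ t ω, ‖Df t ω‖ ≤ C * (1 + ‖ω‖ ^ (p - 1)))
    (hμ : ∫⁻ x, ‖x‖ₑ ^ p ∂μ ≠ ⊤) :
    AEMeasurable (fun t => ∫⁻ x, ePow q ((μ[Df t | completedFiltration μ t]) x) ∂μ)
      (timeMeasure T) :=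
  aemeasurable_of_tendsto_metrizable_ae atTop
    (fun n => (measurable_comp_gridPoint hT.le n fun s => ∫⁻ x, ePow q
        ((μ[Df s | canonicalFiltration T d s]) x) ∂μ).aemeasurable)
    (hf.ae_tendsto_lintegral_ePow_condExp hT hpq hg hμ)

lemma MemD1b.tendsto_lintegral_lintegral_ePow_condExp (hf : MemD1b f Df) (hT : 0 < T)
    (hpq : q.HolderConjugate p)
    (hg : ∃ C : ℝ, ∀ t ω, ‖Df t ω‖ ≤ C * (1 + ‖ω‖ ^ (p - 1)))
    (hμ : ∫⁻ x, ‖x‖ₑ ^ p ∂μ ≠ ⊤) :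
    Tendsto (fun n => ∫⁻ t, ∫⁻ x, ePow q
        ((μ[Df (gridPoint hT.le n t) | canonicalFiltration T d (gridPoint hT.le n t)]) x) ∂μ
        ∂timeMeasure T)
      atTop (𝓝 (processNorm q μ (fun t => μ[Df t | completedFiltration μ t]) ^ q)) := by
  obtain ⟨K, hK⟩ := exists_ePow_deriv_le hpq hg
  have h0 : processNorm q μ (fun t => μ[Df t | completedFiltration μ t]) ^ q =
      ∫⁻ t, ∫⁻ x, ePow q ((μ[Df t | completedFiltration μ t]) x) ∂μ ∂timeMeasure T := by
    rw [processNorm, ← ENNReal.rpow_mul, one_div_mul_cancel hpq.ne_zero, ENNReal.rpow_one]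
    rfl
  rw [h0]
  refine tendsto_lintegral_of_dominated_convergence (fun _ => ∫⁻ x, K * (1 + ‖x‖ₑ ^ p) ∂μ)
    (fun n => measurable_comp_gridPoint hT.le n fun s => ∫⁻ x, ePow q
        ((μ[Df s | canonicalFiltration T d s]) x) ∂μ) (fun n => ae_of_all _ fun t => ?_) ?_
    (hf.ae_tendsto_lintegral_ePow_condExp hT hpq hg hμ)
  · exact (lintegral_ePow_condExp_le hpq.lt.le (hf.memLp_deriv hpq hg hμ _)).trans
      (lintegral_mono fun x => hK _ _)
  · rw [lintegral_const]
    have := lintegral_const_mul_one_add_ne_top hμ (K := K) ENNReal.coe_ne_top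
    finiteness

lemma MemD1b.processNorm_ne_top (hf : MemD1b f Df) (hpq : q.HolderConjugate p)
    (hg : ∃ C : ℝ, ∀ t ω, ‖Df t ω‖ ≤ C * (1 + ‖ω‖ ^ (p - 1)))
    (hμ : ∫⁻ x, ‖x‖ₑ ^ p ∂μ ≠ ⊤) :
    processNorm q μ (fun t => μ[Df t | completedFiltration μ t]) ≠ ⊤ := by
  obtain ⟨K, hK⟩ := exists_ePow_deriv_le hpq hg
  refine ENNReal.rpow_ne_top_of_nonneg (by have := hpq.pos; positivity) ?_
  refine ne_top_of_le_ne_top ?_ (lintegral_mono (μ := timeMeasure T)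
    (g := fun _ => ∫⁻ x, K * (1 + ‖x‖ₑ ^ p) ∂μ) fun t =>
    (lintegral_ePow_condExp_le hpq.lt.le (hf.memLp_deriv hpq hg hμ t)).trans
      (lintegral_mono fun x => hK t x))
  rw [lintegral_const]
  have := lintegral_const_mul_one_add_ne_top hμ (K := K) ENNReal.coe_ne_top
  finiteness

end Deriv

/-! ### Adapted transports -/

section AdaptedMap

variable {T : ℝ} {d : ℕ} {p : ℝ} {μ : Measure (PathSpace T d)}

lemma comap_natural_le_canonicalFiltration {Y : PathSpace T d → PathSpace T d}
    (hY : ∀ t, Measurable[canonicalFiltration T d t] fun x => (Y x).1 t) (t : Icc (0 : ℝ) T) :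
    (Filtration.natural (fun t (ω : PathSpace T d) => ω.1 t) stronglyMeasurable_eval t).comap Y ≤
      canonicalFiltration T d t := by
  rw [MeasurableSpace.comap_le_iff_le_map]
  refine iSup₂_le fun s hs => ?_
  rw [MeasurableSpace.comap_le_iff_le_map]
  intro U hU
  exact (canonicalFiltration T d).mono hs _ (hY s hU)

/-- If t has times to its right, then for every s > t the preimage of 𝓕_t lies in 𝓕_s, and
right-continuity of 𝓕 brings it back to 𝓕_t. Otherwise 𝓕_t is the natural σ-algebra, where
adaptedness of Y suffices. -/
lemma comap_canonicalFiltration_le {Y : PathSpace T d → PathSpace T d}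
    (hY : ∀ t, Measurable[canonicalFiltration T d t] fun x => (Y x).1 t) (t : Icc (0 : ℝ) T) :
    (canonicalFiltration T d t).comap Y ≤ canonicalFiltration T d t := by
  by_cases hne : (𝓝[>] t).NeBot
  · have h1 : canonicalFiltration T d t = ⨅ s > t, canonicalFiltration T d s := by
      conv_lhs => rw [canonicalFiltration, ← Filtration.rightCont_self]
      exact Filtration.rightCont_eq_of_neBot_nhdsGT _ t
    have h2 : canonicalFiltration T d t = ⨅ s > t, Filtration.natural
        (fun t (ω : PathSpace T d) => ω.1 t) stronglyMeasurable_eval s :=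
      Filtration.rightCont_eq_of_neBot_nhdsGT _ t
    refine le_trans ?_ h1.ge
    refine le_iInf₂ fun s hs => le_trans ?_ (comap_natural_le_canonicalFiltration hY s)
    refine MeasurableSpace.comap_mono (h2.trans_le ?_)
    exact iInf₂_le s hs
  · have h2 : canonicalFiltration T d t = Filtration.natural
        (fun t (ω : PathSpace T d) => ω.1 t) stronglyMeasurable_eval t := by
      rw [canonicalFiltration, Filtration.rightCont_apply, if_neg hne]
    refine le_trans (MeasurableSpace.comap_mono h2.le) ?_
    exact comap_natural_le_canonicalFiltration hY t

/-- An adapted map of the path space induces a causal coupling. -/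
lemma isCausalCoupling_map [SFinite μ] {Y : PathSpace T d → PathSpace T d} (hYm : Measurable Y)
    (hY : ∀ t, Measurable[canonicalFiltration T d t] fun x => (Y x).1 t) :
    IsCausalCoupling μ (μ.map Y) (μ.map fun x => (x, Y x)) := by
  have hm : Measurable fun x => (x, Y x) := measurable_id.prodMk hYm
  refine ⟨?_, ?_, Kernel.deterministic Y hYm, inferInstance,
    (Measure.compProd_deterministic hYm).symm, fun t U hU => ?_⟩
  · rw [Measure.map_map measurable_fst hm]
    exact Measure.map_id
  · rw [Measure.map_map measurable_snd hm]
    rfl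
  · have hU' : MeasurableSet U := (canonicalFiltration T d).le t U hU
    have h1 : MeasurableSet[completedFiltration μ t] (Y ⁻¹' U) :=
      canonicalFiltration_le_completedFiltration μ t _
        (comap_canonicalFiltration_le hY t _ ⟨U, hU, rfl⟩)
    have h2 : (fun x => Kernel.deterministic Y hYm x U) =
        (Y ⁻¹' U).indicator fun _ => (1 : ℝ≥0∞) := by
      funext x
      rw [Kernel.deterministic_apply' hYm x hU']
      rfl
    rw [h2]
    exact Measurable.indicator measurable_const h1

lemma causalCost_map_le [SFinite μ] (hT : 0 ≤ T) (hp : 0 < p) {Y : PathSpace T d → PathSpace T d}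
    (hYm : Measurable Y) (hY : ∀ t, Measurable[canonicalFiltration T d t] fun x => (Y x).1 t) :
    causalCost p μ (μ.map Y) ≤ ∫⁻ x, sobolevCost p (Y x - x) ∂μ := by
  refine (iInf₂_le _ (isCausalCoupling_map hYm hY)).trans_eq ?_
  have hm : Measurable fun z : PathSpace T d × PathSpace T d => sobolevCost p (z.1 - z.2) :=
    (measurable_sobolevCost hT hp).comp (continuous_fst.sub continuous_snd).measurable
  have hpair : Measurable fun x => (x, Y x) := measurable_id.prodMk hYm
  rw [lintegral_map hm hpair]
  refine lintegral_congr fun x => ?_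
  rw [← sobolevCost_neg hp, neg_sub]

lemma isWeakDeriv_zero : IsWeakDeriv (0 : PathSpace T d) 0 := by
  refine ⟨integrableOn_zero, fun t => ?_⟩
  simp only [Pi.zero_apply, intervalIntegral.integral_zero]
  rfl

lemma sobolevCost_zero (hp : 0 < p) : sobolevCost p (0 : PathSpace T d) = 0 := by
  refine le_antisymm ((iInf₂_le 0 isWeakDeriv_zero).trans_eq ?_) zero_le
  have h : ∫⁻ s in Icc 0 T, ePow p (0 : Fin d → ℝ) = 0 := by simp [ePow_zero hp]
  exact h

lemma causalCost_self [SFinite μ] (hT : 0 ≤ T) (hp : 0 < p) : causalCost p μ μ = 0 := by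
  have h := causalCost_map_le (μ := μ) hT hp measurable_id
    (fun t => measurable_eval_canonicalFiltration le_rfl)
  rw [Measure.map_id] at h
  simpa [sobolevCost_zero hp] using h

end AdaptedMap

/-! ### Piecewise linear paths -/

section RampPath

variable {T : ℝ} {d : ℕ}

lemma intervalIntegrable_gridIndicator (n k : ℕ) (a b : ℝ) :
    IntervalIntegrable ({s | gridIndex T n s = k}.indicator fun _ => (1 : ℝ)) volume a b := by
  have hm : MeasurableSet {s | gridIndex T n s = k} :=
    measurable_gridIndex T n (measurableSet_singleton k)
  exact (intervalIntegrable_const (c := (1 : ℝ))).mono_fun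
    ((measurable_const.indicator hm).aestronglyMeasurable) (ae_of_all _ fun s =>
      norm_indicator_le_norm_self _ _)

/-- The piecewise linear path with velocity `e` on the `k`-th interval of the grid. -/
noncomputable def rampPath (T : ℝ) (n k : ℕ) (e : Fin d → ℝ) : PathSpace T d :=
  ⟨⟨fun t => (∫ s in (0 : ℝ)..t, {s | gridIndex T n s = k}.indicator (fun _ => (1 : ℝ)) s) • e, by
    have h := intervalIntegral.continuous_primitive (μ := volume)
      (f := {s | gridIndex T n s = k}.indicator fun _ => (1 : ℝ))
      (fun a b => intervalIntegrable_gridIndicator n k a b) 0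
    exact (h.comp continuous_subtype_val).smul continuous_const⟩, fun t ht => by
    simp [ht]⟩

lemma rampPath_apply (n k : ℕ) (e : Fin d → ℝ) (t : Icc (0 : ℝ) T) :
    (rampPath T n k e).1 t =
      (∫ s in (0 : ℝ)..t, {s | gridIndex T n s = k}.indicator (fun _ => (1 : ℝ)) s) • e := rfl

lemma continuous_rampPath (n k : ℕ) :
    Continuous (rampPath T n k : (Fin d → ℝ) → PathSpace T d) := by
  refine PathSpace.continuous_of_continuous_uncurry ?_
  simp only [rampPath_apply]
  have h := intervalIntegral.continuous_primitive (μ := volume)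
    (f := {s | gridIndex T n s = k}.indicator fun _ => (1 : ℝ))
    (fun a b => intervalIntegrable_gridIndicator n k a b) 0
  exact ((h.comp (continuous_subtype_val.comp continuous_snd)).smul continuous_fst)

lemma rampPath_apply_of_le (hT : 0 < T) {n k : ℕ} (hk : k ≤ n + 1) (e : Fin d → ℝ)
    {t : Icc (0 : ℝ) T} (ht : t ≤ gridNode hT.le n k) : (rampPath T n k e).1 t = 0 := by
  have h0 : ∫ s in (0 : ℝ)..t, {s | gridIndex T n s = k}.indicator (fun _ => (1 : ℝ)) s = 0 := by
    rw [intervalIntegral.integral_of_le t.2.1]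
    refine setIntegral_eq_zero_of_forall_eq_zero fun s hs => indicator_of_notMem ?_ _
    intro hsk
    have h1 := (gridIndex_spec hT n hs.1).1
    have h2 : gridIndex T n s = k := hsk
    have h3 : (t : ℝ) ≤ gridNode hT.le n k := ht
    rw [coe_gridNode hT.le hk, ← h2] at h3
    linarith [hs.2]
  rw [rampPath_apply, h0, zero_smul]

/-- The path whose velocity on the `k`-th interval of the grid is `ξ k`. -/
noncomputable def rampSum (T : ℝ) (n : ℕ) (ξ : ℕ → Fin d → ℝ) : PathSpace T d :=
  ∑ k ∈ Finset.range (n + 1), rampPath T n k (ξ k)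

lemma PathSpace.sum_apply {ι : Type*} (s : Finset ι) (u : ι → PathSpace T d) (t : Icc (0 : ℝ) T) :
    (∑ i ∈ s, u i).1 t = ∑ i ∈ s, (u i).1 t := by
  classical
  induction s using Finset.induction_on with
  | empty => rfl
  | insert a s ha ih =>
    rw [Finset.sum_insert ha, Finset.sum_insert ha, ← ih]
    rfl

lemma rampSum_apply (n : ℕ) (ξ : ℕ → Fin d → ℝ) (t : Icc (0 : ℝ) T) :
    (rampSum T n ξ).1 t = ∑ k ∈ Finset.range (n + 1), (rampPath T n k (ξ k)).1 t :=
  PathSpace.sum_apply _ _ t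

lemma isWeakDeriv_rampSum (hT : 0 < T) (n : ℕ) (ξ : ℕ → Fin d → ℝ) :
    IsWeakDeriv (rampSum T n ξ) fun s => ξ (gridIndex T n s) := by
  have hsum : ∀ s ≤ T, ξ (gridIndex T n s) = ∑ k ∈ Finset.range (n + 1),
      {s | gridIndex T n s = k}.indicator (fun _ => (1 : ℝ)) s • ξ k := fun s hs => by
    rw [Finset.sum_eq_single_of_mem _ (Finset.mem_range.2 (gridIndex_lt hT n hs))]
    · rw [indicator_of_mem (by exact rfl), one_smul]
    · intro k _ hk
      have hs' : s ∉ {s | gridIndex T n s = k} := fun h => by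
        have h' : gridIndex T n s = k := h
        exact hk h'.symm
      rw [indicator_of_notMem hs', zero_smul]
  have hint : ∀ k, ∀ t : Icc (0 : ℝ) T, IntervalIntegrable (fun s =>
      {s | gridIndex T n s = k}.indicator (fun _ => (1 : ℝ)) s • ξ k) volume 0 t := fun k t =>
    ⟨(intervalIntegrable_gridIndicator n k 0 t).1.smul_const _,
      (intervalIntegrable_gridIndicator n k 0 t).2.smul_const _⟩
  refine ⟨?_, fun t => ?_⟩
  · have h1 : IntervalIntegrable (fun s => ∑ k ∈ Finset.range (n + 1),
        {s | gridIndex T n s = k}.indicator (fun _ => (1 : ℝ)) s • ξ k) volume 0 T := by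
      have := IntervalIntegrable.sum (Finset.range (n + 1))
        fun k _ => hint k ⟨T, hT.le, le_rfl⟩
      simpa only [Finset.sum_fn] using this
    rw [intervalIntegrable_iff_integrableOn_Icc_of_le hT.le] at h1
    exact h1.congr_fun (fun s hs => (hsum s hs.2).symm) measurableSet_Icc
  · have h2 : ∫ s in (0 : ℝ)..t, ξ (gridIndex T n s) = ∫ s in (0 : ℝ)..t,
        ∑ k ∈ Finset.range (n + 1),
          {s | gridIndex T n s = k}.indicator (fun _ => (1 : ℝ)) s • ξ k := by
      refine intervalIntegral.integral_congr fun s hs => hsum s ?_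
      rw [uIcc_of_le t.2.1] at hs
      exact hs.2.trans t.2.2
    rw [h2, intervalIntegral.integral_finsetSum fun k _ => hint k t, rampSum_apply]
    refine Finset.sum_congr rfl fun k _ => ?_
    rw [rampPath_apply, intervalIntegral.integral_smul_const]

lemma measurable_rampSum {S : Type*} [MeasurableSpace S] (n : ℕ) {ξ : ℕ → S → Fin d → ℝ}
    (hξ : ∀ k, Measurable (ξ k)) : Measurable fun x => rampSum T n fun k => ξ k x := by
  unfold rampSum
  have h : ∀ k ∈ Finset.range (n + 1), Measurable fun x => rampPath T n k (ξ k x) := fun k _ =>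
    (continuous_rampPath n k).measurable.comp (hξ k)
  exact Finset.measurable_fun_sum _ h

/-- The k-th velocity affects the path only after the k-th node, and by then it is known. -/
lemma measurable_rampSum_apply (hT : 0 < T) (n : ℕ) {ξ : ℕ → PathSpace T d → Fin d → ℝ}
    (hξ : ∀ k, Measurable[canonicalFiltration T d (gridNode hT.le n k)] (ξ k))
    (t : Icc (0 : ℝ) T) :
    Measurable[canonicalFiltration T d t] fun x => (rampSum T n fun k => ξ k x).1 t := by
  simp only [rampSum_apply]
  refine Finset.measurable_fun_sum _ fun k hk => ?_
  rcases le_or_gt t (gridNode hT.le n k) with h | h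
  · simp only [rampPath_apply_of_le hT (Finset.mem_range.1 hk).le _ h]
    exact measurable_const
  · simp only [rampPath_apply]
    have h1 : Measurable[canonicalFiltration T d t] (ξ k) :=
      (hξ k).mono ((canonicalFiltration T d).mono h.le) le_rfl
    exact Measurable.const_smul (M := ℝ) h1 _

lemma IsWeakDeriv.smul {h : PathSpace T d} {g : ℝ → Fin d → ℝ} (hg : IsWeakDeriv h g) (c : ℝ) :
    IsWeakDeriv (c • h) (fun s => c • g s) := by
  refine ⟨hg.1.smul c, fun t => ?_⟩
  rw [intervalIntegral.integral_smul, ← hg.2 t]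
  rfl

end RampPath

/-! ### The dual vector -/

section DualVec

variable {d : ℕ} {p q : ℝ}

/-- The vector for which Hölder's inequality for `z` is an equality. -/
noncomputable def dualVec (q : ℝ) (z : Fin d → ℝ) : Fin d → ℝ := fun i => z i * |z i| ^ (q - 2)

lemma measurable_dualVec (q : ℝ) : Measurable (dualVec q : (Fin d → ℝ) → Fin d → ℝ) := by
  unfold dualVec
  fun_prop

lemma ePow_dualVec (hpq : q.HolderConjugate p) (z : Fin d → ℝ) :
    ePow p (dualVec q z) = ePow q z := by
  rw [ePow_eq_sum hpq.pos, ePow_eq_sum hpq.symm.pos]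
  refine Finset.sum_congr rfl fun i _ => ?_
  rw [Real.enorm_eq_ofReal_abs, Real.enorm_eq_ofReal_abs, dualVec,
    ENNReal.ofReal_rpow_of_nonneg (abs_nonneg _) hpq.symm.nonneg,
    ENNReal.ofReal_rpow_of_nonneg (abs_nonneg _) hpq.nonneg]
  congr 1
  rw [abs_mul, abs_of_nonneg (Real.rpow_nonneg (abs_nonneg (z i)) _)]
  -- The exponent q - 2 may be negative, so zero coordinates are treated apart: there the factor z i
  -- annihilates whatever value the power has. Elsewhere the identity is (q - 1) p = q.
  rcases (abs_nonneg (z i)).eq_or_lt with h | h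
  · rw [← h, zero_mul, Real.zero_rpow hpq.symm.ne_zero, Real.zero_rpow hpq.ne_zero]
  · have h1 : |z i| * |z i| ^ (q - 2) = |z i| ^ (q - 1) := by
      rw [show q - 1 = 1 + (q - 2) by ring, Real.rpow_add h, Real.rpow_one]
    rw [h1, ← Real.rpow_mul h.le, hpq.sub_one_mul_conj]

lemma sum_mul_dualVec (hq : 0 < q) (z : Fin d → ℝ) :
    ∑ i, z i * dualVec q z i = (ePow q z).toReal := by
  rw [ePow_eq_sum hq, ENNReal.toReal_sum fun i _ => by finiteness]
  refine Finset.sum_congr rfl fun i _ => ?_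
  rw [← ENNReal.toReal_rpow, toReal_enorm, Real.norm_eq_abs, dualVec, ← mul_assoc,
    ← abs_mul_abs_self (z i)]
  rcases (abs_nonneg (z i)).eq_or_lt with h | h
  · rw [← h, zero_mul, zero_mul, Real.zero_rpow hq.ne']
  · rw [show q = 1 + 1 + (q - 2) by ring, Real.rpow_add h, Real.rpow_add h, Real.rpow_one]
    ring_nf

end DualVec

/-! ### The lower bound -/

section LowerBound

variable {T : ℝ} {d : ℕ} {f : PathSpace T d → ℝ} {Df : Icc (0 : ℝ) T → PathSpace T d → Fin d → ℝ}
  {p q : ℝ} {μ : Measure (PathSpace T d)}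

/-- The conditional expectation of the derivative at the `k`-th grid point, given the past. -/
noncomputable def gridCondExp (hT : 0 < T) (Df : Icc (0 : ℝ) T → PathSpace T d → Fin d → ℝ)
    (μ : Measure (PathSpace T d)) (n k : ℕ) : PathSpace T d → Fin d → ℝ :=
  μ[Df (gridNode hT.le n k) | canonicalFiltration T d (gridNode hT.le n k)]

/-- The path whose velocity is dual to the predicted derivative at the last grid point. -/
noncomputable def gridDirection (hT : 0 < T) (Df : Icc (0 : ℝ) T → PathSpace T d → Fin d → ℝ)
    (μ : Measure (PathSpace T d)) (q : ℝ) (n : ℕ) (x : PathSpace T d) : PathSpace T d :=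
  rampSum T n fun k => dualVec q (gridCondExp hT Df μ n k x)

lemma measurable_gridCondExp_canonicalFiltration (hT : 0 < T) (n k : ℕ) :
    Measurable[canonicalFiltration T d (gridNode hT.le n k)] (gridCondExp hT Df μ n k) :=
  stronglyMeasurable_condExp.measurable

lemma measurable_gridCondExp (hT : 0 < T) (n k : ℕ) : Measurable (gridCondExp hT Df μ n k) :=
  (measurable_gridCondExp_canonicalFiltration hT n k).mono
    ((canonicalFiltration T d).le _) le_rfl

lemma measurable_gridDirection (hT : 0 < T) (n : ℕ) :
    Measurable (gridDirection hT Df μ q n) :=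
  measurable_rampSum n fun k => (measurable_dualVec q).comp (measurable_gridCondExp hT n k)

lemma measurable_gridDirection_apply (hT : 0 < T) (n : ℕ) (t : Icc (0 : ℝ) T) :
    Measurable[canonicalFiltration T d t] fun x => (gridDirection hT Df μ q n x).1 t :=
  measurable_rampSum_apply hT n (ξ := fun k x => dualVec q (gridCondExp hT Df μ n k x))
    (fun k => (measurable_dualVec q).comp (measurable_gridCondExp_canonicalFiltration hT n k)) t

lemma isWeakDeriv_smul_gridDirection (hT : 0 < T) (n : ℕ) (c : ℝ) (x : PathSpace T d) :
    IsWeakDeriv (c • gridDirection hT Df μ q n x)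
      fun s => c • dualVec q (gridCondExp hT Df μ n (gridIndex T n s) x) :=
  (isWeakDeriv_rampSum hT n fun k => dualVec q (gridCondExp hT Df μ n k x)).smul c

lemma leftDeriv_smul_gridDirection (hT : 0 < T) (n : ℕ) (c : ℝ) (x : PathSpace T d) :
    ∀ᵐ t ∂timeMeasure T, leftDeriv t (c • gridDirection hT Df μ q n x) =
      c • dualVec q (gridCondExp hT Df μ n (gridIndex T n (t : Icc (0 : ℝ) T)) x) :=
  (isWeakDeriv_smul_gridDirection hT n c x).leftDeriv_eq

lemma measurable_gridIndex_comp (n : ℕ) {E : Type*} [MeasurableSpace E]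
    {u : ℕ → PathSpace T d → E} (hu : ∀ k, Measurable (u k)) :
    Measurable fun y : PathSpace T d × Icc (0 : ℝ) T => u (gridIndex T n y.2) y.1 := by
  have h1 : Measurable fun y : ℕ × PathSpace T d => u y.1 y.2 :=
    measurable_from_prod_countable_right hu
  have h2 : Measurable fun y : PathSpace T d × Icc (0 : ℝ) T => (gridIndex T n y.2, y.1) :=
    ((measurable_gridIndex T n).comp (measurable_subtype_coe.comp measurable_snd)).prodMk
      measurable_fst
  exact h1.comp h2

/-- The energy of the predicted derivative along the grid. -/
noncomputable def gridEnergy (hT : 0 < T) (Df : Icc (0 : ℝ) T → PathSpace T d → Fin d → ℝ)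
    (μ : Measure (PathSpace T d)) (q : ℝ) (n : ℕ) : ℝ≥0∞ :=
  ∫⁻ t : Icc (0 : ℝ) T, ∫⁻ x, ePow q (gridCondExp hT Df μ n (gridIndex T n t) x) ∂μ ∂timeMeasure T

lemma gridEnergy_eq_lintegral_prod [SFinite μ] (hT : 0 < T) (hq : 0 < q) (n : ℕ) :
    gridEnergy hT Df μ q n = ∫⁻ y, ePow q (gridCondExp hT Df μ n (gridIndex T n y.2) y.1)
      ∂(μ.prod (timeMeasure T)) := by
  rw [lintegral_prod_symm]
  · rfl
  · exact ((measurable_ePow hq).comp (measurable_gridIndex_comp n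
      (measurable_gridCondExp hT n))).aemeasurable

/-- The p-energy of the dual vector is the q-energy of the original one, so the cost of the
direction is the grid energy up to scaling. -/
lemma lintegral_sobolevCost_gridDirection [SFinite μ] (hT : 0 < T) (hpq : q.HolderConjugate p)
    (n : ℕ) (c : ℝ) : ∫⁻ x, sobolevCost p (c • gridDirection hT Df μ q n x) ∂μ =
      ‖c‖ₑ ^ p * gridEnergy hT Df μ q n := by
  have hm : Measurable fun y : PathSpace T d × Icc (0 : ℝ) T =>
      ePow q (gridCondExp hT Df μ n (gridIndex T n y.2) y.1) :=
    (measurable_ePow hpq.pos).comp (measurable_gridIndex_comp n (measurable_gridCondExp hT n))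
  have hc : ‖c‖ₑ ^ p ≠ ⊤ := ENNReal.rpow_ne_top_of_nonneg hpq.symm.nonneg (by finiteness)
  rw [gridEnergy_eq_lintegral_prod hT hpq.pos, lintegral_prod _ hm.aemeasurable,
    ← lintegral_const_mul' _ _ hc]
  refine lintegral_congr fun x => ?_
  rw [(isWeakDeriv_smul_gridDirection hT n c x).sobolevCost_eq p, ← lintegral_const_mul' _ _ hc]
  refine lintegral_congr_ae ?_
  filter_upwards [leftDeriv_smul_gridDirection (Df := Df) (μ := μ) (q := q) hT n c x] with t ht
  rw [ht, ePow_smul hpq.symm.pos, ePow_dualVec hpq]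

variable [IsProbabilityMeasure μ]

lemma MemD1b.lintegral_ePow_gridCondExp_ne_top (hf : MemD1b f Df) (hT : 0 < T)
    (hpq : q.HolderConjugate p)
    (hg : ∃ C : ℝ, ∀ t ω, ‖Df t ω‖ ≤ C * (1 + ‖ω‖ ^ (p - 1)))
    (hμ : ∫⁻ x, ‖x‖ₑ ^ p ∂μ ≠ ⊤) (n k : ℕ) :
    ∫⁻ x, ePow q (gridCondExp hT Df μ n k x) ∂μ ≠ ⊤ := by
  obtain ⟨K, hK⟩ := exists_ePow_deriv_le hpq hg
  refine ne_top_of_le_ne_top (lintegral_const_mul_one_add_ne_top hμ (K := K) ENNReal.coe_ne_top)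
    ((lintegral_ePow_condExp_le hpq.lt.le (hf.memLp_deriv hpq hg hμ _)).trans
      (lintegral_mono fun x => hK _ x))

/-- The dual vector is known at the node, so the derivative may be replaced by its conditional
expectation, and the pairing of a vector with its dual is its q-energy. -/
lemma MemD1b.integral_deriv_mul_dualVec (hf : MemD1b f Df) (hT : 0 < T)
    (hpq : q.HolderConjugate p)
    (hg : ∃ C : ℝ, ∀ t ω, ‖Df t ω‖ ≤ C * (1 + ‖ω‖ ^ (p - 1)))
    (hμ : ∫⁻ x, ‖x‖ₑ ^ p ∂μ ≠ ⊤) (n k : ℕ) :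
    ∫ x, ∑ i, Df (gridNode hT.le n k) x i * dualVec q (gridCondExp hT Df μ n k x) i ∂μ =
      (∫⁻ x, ePow q (gridCondExp hT Df μ n k x) ∂μ).toReal := by
  set t := gridNode hT.le n k with ht
  have hq1 : 1 ≤ ENNReal.ofReal q := by simpa using hpq.lt.le
  have hconj := hpq.ennrealOfReal
  have hD := hf.memLp_deriv hpq hg hμ t
  have hζ : MemLp (gridCondExp hT Df μ n k) (ENNReal.ofReal q) μ := hD.condExp hq1
  have hJ : MemLp (fun x => dualVec q (gridCondExp hT Df μ n k x)) (ENNReal.ofReal p) μ := by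
    refine memLp_of_lintegral_ePow hpq.symm.pos ((measurable_dualVec q).comp
      (measurable_gridCondExp hT n k)).aestronglyMeasurable ?_
    simp only [ePow_dualVec hpq]
    exact hf.lintegral_ePow_gridCondExp_ne_top hT hpq hg hμ n k
  have hJm : ∀ i, StronglyMeasurable[canonicalFiltration T d t]
      fun x => dualVec q (gridCondExp hT Df μ n k x) i := fun i =>
    ((measurable_pi_apply i).comp ((measurable_dualVec q).comp
      (measurable_gridCondExp_canonicalFiltration hT n k))).stronglyMeasurable
  have hint : ∀ φ : PathSpace T d → Fin d → ℝ, MemLp φ (ENNReal.ofReal q) μ → ∀ i,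
      Integrable (fun x => φ x i * dualVec q (gridCondExp hT Df μ n k x) i) μ := fun φ hφ i =>
    (memLp_apply hφ i).integrable_mul (memLp_apply hJ i)
  have hm : Measurable fun x => ePow q (gridCondExp hT Df μ n k x) :=
    (measurable_ePow hpq.pos).comp (measurable_gridCondExp hT n k)
  rw [← integral_toReal hm.aemeasurable (ae_of_all _ fun x => ENNReal.ofReal_lt_top)]
  simp only [← sum_mul_dualVec hpq.pos]
  rw [integral_finsetSum _ fun i _ => hint _ hD i, integral_finsetSum _ fun i _ => hint _ hζ i]
  refine Finset.sum_congr rfl fun i _ => ?_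
  rw [← integral_condExp ((canonicalFiltration T d).le t)]
  refine integral_congr_ae ?_
  have h1 := condExp_mul_of_stronglyMeasurable_right (hJm i) (hint _ hD i)
    ((memLp_apply hD i).integrable hq1)
  refine h1.trans ?_
  filter_upwards [condExp_apply_ae_eq (m := canonicalFiltration T d t) (hD.integrable hq1) i]
    with x hx
  rw [Pi.mul_apply, ← hx]
  rfl

end LowerBound

/-! ### The gain of the grid direction and the discretization error. -/

section LowerBound

variable {T : ℝ} {d : ℕ} {f : PathSpace T d → ℝ} {Df : Icc (0 : ℝ) T → PathSpace T d → Fin d → ℝ}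
  {p q : ℝ} {μ : Measure (PathSpace T d)} [IsProbabilityMeasure μ]

/-- The error in replacing the derivative by its value at the last grid point. -/
noncomputable def gridError (hT : 0 < T) (Df : Icc (0 : ℝ) T → PathSpace T d → Fin d → ℝ)
    (μ : Measure (PathSpace T d)) (q : ℝ) (n : ℕ) : ℝ≥0∞ :=
  ∫⁻ t, ∫⁻ x, ePow q (Df (gridPoint hT.le n t) x - Df t x) ∂μ ∂timeMeasure T

lemma gridError_ne_top (hT : 0 < T) (hpq : q.HolderConjugate p)
    (hg : ∃ C : ℝ, ∀ t ω, ‖Df t ω‖ ≤ C * (1 + ‖ω‖ ^ (p - 1)))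
    (hμ : ∫⁻ x, ‖x‖ₑ ^ p ∂μ ≠ ⊤) (n : ℕ) : gridError hT Df μ q n ≠ ⊤ := by
  obtain ⟨K, hK, hb⟩ := exists_ePow_deriv_sub_le hpq hg
  have h1 : gridError hT Df μ q n ≤ ∫⁻ _ : Icc (0 : ℝ) T, ∫⁻ x, K * (1 + ‖x‖ₑ ^ p) ∂μ
      ∂timeMeasure T := lintegral_mono fun t => lintegral_mono fun x => hb _ _ _
  refine ne_top_of_le_ne_top ?_ h1
  rw [lintegral_const]
  have := lintegral_const_mul_one_add_ne_top hμ hK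
  finiteness

lemma gridEnergy_ne_top (hf : MemD1b f Df) (hT : 0 < T) (hpq : q.HolderConjugate p)
    (hg : ∃ C : ℝ, ∀ t ω, ‖Df t ω‖ ≤ C * (1 + ‖ω‖ ^ (p - 1)))
    (hμ : ∫⁻ x, ‖x‖ₑ ^ p ∂μ ≠ ⊤) (n : ℕ) : gridEnergy hT Df μ q n ≠ ⊤ := by
  obtain ⟨K, hK⟩ := exists_ePow_deriv_le hpq hg
  have h1 : gridEnergy hT Df μ q n ≤ ∫⁻ _ : Icc (0 : ℝ) T, ∫⁻ x, K * (1 + ‖x‖ₑ ^ p) ∂μ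
      ∂timeMeasure T := lintegral_mono fun t =>
    (lintegral_ePow_condExp_le hpq.lt.le (hf.memLp_deriv hpq hg hμ _)).trans
      (lintegral_mono fun x => hK _ x)
  refine ne_top_of_le_ne_top ?_ h1
  rw [lintegral_const]
  have := lintegral_const_mul_one_add_ne_top hμ (K := K) ENNReal.coe_ne_top
  finiteness

/-- With the derivative frozen at the last node the pairing is exactly the energy. Unfreezing it
costs, by Hölder, the L^q grid error times the L^p-norm of the dual direction, whose p-th power is
again the energy. -/
lemma MemD1b.le_integral_deriv_gridDirection (hf : MemD1b f Df) (hT : 0 < T)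
    (hpq : q.HolderConjugate p)
    (hg : ∃ C : ℝ, ∀ t ω, ‖Df t ω‖ ≤ C * (1 + ‖ω‖ ^ (p - 1)))
    (hμ : ∫⁻ x, ‖x‖ₑ ^ p ∂μ ≠ ⊤) (n : ℕ) :
    (gridEnergy hT Df μ q n).toReal -
      (gridError hT Df μ q n ^ (1 / q) * gridEnergy hT Df μ q n ^ (1 / p)).toReal ≤
    ∫ y, ∑ i, Df y.2 y.1 i * dualVec q (gridCondExp hT Df μ n (gridIndex T n y.2) y.1) i
      ∂(μ.prod (timeMeasure T)) := by
  have hA := gridEnergy_ne_top hf hT hpq hg hμ n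
  have hB := gridError_ne_top hT hpq hg hμ n
  have hq0 : 0 ≤ 1 / q := one_div_nonneg.2 hpq.nonneg
  have hp0 : 0 ≤ 1 / p := one_div_nonneg.2 hpq.symm.nonneg
  have hGm : Measurable fun y : PathSpace T d × Icc (0 : ℝ) T =>
      gridCondExp hT Df μ n (gridIndex T n y.2) y.1 :=
    measurable_gridIndex_comp n (measurable_gridCondExp hT n)
  have hJm : Measurable fun y : PathSpace T d × Icc (0 : ℝ) T =>
      dualVec q (gridCondExp hT Df μ n (gridIndex T n y.2) y.1) := (measurable_dualVec q).comp hGm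
  have hDm := hf.measurable_deriv hT
  have hDgm : Measurable fun y : PathSpace T d × Icc (0 : ℝ) T =>
      Df (gridPoint hT.le n y.2) y.1 := measurable_gridIndex_comp n
    (u := fun k => Df (gridNode hT.le n k)) fun k => (hf.continuous_deriv _).measurable
  have hJA : ∫⁻ y, ePow p (dualVec q (gridCondExp hT Df μ n (gridIndex T n y.2) y.1))
      ∂(μ.prod (timeMeasure T)) = gridEnergy hT Df μ q n := by
    simp only [ePow_dualVec hpq]
    exact (gridEnergy_eq_lintegral_prod hT hpq.pos n).symm
  have hErr : ∫⁻ y, ePow q (Df (gridPoint hT.le n y.2) y.1 - Df y.2 y.1)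
      ∂(μ.prod (timeMeasure T)) = gridError hT Df μ q n := by
    have h2 : Measurable fun y : PathSpace T d × Icc (0 : ℝ) T =>
        ePow q (Df (gridPoint hT.le n y.2) y.1 - Df y.2 y.1) :=
      (measurable_ePow hpq.pos).comp (hDgm.sub hDm)
    rw [lintegral_prod_symm _ h2.aemeasurable]
    rfl
  have h1 := lintegral_enorm_inner_le (μ.prod (timeMeasure T)) hpq (hDgm.sub hDm).aemeasurable
    hJm.aemeasurable
  simp only [Pi.sub_apply] at h1
  rw [hJA, hErr] at h1
  have hfin : gridError hT Df μ q n ^ (1 / q) * gridEnergy hT Df μ q n ^ (1 / p) ≠ ⊤ :=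
    ENNReal.mul_ne_top (ENNReal.rpow_ne_top_of_nonneg hq0 hB)
      (ENNReal.rpow_ne_top_of_nonneg hp0 hA)
  have hi1 : Integrable (fun y : PathSpace T d × Icc (0 : ℝ) T =>
      ∑ i, (Df (gridPoint hT.le n y.2) y.1 i - Df y.2 y.1 i) *
        dualVec q (gridCondExp hT Df μ n (gridIndex T n y.2) y.1) i) (μ.prod (timeMeasure T)) :=
    ⟨(measurable_inner (hDgm.sub hDm) hJm).aestronglyMeasurable, h1.trans_lt hfin.lt_top⟩
  have hi2 : Integrable (fun y : PathSpace T d × Icc (0 : ℝ) T =>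
      ∑ i, Df y.2 y.1 i *
        dualVec q (gridCondExp hT Df μ n (gridIndex T n y.2) y.1) i) (μ.prod (timeMeasure T)) := by
    obtain ⟨K, hK⟩ := exists_ePow_deriv_le hpq hg
    refine ⟨(measurable_inner hDm hJm).aestronglyMeasurable,
      (lintegral_enorm_inner_le _ hpq hDm.aemeasurable hJm.aemeasurable).trans_lt ?_⟩
    rw [hJA]
    refine (ENNReal.mul_ne_top (ENNReal.rpow_ne_top_of_nonneg hq0 ?_)
      (ENNReal.rpow_ne_top_of_nonneg hp0 hA)).lt_top
    have h3 : Measurable fun y : PathSpace T d × Icc (0 : ℝ) T => ePow q (Df y.2 y.1) :=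
      (measurable_ePow hpq.pos).comp hDm
    rw [lintegral_prod_symm _ h3.aemeasurable]
    have h2 : ∫⁻ t, ∫⁻ x, ePow q (Df t x) ∂μ ∂timeMeasure T ≤
        ∫⁻ _ : Icc (0 : ℝ) T, ∫⁻ x, K * (1 + ‖x‖ₑ ^ p) ∂μ ∂timeMeasure T :=
      lintegral_mono fun t => lintegral_mono fun x => hK t x
    refine ne_top_of_le_ne_top ?_ h2
    rw [lintegral_const]
    have := lintegral_const_mul_one_add_ne_top hμ (K := K) ENNReal.coe_ne_top
    finiteness
  have hsum : ∫ y, ∑ i, Df (gridPoint hT.le n y.2) y.1 i *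
      dualVec q (gridCondExp hT Df μ n (gridIndex T n y.2) y.1) i ∂(μ.prod (timeMeasure T)) =
      (gridEnergy hT Df μ q n).toReal := by
    have hi3 : Integrable (fun y : PathSpace T d × Icc (0 : ℝ) T =>
        ∑ i, Df (gridPoint hT.le n y.2) y.1 i *
        dualVec q (gridCondExp hT Df μ n (gridIndex T n y.2) y.1) i) (μ.prod (timeMeasure T)) := by
      refine (hi1.add hi2).congr (ae_of_all _ fun y => ?_)
      simp only [Pi.add_apply, ← Finset.sum_add_distrib, ← add_mul, sub_add_cancel]
    rw [integral_prod_symm _ hi3]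
    have h3 : ∀ t : Icc (0 : ℝ) T, ∫ x, ∑ i, Df (gridPoint hT.le n t) x i *
        dualVec q (gridCondExp hT Df μ n (gridIndex T n t) x) i ∂μ =
        (∫⁻ x, ePow q (gridCondExp hT Df μ n (gridIndex T n t) x) ∂μ).toReal := fun t =>
      hf.integral_deriv_mul_dualVec hT hpq hg hμ n _
    simp only [h3]
    refine integral_toReal ?_ (ae_of_all _ fun t =>
      (hf.lintegral_ePow_gridCondExp_ne_top hT hpq hg hμ n _).lt_top)
    have h4 : Measurable fun y : PathSpace T d × Icc (0 : ℝ) T =>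
      ePow q (gridCondExp hT Df μ n (gridIndex T n y.2) y.1) := (measurable_ePow hpq.pos).comp hGm
    exact h4.lintegral_prod_left'.aemeasurable
  have hdiff : ∫ y, ∑ i, (Df (gridPoint hT.le n y.2) y.1 i - Df y.2 y.1 i) *
        dualVec q (gridCondExp hT Df μ n (gridIndex T n y.2) y.1) i ∂(μ.prod (timeMeasure T)) ≤
      (gridError hT Df μ q n ^ (1 / q) * gridEnergy hT Df μ q n ^ (1 / p)).toReal := by
    refine (le_abs_self _).trans ?_
    rw [← Real.norm_eq_abs, ← toReal_enorm]
    exact ENNReal.toReal_mono hfin ((enorm_integral_le_lintegral_enorm _).trans h1)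
  rw [← hsum]
  have h5 : ∫ y, ∑ i, Df (gridPoint hT.le n y.2) y.1 i *
      dualVec q (gridCondExp hT Df μ n (gridIndex T n y.2) y.1) i ∂(μ.prod (timeMeasure T)) =
      ∫ y, ∑ i, (Df (gridPoint hT.le n y.2) y.1 i - Df y.2 y.1 i) *
        dualVec q (gridCondExp hT Df μ n (gridIndex T n y.2) y.1) i ∂(μ.prod (timeMeasure T)) +
      ∫ y, ∑ i, Df y.2 y.1 i *
        dualVec q (gridCondExp hT Df μ n (gridIndex T n y.2) y.1) i ∂(μ.prod (timeMeasure T)) := by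
    rw [← integral_add hi1 hi2]
    simp only [← Finset.sum_add_distrib, ← add_mul, sub_add_cancel]
  linarith

lemma MemD1b.integral_deriv_inner_gridDirection (hf : MemD1b f Df) (hT : 0 < T) (n : ℕ) (c : ℝ) :
    ∫ y, ∑ i, Df y.2 y.1.1 i * leftDeriv y.2 (y.1.2 - y.1.1) i
      ∂((μ.map fun x => (x, x + c • gridDirection hT Df μ q n x)).prod (timeMeasure T)) =
    c * ∫ y, ∑ i, Df y.2 y.1 i * dualVec q (gridCondExp hT Df μ n (gridIndex T n y.2) y.1) i
      ∂(μ.prod (timeMeasure T)) := by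
  have hHm : Measurable fun x => c • gridDirection hT Df μ q n x :=
    (measurable_gridDirection hT n).const_smul c
  have hYm : Measurable fun x => (x, x + c • gridDirection hT Df μ q n x) :=
    measurable_id.prodMk (measurable_id.add hHm)
  have hmap : (μ.map fun x => (x, x + c • gridDirection hT Df μ q n x)).prod (timeMeasure T) =
      (μ.prod (timeMeasure T)).map
        (Prod.map (fun x => (x, x + c • gridDirection hT Df μ q n x)) id) := by
    rw [← Measure.map_prod_map _ _ hYm measurable_id, Measure.map_id]
  rw [hmap, integral_map (hYm.prodMap measurable_id).aemeasurable
    (measurable_inner (hf.measurable_deriv_fst hT)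
      measurable_leftDeriv_increment).aestronglyMeasurable, ← integral_const_mul]
  refine integral_congr_ae ?_
  have hGm : Measurable fun y : PathSpace T d × Icc (0 : ℝ) T =>
      c • dualVec q (gridCondExp hT Df μ n (gridIndex T n y.2) y.1) :=
    ((measurable_dualVec q).comp (measurable_gridIndex_comp n
      (measurable_gridCondExp hT n))).const_smul c
  have hLm : Measurable fun y : PathSpace T d × Icc (0 : ℝ) T =>
      leftDeriv y.2 (c • gridDirection hT Df μ q n y.1) :=
    measurable_leftDeriv_comp measurable_snd (hHm.comp measurable_fst)
  -- For each path the velocity is identified only at almost every time; joint measurability makes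
  -- this an almost sure statement for the product measure.
  have hae : ∀ᵐ y ∂(μ.prod (timeMeasure T)), leftDeriv y.2 (c • gridDirection hT Df μ q n y.1) =
      c • dualVec q (gridCondExp hT Df μ n (gridIndex T n y.2) y.1) :=
    (Measure.ae_prod_iff_ae_ae (measurableSet_eq_fun hLm hGm)).2
      (ae_of_all _ fun x => leftDeriv_smul_gridDirection hT n c x)
  filter_upwards [hae] with y hy
  simp only [Prod.map_fst, Prod.map_snd, id_eq, add_sub_cancel_left]
  rw [hy, Finset.mul_sum]
  refine Finset.sum_congr rfl fun i _ => ?_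
  rw [Pi.smul_apply, smul_eq_mul]
  ring

end LowerBound

/-! ### Construction of nearly optimal measures. -/

section LowerBound

variable {T : ℝ} {d : ℕ} {f : PathSpace T d → ℝ} {Df : Icc (0 : ℝ) T → PathSpace T d → Fin d → ℝ}
  {p q : ℝ} {μ : Measure (PathSpace T d)}

lemma integral_comp_fst {π : Measure (PathSpace T d × PathSpace T d)} (hπ : π.map Prod.fst = μ)
    (hf : Continuous f) : ∫ z, f z.1 ∂π = ∫ x, f x ∂μ := by
  rw [← hπ, integral_map measurable_fst.aemeasurable hf.measurable.aestronglyMeasurable]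

lemma integral_comp_snd {π : Measure (PathSpace T d × PathSpace T d)} (hπ : π.map Prod.snd = μ)
    (hf : Continuous f) : ∫ z, f z.2 ∂π = ∫ x, f x ∂μ := by
  rw [← hπ, integral_map measurable_snd.aemeasurable hf.measurable.aestronglyMeasurable]

variable [IsProbabilityMeasure μ]

lemma exists_gridEnergy_gridError (hf : MemD1b f Df) (hT : 0 < T) (hpq : q.HolderConjugate p)
    (hg : ∃ C : ℝ, ∀ t ω, ‖Df t ω‖ ≤ C * (1 + ‖ω‖ ^ (p - 1)))
    (hμ : ∫⁻ x, ‖x‖ₑ ^ p ∂μ ≠ ⊤) {ε : ℝ} (hε : 0 < ε) :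
    ∃ n, (processNorm q μ fun t => μ[Df t | completedFiltration μ t]).toReal - ε <
        (gridEnergy hT Df μ q n ^ (1 / q)).toReal ∧
      (gridError hT Df μ q n ^ (1 / q)).toReal < ε := by
  have hq0 : 0 < 1 / q := one_div_pos.2 hpq.pos
  have h1 := (hf.tendsto_lintegral_lintegral_ePow_condExp (μ := μ) hT hpq hg hμ).ennrpow_const
    (1 / q)
  rw [← ENNReal.rpow_mul, mul_one_div_cancel hpq.ne_zero, ENNReal.rpow_one] at h1
  have h2 := (ENNReal.tendsto_toReal (hf.processNorm_ne_top hpq hg hμ)).comp h1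
  have h3 := (hf.tendsto_lintegral_lintegral_ePow_sub (μ := μ) hT hpq hg hμ).ennrpow_const (1 / q)
  rw [ENNReal.zero_rpow_of_pos hq0] at h3
  have h4 := (ENNReal.tendsto_toReal ENNReal.zero_ne_top).comp h3
  rw [ENNReal.toReal_zero] at h4
  obtain ⟨n, hn1, hn2⟩ := ((h2.eventually (lt_mem_nhds (sub_lt_self _ hε))).and
    (h4.eventually (gt_mem_nhds hε))).exists
  exact ⟨n, hn1, hn2⟩

lemma exists_pos_ofReal_rpow_le {η : ℝ≥0∞} (hη : η ≠ 0) (hp : 0 < p) :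
    ∃ r : ℝ, 0 < r ∧ ENNReal.ofReal r ^ p ≤ η := by
  have h1 : Tendsto (fun r : ℝ => ENNReal.ofReal r ^ p) (𝓝 0) (𝓝 0) := by
    have h : Continuous fun r : ℝ => ENNReal.ofReal r ^ p :=
      (ENNReal.continuous_rpow_const (y := p)).comp ENNReal.continuous_ofReal
    simpa [ENNReal.zero_rpow_of_pos hp] using h.tendsto 0
  have h2 : ∀ᶠ r in 𝓝[>] (0 : ℝ), ENNReal.ofReal r ^ p < η :=
    (h1.mono_left nhdsWithin_le_nhds).eventually (gt_mem_nhds (pos_iff_ne_zero.2 hη))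
  obtain ⟨r, hr1, hr2⟩ := (h2.and self_mem_nhdsWithin).exists
  exact ⟨r, hr2, hr1.le⟩

/-- Nearly optimal transports of small cost. -/
theorem MemD1b.exists_measure_le_integral_sub (hf : MemD1b f Df) (hT : 0 < T)
    (hpq : q.HolderConjugate p)
    (hg : ∃ C : ℝ, ∀ t ω, ‖Df t ω‖ ≤ C * (1 + ‖ω‖ ^ (p - 1)))
    (hμ : ∫⁻ x, ‖x‖ₑ ^ p ∂μ ≠ ⊤) (hfμ : Integrable f μ) {ε : ℝ} (hε : 0 < ε) :
    ∃ η : ℝ, 0 < η ∧ ∀ w : ℝ, 0 ≤ w → w ≤ η → ∃ ν : Measure (PathSpace T d),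
      IsProbabilityMeasure ν ∧ causalCost p μ ν ^ (1 / p) ≤ ENNReal.ofReal w ∧
      w * ((processNorm q μ fun t => μ[Df t | completedFiltration μ t]).toReal - ε) ≤
        ∫ x, f x ∂ν - ∫ x, f x ∂μ := by
  set Z := (processNorm q μ fun t => μ[Df t | completedFiltration μ t]).toReal with hZ
  have hp := hpq.symm.pos
  have hp0 : 0 ≤ 1 / p := one_div_nonneg.2 hp.le
  have hq0 : 0 ≤ 1 / q := one_div_nonneg.2 hpq.nonneg
  -- If Z ≤ ε then no gain is required and μ itself serves. Otherwise the grid energy below is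
  -- positive and can be normalized.
  rcases le_or_gt Z ε with hZε | hZε
  · refine ⟨1, one_pos, fun w hw _ => ⟨μ, inferInstance, ?_, ?_⟩⟩
    · rw [causalCost_self hT.le hp, ENNReal.zero_rpow_of_pos (one_div_pos.2 hp)]
      exact zero_le
    · rw [sub_self]
      exact mul_nonpos_of_nonneg_of_nonpos hw (by linarith)
  -- The allowance ε is split in three: the defect of the grid energy, the grid error, and the
  -- nonlinear error of the expansion.
  obtain ⟨n, hn1, hn2⟩ := exists_gridEnergy_gridError (μ := μ) hf hT hpq hg hμ
    (show 0 < ε / 3 by positivity)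
  have hA := gridEnergy_ne_top hf hT hpq hg hμ n
  have hB := gridError_ne_top hT hpq hg hμ n
  set A := gridEnergy hT Df μ q n
  set B := gridError hT Df μ q n
  have hA0 : A ≠ 0 := by
    intro h0
    rw [h0, ENNReal.zero_rpow_of_pos (one_div_pos.2 hpq.pos), ENNReal.toReal_zero] at hn1
    linarith
  set a := (A ^ (1 / p)).toReal with ha
  have hAp : A ^ (1 / p) ≠ ⊤ := ENNReal.rpow_ne_top_of_nonneg hp0 hA
  have hapos : 0 < a := ENNReal.toReal_pos (by simp [hA0, hA]) hAp
  have hAeq : A.toReal = a * (A ^ (1 / q)).toReal := by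
    rw [ha, ← ENNReal.toReal_mul, ← ENNReal.rpow_add _ _ hA0 hA, one_div, one_div,
      hpq.symm.inv_add_inv_eq_one, ENNReal.rpow_one]
  obtain ⟨K, hK, hexp⟩ := hf.exists_enorm_integral_sub_le hT hpq hg hμ hfμ
  obtain ⟨η', hη', hgap⟩ := hf.exists_lintegral_derivGap_le hT hpq hg μ hμ
    (ε := ENNReal.ofReal (ε / 3) ^ q)
    (by rw [Ne, ENNReal.rpow_eq_zero_iff]; simp [hε])
  obtain ⟨η, hη, hηη'⟩ := exists_pos_ofReal_rpow_le hη' hp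
  refine ⟨η, hη, fun w hw hwη => ?_⟩
  -- The direction has cost A = a^p, so this scaling makes the cost of the perturbation exactly w^p.
  set c := w / a with hc
  have hc0 : 0 ≤ c := div_nonneg hw hapos.le
  set H : PathSpace T d → PathSpace T d := fun x => c • gridDirection hT Df μ q n x with hH
  have hHm : Measurable H := (measurable_gridDirection hT n).const_smul c
  have hYm : Measurable fun x => x + H x := measurable_id.add hHm
  have hpm : Measurable fun x => (x, x + H x) := measurable_id.prodMk hYm
  have hYad : ∀ t, Measurable[canonicalFiltration T d t] fun x => (x + H x).1 t := fun t => by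
    have h1 := measurable_gridDirection_apply (Df := Df) (μ := μ) (q := q) hT n t
    have h2 : Measurable[canonicalFiltration T d t]
        fun x => c • (gridDirection hT Df μ q n x).1 t := Measurable.const_smul (M := ℝ) h1 c
    have h3 : Measurable[canonicalFiltration T d t] fun x : PathSpace T d => x.1 t :=
      measurable_eval_canonicalFiltration le_rfl
    exact h3.add h2
  have hcost : ∫⁻ x, sobolevCost p (H x) ∂μ = ENNReal.ofReal w ^ p := by
    have h1 : A = ENNReal.ofReal a ^ p := by
      rw [ha, ENNReal.ofReal_toReal hAp, ← ENNReal.rpow_mul, one_div_mul_cancel hp.ne',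
        ENNReal.rpow_one]
    have h2 : ∫⁻ x, sobolevCost p (H x) ∂μ = ‖c‖ₑ ^ p * A :=
      lintegral_sobolevCost_gridDirection hT hpq n c
    rw [h2, Real.enorm_eq_ofReal hc0, h1, ← ENNReal.mul_rpow_of_nonneg _ _ hp.le,
      ← ENNReal.ofReal_mul hc0, hc, div_mul_cancel₀ _ hapos.ne']
  set π : Measure (PathSpace T d × PathSpace T d) := μ.map fun x => (x, x + H x) with hπ
  have hW : ∫⁻ z, sobolevCost p (z.2 - z.1) ∂π = ENNReal.ofReal w ^ p := by
    have hm : Measurable fun z : PathSpace T d × PathSpace T d => sobolevCost p (z.2 - z.1) :=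
      (measurable_sobolevCost hT.le hp).comp measurable_pathIncrement
    rw [hπ, lintegral_map hm hpm, ← hcost]
    simp only [add_sub_cancel_left]
  have hWtop : ENNReal.ofReal w ^ p ≠ ⊤ := ENNReal.rpow_ne_top_of_nonneg hp.le (by finiteness)
  have hπ1 : π.map Prod.fst = μ := (isCausalCoupling_map (μ := μ) hYm hYad).1
  obtain ⟨-, hi, hE⟩ := hexp π hπ1 (by rwa [hW])
  have hG := hgap π hπ1 (by
    rw [hW]
    exact (ENNReal.rpow_le_rpow (ENNReal.ofReal_le_ofReal hwη) hp.le).trans hηη')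
  have hint2 := integral_comp_snd (isCausalCoupling_map (μ := μ) hYm hYad).2.1 hf.continuous
  have hint1 := integral_comp_fst hπ1 hf.continuous
  have hE' : ‖∫ z, f z.2 ∂π - ∫ z, f z.1 ∂π - ∫ y, ∑ i, Df y.2 y.1.1 i *
      leftDeriv y.2 (y.1.2 - y.1.1) i ∂(π.prod (timeMeasure T))‖ₑ ≤
        ENNReal.ofReal (ε / 3 * w) := by
    refine hE.trans ?_
    rw [hW, ← ENNReal.rpow_mul, mul_one_div_cancel hp.ne', ENNReal.rpow_one,
      ENNReal.ofReal_mul (by positivity)]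
    gcongr
    refine (ENNReal.rpow_le_rpow hG hq0).trans_eq ?_
    rw [← ENNReal.rpow_mul, mul_one_div_cancel hpq.ne_zero, ENNReal.rpow_one]
  have hE2 : |∫ z, f z.2 ∂π - ∫ z, f z.1 ∂π - ∫ y, ∑ i, Df y.2 y.1.1 i *
      leftDeriv y.2 (y.1.2 - y.1.1) i ∂(π.prod (timeMeasure T))| ≤ ε / 3 * w := by
    rw [← Real.norm_eq_abs, ← toReal_enorm]
    exact ENNReal.toReal_le_of_le_ofReal (by positivity) hE'
  have hL : c * (A.toReal - (B ^ (1 / q) * A ^ (1 / p)).toReal) ≤ ∫ y, ∑ i, Df y.2 y.1.1 i *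
      leftDeriv y.2 (y.1.2 - y.1.1) i ∂(π.prod (timeMeasure T)) := by
    rw [hπ, hH, hf.integral_deriv_inner_gridDirection hT n c]
    exact mul_le_mul_of_nonneg_left (hf.le_integral_deriv_gridDirection hT hpq hg hμ n) hc0
  have hL2 : c * (A.toReal - (B ^ (1 / q) * A ^ (1 / p)).toReal) =
      w * ((A ^ (1 / q)).toReal - (B ^ (1 / q)).toReal) := by
    rw [ENNReal.toReal_mul, hAeq, ← ha, hc]
    field_simp
  refine ⟨μ.map fun x => x + H x, Measure.isProbabilityMeasure_map hYm.aemeasurable, ?_, ?_⟩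
  · have h1 := causalCost_map_le (μ := μ) hT.le hp hYm hYad
    simp only [add_sub_cancel_left] at h1
    rw [hcost] at h1
    refine (ENNReal.rpow_le_rpow h1 hp0).trans_eq ?_
    rw [← ENNReal.rpow_mul, mul_one_div_cancel hp.ne', ENNReal.rpow_one]
  · rw [hint1, hint2] at hE2
    rw [hL2] at hL
    have h3 := (abs_le.1 hE2).1
    have h4 : w * (Z - ε) ≤ w * ((A ^ (1 / q)).toReal - (B ^ (1 / q)).toReal - ε / 3) :=
      mul_le_mul_of_nonneg_left (by linarith) hw
    linarith

end LowerBound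

/-! ### The upper bounds -/

section UpperBounds

variable {T : ℝ} {d : ℕ} {f : PathSpace T d → ℝ} {Df : Icc (0 : ℝ) T → PathSpace T d → Fin d → ℝ}
  {p q : ℝ} {μ : Measure (PathSpace T d)}

/-- A continuous bound in terms of the cost of each causal coupling is a bound in terms of the
causal transport cost. -/
lemma le_comp_causalCost (hp : 0 < p) {ν : Measure (PathSpace T d)} (hν : causalCost p μ ν ≠ ⊤)
    {a b : ℝ≥0∞} {ψ : ℝ≥0∞ → ℝ≥0∞} (hψ : ContinuousAt ψ (causalCost p μ ν))
    (hψm : Monotone ψ) (hb : causalCost p μ ν < b)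
    (h : ∀ π, IsCausalCoupling μ ν π → ∫⁻ z, sobolevCost p (z.2 - z.1) ∂π < b →
      a ≤ ψ (∫⁻ z, sobolevCost p (z.2 - z.1) ∂π)) : a ≤ ψ (causalCost p μ ν) := by
  -- No optimal coupling is needed: for every r above the infimum some causal coupling costs less
  -- than r, and r then decreases to the infimum by continuity of ψ.
  have hne : (𝓝[>] (causalCost p μ ν)).NeBot := nhdsGT_neBot_of_exists_gt ⟨⊤, hν.lt_top⟩
  have hlim : Tendsto ψ (𝓝[>] (causalCost p μ ν)) (𝓝 (ψ (causalCost p μ ν))) :=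
    hψ.tendsto.mono_left nhdsWithin_le_nhds
  refine ge_of_tendsto hlim ?_
  filter_upwards [self_mem_nhdsWithin, mem_nhdsWithin_of_mem_nhds (Iio_mem_nhds hb)] with r hr hrb
  obtain ⟨π, hπ⟩ := iInf_lt_iff.1 (show causalCost p μ ν < r from hr)
  obtain ⟨hπc, hπr⟩ := iInf_lt_iff.1 hπ
  have heq : ∫⁻ z, sobolevCost p (z.1 - z.2) ∂π = ∫⁻ z, sobolevCost p (z.2 - z.1) ∂π :=
    lintegral_congr fun z => by rw [← sobolevCost_neg hp, neg_sub]
  rw [heq] at hπr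
  exact (h π hπc (hπr.trans hrb)).trans (hψm hπr.le)

variable [IsProbabilityMeasure μ]

/-- Hölder with the growth of the derivative gives a bound of the form (1 + w^p)^(1/q) w, and p/q =
p - 1 turns it into w + w^p. It is not sharp, but it holds at all costs and so controls the
competitors that are far from μ. -/
lemma MemD1b.exists_integral_sub_le (hf : MemD1b f Df) (hT : 0 < T)
    (hpq : q.HolderConjugate p)
    (hg : ∃ C : ℝ, ∀ t ω, ‖Df t ω‖ ≤ C * (1 + ‖ω‖ ^ (p - 1)))
    (hμ : ∫⁻ x, ‖x‖ₑ ^ p ∂μ ≠ ⊤) (hfμ : Integrable f μ) :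
    ∃ C : ℝ, 0 ≤ C ∧ ∀ (ν : Measure (PathSpace T d)) (w : ℝ≥0),
      causalCost p μ ν ^ (1 / p) = w → ∫ x, f x ∂ν - ∫ x, f x ∂μ ≤ C * (w + w ^ p) := by
  have hp := hpq.symm.pos
  have hp0 : 0 ≤ 1 / p := one_div_nonneg.2 hp.le
  have hq0 : 0 ≤ 1 / q := one_div_nonneg.2 hpq.nonneg
  have hq1 : 1 / q ≤ 1 := by rw [div_le_one hpq.pos]; exact hpq.lt.le
  obtain ⟨K, hK, hexp⟩ := hf.exists_enorm_integral_sub_le hT hpq hg hμ hfμ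
  have hK2 : K ^ (1 / q) ≠ ⊤ := ENNReal.rpow_ne_top_of_nonneg hq0 hK
  refine ⟨(K ^ (1 / q)).toReal, ENNReal.toReal_nonneg, fun ν w hw => ?_⟩
  have hW : causalCost p μ ν = (w : ℝ≥0∞) ^ p := by
    rw [← hw, ← ENNReal.rpow_mul, one_div_mul_cancel hp.ne', ENNReal.rpow_one]
  have hWtop : causalCost p μ ν ≠ ⊤ := by
    rw [hW]
    exact ENNReal.rpow_ne_top_of_nonneg hp.le ENNReal.coe_ne_top
  have h1 : ‖∫ x, f x ∂ν - ∫ x, f x ∂μ‖ₑ ≤ (K * (1 + causalCost p μ ν)) ^ (1 / q) *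
      causalCost p μ ν ^ (1 / p) := by
    refine le_comp_causalCost (ψ := fun W => (K * (1 + W)) ^ (1 / q) * W ^ (1 / p)) hp hWtop ?_ ?_
      hWtop.lt_top fun π hπ hπb => ?_
    · have h2 : Continuous fun W : ℝ≥0∞ => (K * (1 + W)) ^ (1 / q) :=
        ENNReal.continuous_rpow_const.comp ((ENNReal.continuous_const_mul hK).comp
          (by fun_prop : Continuous fun W : ℝ≥0∞ => 1 + W))
      have h3 : Continuous fun W : ℝ≥0∞ => W ^ (1 / p) := ENNReal.continuous_rpow_const
      exact ENNReal.Tendsto.mul h2.continuousAt.tendsto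
        (Or.inr (ENNReal.rpow_ne_top_of_nonneg hp0 hWtop)) h3.continuousAt.tendsto
        (Or.inr (ENNReal.rpow_ne_top_of_nonneg hq0 (by finiteness)))
    · intro W W' hWW'
      dsimp only
      gcongr
    · have h2 := (hexp π hπ.1 hπb.ne).1
      rwa [integral_comp_fst hπ.1 hf.continuous, integral_comp_snd hπ.2.1 hf.continuous] at h2
  have h4 : (K * (1 + causalCost p μ ν)) ^ (1 / q) * causalCost p μ ν ^ (1 / p) ≤
      K ^ (1 / q) * (w + (w : ℝ≥0∞) ^ p) := by
    rw [hw, hW, ENNReal.mul_rpow_of_nonneg _ _ hq0, mul_assoc]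
    gcongr
    calc (1 + (w : ℝ≥0∞) ^ p) ^ (1 / q) * w
        ≤ ((1 : ℝ≥0∞) ^ (1 / q) + ((w : ℝ≥0∞) ^ p) ^ (1 / q)) * w := by
          gcongr
          exact ENNReal.rpow_add_le_add_rpow _ _ hq0 hq1
      _ = w + (w : ℝ≥0∞) ^ p := by
          rw [ENNReal.one_rpow, add_mul, one_mul, ← ENNReal.rpow_mul]
          congr 1
          have h5 : p * (1 / q) = p - 1 := by
            rw [mul_one_div, hpq.symm.div_conj_eq_sub_one]
          rw [h5]
          nth_rewrite 2 [← ENNReal.rpow_one (w : ℝ≥0∞)]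
          rw [← ENNReal.rpow_add_of_nonneg _ _ hpq.symm.sub_one_pos.le zero_le_one, sub_add_cancel]
  refine (le_abs_self _).trans ?_
  rw [← Real.norm_eq_abs, ← toReal_enorm]
  have hwp : (w : ℝ≥0∞) ^ p ≠ ⊤ := ENNReal.rpow_ne_top_of_nonneg hp.le ENNReal.coe_ne_top
  refine (ENNReal.toReal_mono (by finiteness) (h1.trans h4)).trans_eq ?_
  rw [ENNReal.toReal_mul, ENNReal.toReal_add ENNReal.coe_ne_top hwp, ENNReal.coe_toReal,
    ← ENNReal.toReal_rpow (w : ℝ≥0∞) p, ENNReal.coe_toReal]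

/-- The pairing with the derivative at X contributes Z w by causality, and the derivative gap
contributes at most ε w once the cost is small. -/
lemma MemD1b.exists_integral_sub_le_of_lt (hf : MemD1b f Df) (hT : 0 < T)
    (hpq : q.HolderConjugate p)
    (hg : ∃ C : ℝ, ∀ t ω, ‖Df t ω‖ ≤ C * (1 + ‖ω‖ ^ (p - 1)))
    (hμ : ∫⁻ x, ‖x‖ₑ ^ p ∂μ ≠ ⊤) (hfμ : Integrable f μ) {ε : ℝ} (hε : 0 < ε) :
    ∃ η : ℝ, 0 < η ∧ ∀ (ν : Measure (PathSpace T d)) (w : ℝ≥0),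
      causalCost p μ ν ^ (1 / p) = w → (w : ℝ) < η → ∫ x, f x ∂ν - ∫ x, f x ∂μ ≤
        ((processNorm q μ fun t => μ[Df t | completedFiltration μ t]).toReal + ε) * w := by
  have hp := hpq.symm.pos
  have hp0 : 0 ≤ 1 / p := one_div_nonneg.2 hp.le
  have hq0 : 0 ≤ 1 / q := one_div_nonneg.2 hpq.nonneg
  set Z := processNorm q μ fun t => μ[Df t | completedFiltration μ t]
  have hZ : Z ≠ ⊤ := hf.processNorm_ne_top hpq hg hμ
  obtain ⟨K, hK, hexp⟩ := hf.exists_enorm_integral_sub_le hT hpq hg hμ hfμ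
  obtain ⟨η', hη', hgap⟩ := hf.exists_lintegral_derivGap_le hT hpq hg μ hμ
    (ε := ENNReal.ofReal ε ^ q)
    (by rw [Ne, ENNReal.rpow_eq_zero_iff]; simp [hε])
  obtain ⟨η, hη, hηη'⟩ := exists_pos_ofReal_rpow_le hη' hp
  refine ⟨η, hη, fun ν w hw hwη => ?_⟩
  have hW : causalCost p μ ν = (w : ℝ≥0∞) ^ p := by
    rw [← hw, ← ENNReal.rpow_mul, one_div_mul_cancel hp.ne', ENNReal.rpow_one]
  have hWtop : causalCost p μ ν ≠ ⊤ := by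
    rw [hW]
    exact ENNReal.rpow_ne_top_of_nonneg hp.le ENNReal.coe_ne_top
  have hWη : causalCost p μ ν < η' := by
    rw [hW]
    refine lt_of_lt_of_le (ENNReal.rpow_lt_rpow ?_ hp) hηη'
    rw [← ENNReal.ofReal_coe_nnreal]
    exact (ENNReal.ofReal_lt_ofReal_iff hη).2 hwη
  have h1 : ‖∫ x, f x ∂ν - ∫ x, f x ∂μ‖ₑ ≤
      (Z + ENNReal.ofReal ε) * causalCost p μ ν ^ (1 / p) := by
    refine le_comp_causalCost (ψ := fun W => (Z + ENNReal.ofReal ε) * W ^ (1 / p)) hp hWtop ?_ ?_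
      (lt_min hWη hWtop.lt_top) fun π hπ hπb => ?_
    · exact ((ENNReal.continuous_const_mul (by finiteness)).comp
        ENNReal.continuous_rpow_const).continuousAt
    · intro W W' hWW'
      dsimp only
      gcongr
    · have hπtop := (hπb.trans_le (min_le_right _ _)).ne
      obtain ⟨-, hi, h2⟩ := hexp π hπ.1 hπtop
      have h3 := hf.enorm_integral_deriv_inner_le hT hpq hg hμ hπ hπtop hi
        (hf.aemeasurable_lintegral_ePow_condExp hT hpq hg hμ)
      have h4 : (∫⁻ z, derivGap q Df z.1 (z.2 - z.1) ∂π) ^ (1 / q) ≤ ENNReal.ofReal ε := by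
        refine (ENNReal.rpow_le_rpow (hgap π hπ.1 (hπb.trans_le (min_le_left _ _)).le)
          hq0).trans_eq ?_
        rw [← ENNReal.rpow_mul, mul_one_div_cancel hpq.ne_zero, ENNReal.rpow_one]
      rw [integral_comp_fst hπ.1 hf.continuous, integral_comp_snd hπ.2.1 hf.continuous] at h2
      rw [add_mul]
      refine le_trans ?_ (add_le_add h3 (h2.trans (mul_le_mul_left h4 _)))
      refine le_trans (le_of_eq ?_) (enorm_add_le _ _)
      rw [add_sub_cancel]
  rw [hw] at h1
  refine (le_abs_self _).trans ?_
  rw [← Real.norm_eq_abs, ← toReal_enorm]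
  refine (ENNReal.toReal_mono (by finiteness) h1).trans_eq ?_
  rw [ENNReal.toReal_mul, ENNReal.toReal_add hZ (by finiteness), ENNReal.toReal_ofReal hε.le,
    ENNReal.coe_toReal]

end UpperBounds

/-! ### The convex conjugate and penalization -/

section Penalization

variable {p : ℝ} {L : ℝ≥0 → ℝ≥0∞}

lemma exists_mul_rpow_le
    (hL : Tendsto (fun u : ℝ≥0 => L u / (u : ℝ≥0∞) ^ p) atTop (𝓝 ⊤)) (M : ℝ≥0) :
    ∃ U : ℝ≥0, 1 ≤ U ∧ ∀ u ≥ U, L u ≠ ⊤ → M * (u : ℝ) ^ p ≤ (L u).toReal := by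
  obtain ⟨U, hU⟩ := eventually_atTop.1
    (hL.eventually (lt_mem_nhds (ENNReal.coe_lt_top (r := M))))
  refine ⟨max U 1, le_max_right _ _, fun u hu hLu => ?_⟩
  have h1 : (M : ℝ≥0∞) * (u : ℝ≥0∞) ^ p ≤ L u :=
    ENNReal.mul_le_of_le_div (hU u ((le_max_left _ _).trans hu)).le
  have h2 := ENNReal.toReal_mono hLu h1
  rwa [ENNReal.toReal_mul, ← ENNReal.toReal_rpow, ENNReal.coe_toReal, ENNReal.coe_toReal] at h2

/-- Beyond a threshold that is at least 1, u ≤ u^p. -/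
lemma exists_mul_le (hL : Tendsto (fun u : ℝ≥0 => L u / (u : ℝ≥0∞) ^ p) atTop (𝓝 ⊤))
    (hp : 1 ≤ p) (M : ℝ≥0) :
    ∃ U : ℝ≥0, ∀ u ≥ U, L u ≠ ⊤ → M * (u : ℝ) ≤ (L u).toReal := by
  obtain ⟨U, hU1, hU⟩ := exists_mul_rpow_le hL M
  refine ⟨U, fun u hu hLu => le_trans ?_ (hU u hu hLu)⟩
  have hu1 : (1 : ℝ) ≤ u := by exact_mod_cast hU1.trans hu
  gcongr
  exact Real.self_le_rpow_of_one_le hu1 hp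

lemma convexConjugate_term {v : ℝ≥0∞} (hv : v ≠ ⊤) {u : ℝ≥0} (hu : L u ≠ ⊤) :
    (((u : ℝ≥0∞) * v : ℝ≥0∞) : EReal) - ((L u : ℝ≥0∞) : EReal) =
      ((u * v.toReal - (L u).toReal : ℝ) : EReal) := by
  rw [EReal.coe_sub, EReal.coe_ennreal_toReal hu]
  congr 1
  have h : (u : ℝ) * v.toReal = ((u : ℝ≥0∞) * v).toReal := by simp
  rw [h, EReal.coe_ennreal_toReal (by finiteness)]

/-- The convex conjugate of a superlinear function is finite. -/
lemma exists_convexConjugate_eq (hL0 : L 0 = 0)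
    (hL : Tendsto (fun u : ℝ≥0 => L u / (u : ℝ≥0∞) ^ p) atTop (𝓝 ⊤)) (hp : 1 ≤ p)
    {v : ℝ≥0∞} (hv : v ≠ ⊤) :
    ∃ Υ : ℝ, (Υ : EReal) = convexConjugate L v ∧
      (∀ u, L u ≠ ⊤ → u * v.toReal - (L u).toReal ≤ Υ) ∧
      ∀ ε > 0, ∃ u, L u ≠ ⊤ ∧ Υ - ε < u * v.toReal - (L u).toReal := by
  obtain ⟨U, hU⟩ := exists_mul_le hL hp v.toNNReal
  have hle : ∀ u, L u ≠ ⊤ → u * v.toReal - (L u).toReal ≤ U * v.toReal := fun u hu => by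
    rcases le_total u U with h | h
    · have h1 : (u : ℝ) * v.toReal ≤ U * v.toReal := by gcongr
      have h2 := ENNReal.toReal_nonneg (a := L u)
      linarith
    · have h1 : v.toReal * (u : ℝ) ≤ (L u).toReal := hU u h hu
      have h2 : 0 ≤ (U : ℝ) * v.toReal := by positivity
      linarith
  have hterm : ∀ u, L u = ⊤ →
      (((u : ℝ≥0∞) * v : ℝ≥0∞) : EReal) - ((L u : ℝ≥0∞) : EReal) = ⊥ := fun u hu => by
    rw [hu]
    simp
  have hupper : convexConjugate L v ≤ ((U * v.toReal : ℝ) : EReal) := iSup_le fun u => by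
    by_cases hu : L u = ⊤
    · rw [hterm u hu]
      exact bot_le
    · rw [convexConjugate_term hv hu]
      exact EReal.coe_le_coe (hle u hu)
  have hlower : (0 : EReal) ≤ convexConjugate L v := by
    refine le_trans (le_of_eq ?_) (le_iSup _ (0 : ℝ≥0))
    simp [hL0]
  have heq : ((convexConjugate L v).toReal : EReal) = convexConjugate L v :=
    EReal.coe_toReal (ne_top_of_le_ne_top (EReal.coe_ne_top _) hupper)
      (ne_bot_of_le_ne_bot EReal.zero_ne_bot hlower)
  refine ⟨_, heq, fun u hu => ?_, fun ε hε => ?_⟩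
  · rw [← EReal.coe_le_coe_iff, heq, ← convexConjugate_term hv hu]
    exact le_iSup (fun u : ℝ≥0 =>
      (((u : ℝ≥0∞) * v : ℝ≥0∞) : EReal) - ((L u : ℝ≥0∞) : EReal)) u
  · have h1 : (((convexConjugate L v).toReal - ε : ℝ) : EReal) < convexConjugate L v := by
      conv_rhs => rw [← heq]
      exact EReal.coe_lt_coe_iff.2 (sub_lt_self _ hε)
    obtain ⟨u, hu⟩ := lt_iSup_iff.1 h1
    by_cases hLu : L u = ⊤
    · rw [hterm u hLu] at hu
      exact absurd hu not_lt_bot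
    · rw [convexConjugate_term hv hLu] at hu
      exact ⟨u, hLu, EReal.coe_lt_coe_iff.1 hu⟩

/-- The upper bound for a penalized functional, from a first-order bound for small costs and a
growth bound for all costs. -/
lemma exists_penalized_le {ι : Type*} {D : ι → ℝ} {W : ι → ℝ≥0∞} {C Z Υ : ℝ} (hp : 1 < p)
    (hC : 0 ≤ C) (hZ : 0 ≤ Z) (hL : Tendsto (fun u : ℝ≥0 => L u / (u : ℝ≥0∞) ^ p) atTop (𝓝 ⊤))
    (hL0 : L 0 = 0) (h1 : ∀ i (w : ℝ≥0), W i = w → D i ≤ C * (w + w ^ p))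
    (h2 : ∀ ε > 0, ∃ η : ℝ, 0 < η ∧ ∀ i (w : ℝ≥0), W i = w → (w : ℝ) < η → D i ≤ (Z + ε) * w)
    (hΥ : ∀ u, L u ≠ ⊤ → u * Z - (L u).toReal ≤ Υ) {ε : ℝ} (hε : 0 < ε) :
    ∃ δ₀ : ℝ≥0, 0 < δ₀ ∧ ∀ δ : ℝ≥0, 0 < δ → δ < δ₀ → ∀ i (w : ℝ≥0), W i = w →
      L (w / δ) ≠ ⊤ → D i - δ * (L (w / δ)).toReal ≤ δ * (Υ + ε) := by
  have hΥ0 : 0 ≤ Υ := by simpa [hL0] using hΥ 0 (by simp [hL0])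
  -- Beyond U a finite penalty is at least (Z + 1) u, which outweighs the gain (Z + ε₁) u since ε₁ ≤
  -- 1. Below U the surplus ε₁ u is at most ε by the choice of ε₁.
  obtain ⟨U, hU⟩ := exists_mul_le hL hp.le (Real.toNNReal (Z + 1))
  set ε₁ : ℝ := min 1 (ε / (U + 1)) with hε₁
  have hε₁0 : 0 < ε₁ := lt_min one_pos (by positivity)
  have hε₁U : ε₁ * U ≤ ε := by
    calc ε₁ * U ≤ ε / (U + 1) * (U + 1) := by
          gcongr
          · exact min_le_right _ _
          · linarith
      _ = ε := div_mul_cancel₀ _ (by positivity)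
  obtain ⟨η, hη, hη2⟩ := h2 ε₁ hε₁0
  -- For w ≥ η one has w ≤ η^(1-p) w^p, so this constant times w^p dominates the whole growth bound.
  obtain ⟨V, hV1, hV⟩ := exists_mul_rpow_le hL
    (Real.toNNReal (C * (η ^ (1 - p) + 1)))
  -- The condition δ < η/V forces w/δ ≥ V whenever w ≥ η, and δ ≤ 1 gives w^p = δ^p u^p ≤ δ u^p.
  refine ⟨min 1 (Real.toNNReal (η / V)), ?_, fun δ hδ hδ0 i w hw hLw => ?_⟩
  · have : (0 : ℝ) < V := by exact_mod_cast zero_lt_one.trans_le hV1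
    exact lt_min one_pos (Real.toNNReal_pos.2 (by positivity))
  have hδr : (0 : ℝ) < δ := hδ
  set u := w / δ with hu
  have hwu : (w : ℝ) = δ * u := by
    rw [hu, NNReal.coe_div, mul_div_cancel₀ _ hδr.ne']
  have hLnn := ENNReal.toReal_nonneg (a := L u)
  rcases lt_or_ge (w : ℝ) η with hwη | hwη
  · have h3 := hη2 i w hw hwη
    have h4 : D i - δ * (L u).toReal ≤ δ * ((Z + ε₁) * u - (L u).toReal) := by
      rw [hwu] at h3
      linarith
    refine h4.trans (mul_le_mul_of_nonneg_left ?_ hδr.le)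
    rcases le_total u U with h5 | h5
    · have h6 : ε₁ * u ≤ ε := le_trans (by gcongr) hε₁U
      have h7 := hΥ u hLw
      linarith
    · have h6 := hU u h5 hLw
      rw [Real.coe_toNNReal _ (by linarith)] at h6
      have h7 : ε₁ * u ≤ 1 * u := by
        gcongr
        exact min_le_left _ _
      linarith
  · have h3 := h1 i w hw
    have hw0 : (0 : ℝ) < w := hη.trans_le hwη
    have hVδ : δ * V ≤ w := by
      have hV0 : (0 : ℝ) < V := by exact_mod_cast zero_lt_one.trans_le hV1
      have h5 : (δ : ℝ) < η / V := by
        have := hδ0.trans_le (min_le_right _ _)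
        rwa [← NNReal.coe_lt_coe, Real.coe_toNNReal _ (by positivity)] at this
      rw [lt_div_iff₀ hV0] at h5
      exact_mod_cast (h5.le.trans hwη)
    have hVu : V ≤ u := by
      rw [hu, le_div_iff₀ hδ, mul_comm]
      exact hVδ
    have h4 := hV u hVu hLw
    have hη0 : 0 ≤ η ^ (1 - p) := Real.rpow_nonneg hη.le _
    rw [Real.coe_toNNReal _ (by positivity)] at h4
    have hwp : (w : ℝ) ≤ η ^ (1 - p) * (w : ℝ) ^ p := by
      have h6 : (w : ℝ) ^ (1 - p) ≤ η ^ (1 - p) :=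
        Real.rpow_le_rpow_of_nonpos hη hwη (by linarith)
      calc (w : ℝ) = (w : ℝ) ^ (1 - p) * (w : ℝ) ^ p := by
            rw [← Real.rpow_add hw0, sub_add_cancel, Real.rpow_one]
        _ ≤ _ := by gcongr
    have h7 : C * (w + (w : ℝ) ^ p) ≤ C * (η ^ (1 - p) + 1) * (w : ℝ) ^ p := by
      rw [mul_assoc]
      refine mul_le_mul_of_nonneg_left ?_ hC
      linarith
    have hδ1 : (δ : ℝ) ≤ 1 := by exact_mod_cast (hδ0.trans_le (min_le_left _ _)).le
    have h8 : (w : ℝ) ^ p ≤ δ * (u : ℝ) ^ p := by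
      rw [hwu, Real.mul_rpow hδr.le (NNReal.coe_nonneg u)]
      gcongr
      exact Real.rpow_le_self_of_le_one hδr.le hδ1 hp.le
    have h9 : C * (η ^ (1 - p) + 1) * (w : ℝ) ^ p ≤ δ * (L u).toReal := by
      calc C * (η ^ (1 - p) + 1) * (w : ℝ) ^ p
          ≤ C * (η ^ (1 - p) + 1) * (δ * (u : ℝ) ^ p) := by gcongr
        _ = δ * (C * (η ^ (1 - p) + 1) * (u : ℝ) ^ p) := by ring
        _ ≤ _ := by gcongr
    have h10 : 0 ≤ δ * (Υ + ε) := by positivity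
    linarith

/-- The lower bound for a penalized functional. -/
lemma exists_le_penalized {ι : Type*} {D : ι → ℝ} {W : ι → ℝ≥0∞} {Z Υ : ℝ} (hL : Monotone L)
    (h : ∀ ε > 0, ∃ η : ℝ, 0 < η ∧ ∀ w : ℝ, 0 ≤ w → w ≤ η →
      ∃ i, W i ≤ ENNReal.ofReal w ∧ w * (Z - ε) ≤ D i)
    (hΥ : ∀ ε > 0, ∃ u, L u ≠ ⊤ ∧ Υ - ε < u * Z - (L u).toReal) {ε : ℝ} (hε : 0 < ε) :
    ∃ δ₀ : ℝ≥0, 0 < δ₀ ∧ ∀ δ : ℝ≥0, 0 < δ → δ < δ₀ → ∃ i, ∃ w : ℝ≥0, W i = w ∧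
      L (w / δ) ≠ ⊤ ∧ δ * (Υ - ε) ≤ D i - δ * (L (w / δ)).toReal := by
  obtain ⟨u, hu, hu2⟩ := hΥ (ε / 2) (by positivity)
  -- The competitor is taken at w = δ u with u nearly optimal for the conjugate. The first-order
  -- error, multiplied by u, stays below ε/2. The actual cost may be less than w, which only lowers
  -- the penalty since L is monotone.
  obtain ⟨η, hη, hη2⟩ := h (ε / 2 / (u + 1)) (by positivity)
  refine ⟨Real.toNNReal (η / (u + 1)), Real.toNNReal_pos.2 (by positivity), fun δ hδ hδ0 => ?_⟩
  have hδr : (0 : ℝ) < δ := hδ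
  have h1 : (δ : ℝ) * u ≤ η := by
    rw [← NNReal.coe_lt_coe, Real.coe_toNNReal _ (by positivity), lt_div_iff₀ (by positivity)]
      at hδ0
    linarith
  obtain ⟨i, hi, hi2⟩ := hη2 (δ * u) (by positivity) h1
  have hi' : W i ≤ ((δ * u : ℝ≥0) : ℝ≥0∞) := by
    rwa [← NNReal.coe_mul, ENNReal.ofReal_coe_nnreal] at hi
  have hWtop : W i ≠ ⊤ := ne_top_of_le_ne_top ENNReal.coe_ne_top hi'
  have hw : (W i).toNNReal / δ ≤ u := by
    rw [div_le_iff₀ hδ, mul_comm]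
    rwa [← ENNReal.coe_le_coe, ENNReal.coe_toNNReal hWtop]
  have hLw := hL hw
  refine ⟨i, (W i).toNNReal, (ENNReal.coe_toNNReal hWtop).symm, ne_top_of_le_ne_top hu hLw, ?_⟩
  have h3 := ENNReal.toReal_mono hu hLw
  have h4 : (u : ℝ) * (ε / 2 / (u + 1)) ≤ ε / 2 := by
    rw [mul_div_assoc', div_le_iff₀ (by positivity)]
    nlinarith [u.2]
  have h5 : (δ : ℝ) * (Υ - ε) ≤ δ * (u * (Z - ε / 2 / (u + 1)) - (L u).toReal) :=
    mul_le_mul_of_nonneg_left (by linarith) hδr.le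
  have h6 : (δ : ℝ) * (L ((W i).toNNReal / δ)).toReal ≤ δ * (L u).toReal := by gcongr
  linarith

end Penalization

/-! ### The robust value -/

section RobustValue

variable {T : ℝ} {d : ℕ} {f : PathSpace T d → ℝ} {Df : Icc (0 : ℝ) T → PathSpace T d → Fin d → ℝ}
  {p q : ℝ} {μ : Measure (PathSpace T d)} {L : ℝ≥0 → ℝ≥0∞}

lemma lintegral_enorm_rpow_ne_top (hp : 0 ≤ p) (hμ : Integrable (fun ω => ‖ω‖ ^ p) μ) :
    ∫⁻ x, ‖x‖ₑ ^ p ∂μ ≠ ⊤ := by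
  refine ne_of_lt (lt_of_eq_of_lt (lintegral_congr fun x => ?_) hμ.2)
  rw [← ofReal_norm, ENNReal.ofReal_rpow_of_nonneg (norm_nonneg x) hp,
    Real.enorm_eq_ofReal (Real.rpow_nonneg (norm_nonneg x) p)]

lemma processNorm_congr {Ω : Type*} {m : MeasurableSpace Ω} {μ : Measure Ω}
    {A B : Icc (0 : ℝ) T → Ω → Fin d → ℝ} (h : ∀ t, A t =ᵐ[μ] B t) :
    processNorm q μ A = processNorm q μ B := by
  unfold processNorm
  congr 1
  refine lintegral_congr fun t => lintegral_congr_ae ?_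
  filter_upwards [h t] with x hx
  rw [hx]

/-- Deterministic times are stopping times. Together with `processNorm_congr` this reduces the norm
of any optional projection to conditional expectations at fixed times. -/
lemma IsOptionalProjection.ae_eq {Ω : Type*} {m : MeasurableSpace Ω} {μ : Measure Ω}
    [IsFiniteMeasure μ] {𝓗 : Filtration (Icc (0 : ℝ) T) m}
    {A B : Icc (0 : ℝ) T → Ω → Fin d → ℝ}
    (h : IsOptionalProjection μ 𝓗 A B) (t : Icc (0 : ℝ) T) : B t =ᵐ[μ] μ[A t | 𝓗 t] := by
  have h1 := h.2 (fun _ => t) (isStoppingTime_const 𝓗 t)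
  rwa [IsStoppingTime.measurableSpace_const] at h1

lemma sub_penalty_eq_bot {a : ℝ} {δ : ℝ≥0} {w : ℝ≥0∞} (h : penalty L δ w = ⊤) :
    (a : EReal) - ((penalty L δ w : ℝ≥0∞) : EReal) = ⊥ := by
  rw [h, EReal.coe_ennreal_top, EReal.sub_top]

lemma penalty_coe {δ : ℝ≥0} (hδ : 0 < δ) (w : ℝ≥0) : penalty L δ w = δ * L (w / δ) := by
  rw [penalty, if_neg ENNReal.coe_ne_top, if_neg hδ.ne', ENNReal.toNNReal_coe]

lemma sub_penalty_eq {a : ℝ} {δ : ℝ≥0} (hδ : 0 < δ) {w : ℝ≥0} (h : L (w / δ) ≠ ⊤) :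
    (a : EReal) - ((penalty L δ w : ℝ≥0∞) : EReal) =
      ((a - δ * (L (w / δ)).toReal : ℝ) : EReal) := by
  have h1 : (δ : ℝ) * (L (w / δ)).toReal = (penalty L δ w).toReal := by
    rw [penalty_coe hδ, ENNReal.toReal_mul, ENNReal.coe_toReal]
  have h2 : penalty L δ w ≠ ⊤ := by
    rw [penalty_coe hδ]
    finiteness
  rw [EReal.coe_sub, h1, EReal.coe_ennreal_toReal h2]

lemma robustValue_le {δ : ℝ≥0} (hδ : 0 < δ) {c : ℝ}
    (h : ∀ (ν : Measure (PathSpace T d)) (w : ℝ≥0), IsProbabilityMeasure ν →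
      causalCost p μ ν ^ (1 / p) = w → L (w / δ) ≠ ⊤ →
        ∫ x, f x ∂ν - δ * (L (w / δ)).toReal ≤ c) : robustValue p L μ f δ ≤ c := by
  refine iSup₂_le fun ν hν => ?_
  by_cases hw : causalCost p μ ν ^ (1 / p) = ⊤
  · rw [sub_penalty_eq_bot (by rw [hw, penalty, if_pos rfl])]
    exact bot_le
  · obtain ⟨w, hw'⟩ : ∃ w : ℝ≥0, causalCost p μ ν ^ (1 / p) = w :=
      ⟨_, (ENNReal.coe_toNNReal hw).symm⟩
    rw [hw']
    by_cases hL : L (w / δ) = ⊤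
    · rw [sub_penalty_eq_bot (by
        rw [penalty_coe hδ, hL, ENNReal.mul_top (by simpa using hδ.ne')])]
      exact bot_le
    · rw [sub_penalty_eq hδ hL]
      exact EReal.coe_le_coe (h ν w hν hw' hL)

lemma le_robustValue {δ : ℝ≥0} (hδ : 0 < δ) {c : ℝ} (ν : Measure (PathSpace T d)) (w : ℝ≥0)
    (hν : IsProbabilityMeasure ν) (hw : causalCost p μ ν ^ (1 / p) = w) (hL : L (w / δ) ≠ ⊤)
    (h : c ≤ ∫ x, f x ∂ν - δ * (L (w / δ)).toReal) : (c : EReal) ≤ robustValue p L μ f δ := by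
  refine le_trans ?_ (le_iSup₂ ν hν)
  rw [hw, sub_penalty_eq hδ hL]
  exact EReal.coe_le_coe h

/-- Only ν at zero cost compete. They need not be identified with μ: the growth bound at w = 0
already shows that they do no better. -/
lemma robustValue_zero [IsProbabilityMeasure μ] (hT : 0 ≤ T) (hp : 0 < p) {C : ℝ}
    (h : ∀ (ν : Measure (PathSpace T d)) (w : ℝ≥0),
      causalCost p μ ν ^ (1 / p) = w → ∫ x, f x ∂ν - ∫ x, f x ∂μ ≤ C * (w + w ^ p)) :
    robustValue p L μ f 0 = ((∫ x, f x ∂μ : ℝ) : EReal) := by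
  refine le_antisymm (iSup₂_le fun ν hν => ?_) ?_
  · by_cases hw : causalCost p μ ν ^ (1 / p) = 0
    · have h1 := h ν 0 (by simpa using hw)
      rw [NNReal.coe_zero, Real.zero_rpow hp.ne', add_zero, mul_zero] at h1
      have h2 : penalty L 0 (causalCost p μ ν ^ (1 / p)) = 0 := by
        rw [hw, penalty, if_neg ENNReal.zero_ne_top, if_pos rfl, if_pos rfl]
      rw [h2, EReal.coe_ennreal_zero, sub_zero]
      exact EReal.coe_le_coe (by linarith)
    · rw [sub_penalty_eq_bot]
      · exact bot_le
      · rw [penalty, if_pos rfl, if_neg hw, ite_self]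
  · refine le_iSup₂_of_le μ inferInstance (le_of_eq ?_)
    have h2 : penalty L 0 (causalCost p μ μ ^ (1 / p)) = 0 := by
      rw [causalCost_self hT hp, ENNReal.zero_rpow_of_pos (one_div_pos.2 hp), penalty,
        if_neg ENNReal.zero_ne_top, if_pos rfl, if_pos rfl]
    rw [h2, EReal.coe_ennreal_zero, sub_zero]

/-- A function with upper and lower first-order expansions at zero is differentiable there. -/
lemma exists_derivative_of_bounds {V : ℝ≥0 → EReal} {a Υ : ℝ} (h0 : V 0 = a)
    (hV : ∀ ε > 0, ∃ δ₀ : ℝ≥0, 0 < δ₀ ∧ ∀ δ : ℝ≥0, 0 < δ → δ < δ₀ →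
      V δ ≤ ((a + δ * (Υ + ε) : ℝ) : EReal) ∧ ((a + δ * (Υ - ε) : ℝ) : EReal) ≤ V δ) :
    ∃ v : ℝ≥0 → ℝ, (∀ᶠ δ in 𝓝 (0 : ℝ≥0), V δ = (v δ : EReal)) ∧ v 0 = a ∧
      (fun δ : ℝ≥0 => v δ - (v 0 + Υ * δ)) =o[𝓝 (0 : ℝ≥0)] (fun δ : ℝ≥0 => (δ : ℝ)) ∧
      Tendsto (fun δ : ℝ≥0 => (v δ - v 0) / δ) (𝓝[>] (0 : ℝ≥0)) (𝓝 Υ) := by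
  have hcoe : ∀ ε > 0, ∃ δ₀ : ℝ≥0, 0 < δ₀ ∧ ∀ δ : ℝ≥0, δ < δ₀ →
      V δ = ((V δ).toReal : EReal) ∧ |(V δ).toReal - (a + Υ * δ)| ≤ ε * δ := fun ε hε => by
    obtain ⟨δ₀, hδ₀, h⟩ := hV ε hε
    refine ⟨δ₀, hδ₀, fun δ hδ => ?_⟩
    rcases eq_zero_or_pos δ with rfl | hpos
    · simp [h0]
    · obtain ⟨h1, h2⟩ := h δ hpos hδ
      have h3 : ((V δ).toReal : EReal) = V δ := EReal.coe_toReal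
        (ne_top_of_le_ne_top (EReal.coe_ne_top _) h1) (ne_bot_of_le_ne_bot (EReal.coe_ne_bot _) h2)
      rw [← h3, EReal.coe_le_coe_iff] at h1 h2
      exact ⟨h3.symm, abs_le.2 ⟨by linarith, by linarith⟩⟩
  have hv0 : (V 0).toReal = a := by rw [h0, EReal.toReal_coe]
  refine ⟨fun δ => (V δ).toReal, ?_, hv0, ?_, ?_⟩
  · obtain ⟨δ₀, hδ₀, h⟩ := hcoe 1 one_pos
    filter_upwards [Iio_mem_nhds hδ₀] with δ hδ
    exact (h δ hδ).1
  · refine Asymptotics.isLittleO_iff.2 fun ε hε => ?_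
    obtain ⟨δ₀, hδ₀, h⟩ := hcoe ε hε
    filter_upwards [Iio_mem_nhds hδ₀] with δ hδ
    rw [hv0, Real.norm_eq_abs, Real.norm_eq_abs, NNReal.abs_eq]
    exact (h δ hδ).2
  · refine Metric.tendsto_nhds.2 fun ε hε => ?_
    obtain ⟨δ₀, hδ₀, h⟩ := hcoe (ε / 2) (by positivity)
    filter_upwards [mem_nhdsWithin_of_mem_nhds (Iio_mem_nhds hδ₀), self_mem_nhdsWithin]
      with δ hδ hpos
    have hδr : (0 : ℝ) < δ := hpos
    have h1 := (h δ hδ).2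
    have h2 : ((V δ).toReal - (V 0).toReal) / δ - Υ = ((V δ).toReal - (a + Υ * δ)) / δ := by
      rw [hv0]
      field_simp
      ring
    rw [Real.dist_eq, h2, abs_div, abs_of_pos hδr, div_lt_iff₀ hδr]
    have h3 : ε / 2 * (δ : ℝ) < ε * δ := by
      gcongr
      linarith
    linarith

end RobustValue

end CausalDRO

theorem mainTheorem3 {T p q : ℝ} {d : ℕ} (hT : 0 < T) (hd : 1 ≤ d) (hp : 1 < p)
    (hq : q = p / (p - 1))
    (L : ℝ≥0 → ℝ≥0∞) (hL_lsc : LowerSemicontinuous L) (hL_mono : Monotone L) (hL_zero : L 0 = 0)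
    (hL_growth : Tendsto (fun u : ℝ≥0 => L u / (u : ℝ≥0∞) ^ p) atTop (𝓝 ⊤))
    (f : CausalDRO.PathSpace T d → ℝ)
    (Df : Icc (0 : ℝ) T → CausalDRO.PathSpace T d → Fin d → ℝ)
    (hf : CausalDRO.MemD1b f Df)
    (hf_growth : ∃ C : ℝ, ∀ ω, |f ω| ≤ C * (1 + ‖ω‖ ^ p))
    (hDf_growth : ∃ C : ℝ, ∀ t ω, ‖Df t ω‖ ≤ C * (1 + ‖ω‖ ^ (p - 1)))
    (μ : Measure (CausalDRO.PathSpace T d)) [IsProbabilityMeasure μ]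
    (hμ : Integrable (fun ω => ‖ω‖ ^ p) μ) :
    ∃ (v : ℝ≥0 → ℝ) (Υ : ℝ),
      (∀ᶠ δ in 𝓝 (0 : ℝ≥0), CausalDRO.robustValue p L μ f δ = (v δ : EReal)) ∧
      v 0 = ∫ ω, f ω ∂μ ∧
      (fun δ : ℝ≥0 => v δ - (v 0 + Υ * δ)) =o[𝓝 (0 : ℝ≥0)] (fun δ : ℝ≥0 => (δ : ℝ)) ∧
      Tendsto (fun δ : ℝ≥0 => (v δ - v 0) / δ) (𝓝[>] (0 : ℝ≥0)) (𝓝 Υ) ∧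
      (∀ B : Icc (0 : ℝ) T → CausalDRO.PathSpace T d → Fin d → ℝ,
        CausalDRO.IsOptionalProjection μ (CausalDRO.completedFiltration μ) Df B →
        (Υ : EReal) = CausalDRO.convexConjugate L (CausalDRO.processNorm q μ B)) ∧
      (Υ : EReal) = CausalDRO.convexConjugate L (CausalDRO.processNorm q μ
        (fun t => μ[Df t | CausalDRO.completedFiltration μ t])) := by
  have hpq : q.HolderConjugate p := ((Real.holderConjugate_iff_eq_conjExponent hp).2 hq).symm
  have hp0 : 0 < p := hpq.symm.pos
  have hμ' := CausalDRO.lintegral_enorm_rpow_ne_top hp0.le hμ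
  have hfμ := CausalDRO.integrable_of_growth hf.continuous hf_growth hμ
  obtain ⟨Υ, hΥ, hΥ1, hΥ2⟩ := CausalDRO.exists_convexConjugate_eq hL_zero hL_growth hp.le
    (hf.processNorm_ne_top (μ := μ) hpq hDf_growth hμ')
  obtain ⟨C, hC, hC1⟩ := hf.exists_integral_sub_le hT hpq hDf_growth hμ' hfμ
  have hbounds : ∀ ε > 0, ∃ δ₀ : ℝ≥0, 0 < δ₀ ∧ ∀ δ : ℝ≥0, 0 < δ → δ < δ₀ →
      CausalDRO.robustValue p L μ f δ ≤ ((∫ ω, f ω ∂μ + δ * (Υ + ε) : ℝ) : EReal) ∧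
      ((∫ ω, f ω ∂μ + δ * (Υ - ε) : ℝ) : EReal) ≤ CausalDRO.robustValue p L μ f δ :=
    fun ε hε => by
    obtain ⟨δ₁, hδ₁, h1⟩ := CausalDRO.exists_penalized_le
      (D := fun ν : Measure (CausalDRO.PathSpace T d) => ∫ x, f x ∂ν - ∫ x, f x ∂μ)
      (W := fun ν => CausalDRO.causalCost p μ ν ^ (1 / p)) hp hC ENNReal.toReal_nonneg hL_growth
      hL_zero hC1 (fun ε hε => hf.exists_integral_sub_le_of_lt hT hpq hDf_growth hμ' hfμ hε)
      hΥ1 hε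
    -- For the lower bound the competitor must be admissible in the supremum, so the index runs over
    -- probability measures only.
    obtain ⟨δ₂, hδ₂, h2⟩ := CausalDRO.exists_le_penalized
      (D := fun ν : {ν : Measure (CausalDRO.PathSpace T d) // IsProbabilityMeasure ν} =>
        ∫ x, f x ∂ν.1 - ∫ x, f x ∂μ)
      (W := fun ν => CausalDRO.causalCost p μ ν.1 ^ (1 / p)) hL_mono (fun ε hε => by
        obtain ⟨η, hη, h⟩ := hf.exists_measure_le_integral_sub hT hpq hDf_growth hμ' hfμ hε
        refine ⟨η, hη, fun w hw hwη => ?_⟩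
        obtain ⟨ν, hν, h3, h4⟩ := h w hw hwη
        exact ⟨⟨ν, hν⟩, h3, h4⟩) hΥ2 hε
    refine ⟨min δ₁ δ₂, lt_min hδ₁ hδ₂, fun δ hδ hδm => ⟨?_, ?_⟩⟩
    · refine CausalDRO.robustValue_le hδ fun ν w _ hw hLw => ?_
      have h3 := h1 δ hδ (hδm.trans_le (min_le_left _ _)) ν w hw hLw
      linarith
    · obtain ⟨ν, w, hw, hLw, h3⟩ := h2 δ hδ (hδm.trans_le (min_le_right _ _))
      exact CausalDRO.le_robustValue hδ ν.1 w ν.2 hw hLw (by linarith)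
  obtain ⟨v, hv1, hv2, hv3, hv4⟩ := CausalDRO.exists_derivative_of_bounds
    (CausalDRO.robustValue_zero (L := L) hT.le hp0 hC1) hbounds
  refine ⟨v, Υ, hv1, hv2, hv3, hv4, fun B hB => ?_, hΥ⟩
  rw [hΥ, CausalDRO.processNorm_congr hB.ae_eq]
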